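/- Conventions. A 2-functor is a pseudo-functor whose structure cells are identities. A 2-functor $T\colon \mathbb C\to\mathbb D$ is a 2-equivalence if there is a 2-functor $S\colon\mathbb D\to\mathbb C$ together with 2-natural isomorphisms $ST\cong 1_{\mathbb C}$ and $TS\cong 1_{\mathbb D}$. For a category $\mathcal B$ and a 2-category $\mathbb D$, $\mathbb D^{\mathcal B^{op}}$ is the 2-category of pseudo-functors $\mathcal B^{op}\to\mathbb D$, oplax natural transformations and modifications, and $\mathbb D^{\mathcal B^{op}}_p$ its 2-subcategory with the same objects and 2-cells whose 1-cells are the pseudo-natural transformations. $FIB(\mathcal B)$ is the 2-category of (Grothendieck) fibrations over $\mathcal B$, functors over $\mathcal B$ and vertical natural transformations. $CAT$ is the 2-category of categories; $MONCAT$ that of monoidal categories, lax monoidal functors (structure morphisms $FX\otimes FY\to F(X\otimes Y)$, $I\to FI$) and monoidal natural transformations; $MONCAT_s$ has the same objects and 2-cells but only the strong monoidal functors (invertible structure morphisms). A monoidal fibred category over $\mathcal B$ is a fibration $P\colon\mathcal E\to\mathcal B$ with functors $\otimes\colon\mathcal E\times_{\mathcal B}\mathcal E\to\mathcal E$ and $u\colon\mathcal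 B\to\mathcal E$ over $\mathcal B$ and vertical natural associativity and unit isomorphisms satisfying the usual coherence axioms; it is strong if $\otimes$ and $u$ preserve Cartesian arrows. A monoidal functor over $\mathcal B$ is a functor $F\colon\mathcal D\to\mathcal E$ over $\mathcal B$ with vertical natural transformations $FD\otimes FD'\to F(D\otimes D')$ and $u_{\mathcal E}\to F u_{\mathcal D}$ satisfying the usual coherence axioms; it is strong if these are invertible (it is not required to preserve Cartesian arrows). With the vertical natural transformations that are monoidal these form a 2-category $MONFIB(\mathcal B)$; $MONFIB_s(\mathcal B)$ is its 2-subcategory of strong objects and strong 1-cells, with all 2-cells between them. The symmetric variants $SMONFIB(\mathcal B)$, $SMONFIB_s(\mathcal B)$, $SYMMON$, $SYMMON_s$ have symmetries as additional structure on objects (over $\mathcal B$: a vertical natural isomorphism $D\otimes D'\cong D'\otimes D$ that is a symmetry in each fibre) and 1-cells compatible with them. The correspondence. Choose a cleavage of every fibration over $\mathcal B$. To a fibration $P\colon\mathcal E\to\mathcal B$ associate the pseudo-functor $\Phi_P\colon\mathcal B^{op}\to CAT$, $A\mapsto\mathcal E_A$, $f\mapsto f^*$, with the structure isomorphisms given by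 the universal property of Cartesian arrows; to a functor $F$ over $\mathcal B$ the oplax natural transformation $\tau_F$ with components the restrictions $F_A$ and structure morphisms $F(f^*D)\to f^*(FD)$ induced by $F(\bar f_D)$, where $\bar f_D\colon f^*D\to D$ is the chosen Cartesian arrow; to a vertical natural transformation the modification formed by its restrictions to fibres. If $P$ is monoidal, the fibres are monoidal, and $f^*$ is monoidal via the morphisms $f^*D\otimes f^*E\to f^*(D\otimes E)$ and $I_A\to f^*I_B$ induced by $\bar f_D\otimes\bar f_E$ and $u(f)$; likewise monoidal functors and transformations over $\mathcal B$ restrict to monoidal ones on the fibres. Theorem. For every choice of cleavages: 1. The correspondence is a 2-equivalence $FIB(\mathcal B)\to CAT^{\mathcal B^{op}}$, and it restricts to a 2-equivalence between Cartesian functors over $\mathcal B$ and pseudo-natural transformations. 2. The correspondence is a 2-equivalence $MONFIB(\mathcal B)\to MONCAT^{\mathcal B^{op}}$ lifting the one of 1: the square with the forgetful 2-functors $MONFIB(\mathcal B)\to FIB(\mathcal B)$ and $MONCAT^{\mathcal B^{op}}\to CAT^{\mathcal B^{op}}$ commutes. 3. It restricts to strong objects and morphisms, as a 2-equivalence $MONFIB_s(\mathcal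 B)\to (MONCAT_s)^{\mathcal B^{op}}$. 4. The 2-equivalences of 2 and 3 restrict to 2-equivalences when the 1-cells of the domains are restricted to Cartesian functors (those preserving Cartesian arrows) and the 1-cells of the codomains to pseudo-natural transformations (i.e. the codomains become $(-)^{\mathcal B^{op}}_p$). 5. The four 2-equivalences of 2, 3, 4 induce 2-equivalences on the symmetric variants: $SMONFIB(\mathcal B)\to SYMMON^{\mathcal B^{op}}$, $SMONFIB_s(\mathcal B)\to (SYMMON_s)^{\mathcal B^{op}}$, and their restrictions to Cartesian functors and pseudo-natural transformations; the first two lift, through the forgetful 2-functors, the 2-equivalence of 2, and the last two restrict the first two. -/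

import Mathlib

open CategoryTheory Bicategory
open scoped CategoryTheory.Oplax.OplaxTrans.OplaxFunctor CategoryTheory.Oplax.OplaxTrans

set_option linter.unusedVariables false
set_option linter.checkUnivs false
set_option linter.style.haveILetI false

universe w v u w' v' u' s t s' t' w₁ v₁ u₁ v₂ u₂

namespace FibMon

/-- Extra structure on the objects and 1-cells of a bicategory, and a condition on its 2-cells. -/
structure Layer (C : Type u) [Bicategory.{w, v} C] where
  /-- structure on an object -/
  Str : C → Type s
  /-- structure on a 1-cell -/
  Hom : ∀ {a b : C}, Str a → Str b → (a ⟶ b) → Type t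
  /-- condition on a 2-cell -/
  Two : ∀ {a b : C} {x : Str a} {y : Str b} {f g : a ⟶ b}, Hom x y f → Hom x y g → (f ⟶ g) → Prop
  idHom : ∀ {a : C} (x : Str a), Hom x x (𝟙 a)
  compHom : ∀ {a b c : C} {x : Str a} {y : Str b} {z : Str c} {f : a ⟶ b} {g : b ⟶ c},
    Hom x y f → Hom y z g → Hom x z (f ≫ g)
  two_id : ∀ {a b : C} {x : Str a} {y : Str b} {f : a ⟶ b} (h : Hom x y f), Two h h (𝟙 f)
  two_comp : ∀ {a b : C} {x : Str a} {y : Str b} {f g k : a ⟶ b} {hf : Hom x y f} {hg : Hom x y g}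
    {hk : Hom x y k} {α : f ⟶ g} {β : g ⟶ k}, Two hf hg α → Two hg hk β → Two hf hk (α ≫ β)
  two_whiskerLeft : ∀ {a b c : C} {x : Str a} {y : Str b} {z : Str c} {f : a ⟶ b} {g k : b ⟶ c}
    (hf : Hom x y f) {hg : Hom y z g} {hk : Hom y z k} {α : g ⟶ k},
    Two hg hk α → Two (compHom hf hg) (compHom hf hk) (f ◁ α)
  two_whiskerRight : ∀ {a b c : C} {x : Str a} {y : Str b} {z : Str c} {f g : a ⟶ b} {k : b ⟶ c}
    {hf : Hom x y f} {hg : Hom x y g} {α : f ⟶ g} (hk : Hom y z k),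
    Two hf hg α → Two (compHom hf hk) (compHom hg hk) (α ▷ k)
  two_associator : ∀ {a b c d : C} {x : Str a} {y : Str b} {z : Str c} {w : Str d}
    {f : a ⟶ b} {g : b ⟶ c} {k : c ⟶ d} (hf : Hom x y f) (hg : Hom y z g) (hk : Hom z w k),
    Two (compHom (compHom hf hg) hk) (compHom hf (compHom hg hk)) (α_ f g k).hom
  two_associator_inv : ∀ {a b c d : C} {x : Str a} {y : Str b} {z : Str c} {w : Str d}
    {f : a ⟶ b} {g : b ⟶ c} {k : c ⟶ d} (hf : Hom x y f) (hg : Hom y z g) (hk : Hom z w k),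
    Two (compHom hf (compHom hg hk)) (compHom (compHom hf hg) hk) (α_ f g k).inv
  two_leftUnitor : ∀ {a b : C} {x : Str a} {y : Str b} {f : a ⟶ b} (hf : Hom x y f),
    Two (compHom (idHom x) hf) hf (λ_ f).hom
  two_leftUnitor_inv : ∀ {a b : C} {x : Str a} {y : Str b} {f : a ⟶ b} (hf : Hom x y f),
    Two hf (compHom (idHom x) hf) (λ_ f).inv
  two_rightUnitor : ∀ {a b : C} {x : Str a} {y : Str b} {f : a ⟶ b} (hf : Hom x y f),
    Two (compHom hf (idHom y)) hf (ρ_ f).hom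
  two_rightUnitor_inv : ∀ {a b : C} {x : Str a} {y : Str b} {f : a ⟶ b} (hf : Hom x y f),
    Two hf (compHom hf (idHom y)) (ρ_ f).inv

namespace Layer

variable {C : Type u} [Bicategory.{w, v} C] (L : Layer.{w, v, u, s, t} C)

/-- Objects of `C` with structure. -/
structure Total where
  /-- the underlying object -/
  base : C
  /-- its structure -/
  str : L.Str base

variable {L}

namespace Total

/-- 1-cells with structure. -/
structure Hom (x y : L.Total) where
  /-- the underlying 1-cell -/
  base : x.base ⟶ y.base
  /-- its structure -/
  str : L.Hom x.str y.str base

instance : CategoryStruct L.Total where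
  Hom := Hom
  id x := ⟨𝟙 x.base, L.idHom x.str⟩
  comp f g := ⟨f.base ≫ g.base, L.compHom f.str g.str⟩

/-- 2-cells satisfying the condition. -/
@[ext]
structure Hom₂ {x y : L.Total} (f g : x ⟶ y) where
  /-- the underlying 2-cell -/
  base : f.base ⟶ g.base
  prop : L.Two f.str g.str base

instance (x y : L.Total) : Category (x ⟶ y) where
  Hom := Hom₂
  id f := ⟨𝟙 f.base, L.two_id _⟩
  comp α β := ⟨α.base ≫ β.base, L.two_comp α.prop β.prop⟩
  id_comp α := Hom₂.ext (Category.id_comp α.base)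
  comp_id α := Hom₂.ext (Category.comp_id α.base)
  assoc α β γ := Hom₂.ext (Category.assoc α.base β.base γ.base)

@[ext]
theorem hom₂_ext {x y : L.Total} {f g : x ⟶ y} {α β : f ⟶ g} (h : α.base = β.base) : α = β :=
  Hom₂.ext h

@[simp] theorem id_base {x y : L.Total} (f : x ⟶ y) : Hom₂.base (𝟙 f) = 𝟙 f.base := rfl
@[simp] theorem comp_base {x y : L.Total} {f g h : x ⟶ y} (α : f ⟶ g) (β : g ⟶ h) :
    Hom₂.base (α ≫ β) = α.base ≫ β.base := rfl

/-- An invertible 2-cell with both directions satisfying the condition. -/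
def isoMk {x y : L.Total} {f g : x ⟶ y} (e : f.base ≅ g.base) (h : L.Two f.str g.str e.hom)
    (h' : L.Two g.str f.str e.inv) : f ≅ g where
  hom := ⟨e.hom, h⟩
  inv := ⟨e.inv, h'⟩
  hom_inv_id := Hom₂.ext e.hom_inv_id
  inv_hom_id := Hom₂.ext e.inv_hom_id

instance bicategory : Bicategory L.Total where
  whiskerLeft f _ _ α := Hom₂.mk (Hom.base f ◁ Hom₂.base α) (L.two_whiskerLeft _ (Hom₂.prop α))
  whiskerRight α g := Hom₂.mk (Hom₂.base α ▷ Hom.base g) (L.two_whiskerRight _ (Hom₂.prop α))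
  associator f g h := isoMk (α_ f.base g.base h.base) (L.two_associator _ _ _)
    (L.two_associator_inv _ _ _)
  leftUnitor f := isoMk (λ_ f.base) (L.two_leftUnitor _) (L.two_leftUnitor_inv _)
  rightUnitor f := isoMk (ρ_ f.base) (L.two_rightUnitor _) (L.two_rightUnitor_inv _)
  whiskerLeft_id _ _ := Hom₂.ext (Bicategory.whiskerLeft_id _ _)
  whiskerLeft_comp _ _ _ _ _ _ := Hom₂.ext (Bicategory.whiskerLeft_comp _ _ _)
  id_whiskerLeft _ := Hom₂.ext (Bicategory.id_whiskerLeft _)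
  comp_whiskerLeft _ _ _ _ _ := Hom₂.ext (Bicategory.comp_whiskerLeft _ _ _)
  id_whiskerRight _ _ := Hom₂.ext (Bicategory.id_whiskerRight _ _)
  comp_whiskerRight _ _ _ := Hom₂.ext (Bicategory.comp_whiskerRight _ _ _)
  whiskerRight_id _ := Hom₂.ext (Bicategory.whiskerRight_id _)
  whiskerRight_comp _ _ _ := Hom₂.ext (Bicategory.whiskerRight_comp _ _ _)
  whisker_assoc _ _ _ _ _ := Hom₂.ext (Bicategory.whisker_assoc _ _ _)
  whisker_exchange _ _ := Hom₂.ext (Bicategory.whisker_exchange _ _)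
  pentagon _ _ _ _ := Hom₂.ext (Bicategory.pentagon _ _ _ _)
  triangle _ _ := Hom₂.ext (Bicategory.triangle _ _)

theorem hom_ext {x y : L.Total} {f g : x ⟶ y} (h : f.base = g.base) (h' : f.str ≍ g.str) :
    f = g := by
  obtain ⟨f, f'⟩ : Hom x y := f
  obtain ⟨g, g'⟩ : Hom x y := g
  obtain rfl : f = g := h
  obtain rfl : f' = g' := eq_of_heq h'
  rfl

@[simp] theorem eqToHom_base {x y : L.Total} {f g : x ⟶ y} (h : f = g) :
    (eqToHom h : f ⟶ g).base = eqToHom (congrArg Hom.base h) := by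
  subst h; rfl

end Total

variable (L) in
/-- The 2-functor forgetting the structure. -/
def forget : StrictPseudofunctor L.Total C :=
  StrictPseudofunctor.mk'
    { obj := fun x => x.base
      map := fun f => Total.Hom.base f
      map₂ := fun α => Total.Hom₂.base α
      map_id := fun _ => rfl
      map_comp := fun _ _ => rfl
      map₂_id := fun _ => rfl
      map₂_comp := fun _ _ => rfl
      map₂_whisker_left := fun _ _ _ _ => by simp; rfl
      map₂_whisker_right := fun _ _ => by simp; rfl
      map₂_left_unitor := fun _ => by simp; rfl
      map₂_right_unitor := fun _ => by simp; rfl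
      map₂_associator := fun _ _ _ => by simp; rfl }

/-- Two structures side by side. -/
def prod (L' : Layer.{w, v, u, s', t'} C) : Layer C where
  Str a := L.Str a × L'.Str a
  Hom x y f := L.Hom x.1 y.1 f × L'.Hom x.2 y.2 f
  Two h k α := L.Two h.1 k.1 α ∧ L'.Two h.2 k.2 α
  idHom x := (L.idHom x.1, L'.idHom x.2)
  compHom h k := (L.compHom h.1 k.1, L'.compHom h.2 k.2)
  two_id h := ⟨L.two_id _, L'.two_id _⟩
  two_comp h k := ⟨L.two_comp h.1 k.1, L'.two_comp h.2 k.2⟩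
  two_whiskerLeft f _ _ _ h := ⟨L.two_whiskerLeft f.1 h.1, L'.two_whiskerLeft f.2 h.2⟩
  two_whiskerRight f h := ⟨L.two_whiskerRight f.1 h.1, L'.two_whiskerRight f.2 h.2⟩
  two_associator f g h := ⟨L.two_associator _ _ _, L'.two_associator _ _ _⟩
  two_associator_inv f g h := ⟨L.two_associator_inv _ _ _, L'.two_associator_inv _ _ _⟩
  two_leftUnitor f := ⟨L.two_leftUnitor _, L'.two_leftUnitor _⟩
  two_leftUnitor_inv f := ⟨L.two_leftUnitor_inv _, L'.two_leftUnitor_inv _⟩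
  two_rightUnitor f := ⟨L.two_rightUnitor _, L'.two_rightUnitor _⟩
  two_rightUnitor_inv f := ⟨L.two_rightUnitor_inv _, L'.two_rightUnitor_inv _⟩

end Layer

/-- Pseudo-functors `J → C`, oplax natural transformations and modifications. -/
abbrev Psd (J : Type u₁) [Bicategory.{w₁, v₁} J] (C : Type u) [Bicategory.{w, v} C] :=
  InducedBicategory (J ⥤ᵒᵖᴸ C) (fun Φ : J ⥤ᵖ C => Φ.toOplax)

namespace Layer

variable {J : Type u₁} [Bicategory.{w₁, v₁} J]
variable {C : Type u} [Bicategory.{w, v} C] (L : Layer.{w, v, u, s, t} C)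

/-- A lift of a pseudo-functor along the functor forgetting the structure. -/
structure PsdStr (Φ : J ⥤ᵖ C) where
  str : ∀ a, L.Str (Φ.obj a)
  hom : ∀ {a b : J} (f : a ⟶ b), L.Hom (str a) (str b) (Φ.map f)
  two_map₂ : ∀ {a b : J} {f g : a ⟶ b} (α : f ⟶ g), L.Two (hom f) (hom g) (Φ.map₂ α)
  two_mapId : ∀ a, L.Two (hom (𝟙 a)) (L.idHom (str a)) (Φ.mapId a).hom
  two_mapId_inv : ∀ a, L.Two (L.idHom (str a)) (hom (𝟙 a)) (Φ.mapId a).inv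
  two_mapComp : ∀ {a b c : J} (f : a ⟶ b) (g : b ⟶ c),
    L.Two (hom (f ≫ g)) (L.compHom (hom f) (hom g)) (Φ.mapComp f g).hom
  two_mapComp_inv : ∀ {a b c : J} (f : a ⟶ b) (g : b ⟶ c),
    L.Two (L.compHom (hom f) (hom g)) (hom (f ≫ g)) (Φ.mapComp f g).inv

variable {L}

/-- A lift of an oplax natural transformation along the functor forgetting the structure. -/
structure PsdHom {Φ Ψ : J ⥤ᵖ C} (X : L.PsdStr Φ) (Y : L.PsdStr Ψ)
    (τ : Oplax.OplaxTrans Φ.toOplax Ψ.toOplax) where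
  app : ∀ a, L.Hom (X.str a) (Y.str a) (τ.app a)
  two_naturality : ∀ {a b : J} (f : a ⟶ b),
    L.Two (L.compHom (X.hom f) (app b)) (L.compHom (app a) (Y.hom f)) (τ.naturality f)

/-- Structures along the components of a pseudo-functor. -/
def psd (J : Type u₁) [Bicategory.{w₁, v₁} J] (L : Layer.{w, v, u, s, t} C) :
    Layer (Psd J C) where
  Str Φ := L.PsdStr (J := J) Φ
  Hom X Y τ := PsdHom X Y τ.hom
  Two h k Γ := ∀ a, L.Two (h.app a) (k.app a) (Γ.hom.as.app a)
  idHom X :=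
    { app := fun a => L.idHom (X.str a)
      two_naturality := fun f => L.two_comp (L.two_rightUnitor _) (L.two_leftUnitor_inv _) }
  compHom h k :=
    { app := fun a => L.compHom (h.app a) (k.app a)
      two_naturality := fun f =>
        L.two_comp (L.two_associator_inv _ _ _) <|
        L.two_comp (L.two_whiskerRight _ (h.two_naturality f)) <|
        L.two_comp (L.two_associator _ _ _) <|
        L.two_comp (L.two_whiskerLeft _ (k.two_naturality f)) (L.two_associator_inv _ _ _) }
  two_id h a := L.two_id _
  two_comp h k a := L.two_comp (h a) (k a)
  two_whiskerLeft h _ _ _ k a := L.two_whiskerLeft _ (k a)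
  two_whiskerRight h k a := L.two_whiskerRight _ (k a)
  two_associator _ _ _ a := L.two_associator _ _ _
  two_associator_inv _ _ _ a := L.two_associator_inv _ _ _
  two_leftUnitor _ a := L.two_leftUnitor _
  two_leftUnitor_inv _ a := L.two_leftUnitor_inv _
  two_rightUnitor _ a := L.two_rightUnitor _
  two_rightUnitor_inv _ a := L.two_rightUnitor_inv _

/-- The lifted pseudo-functor. -/
def PsdStr.toPsd {Φ : J ⥤ᵖ C} (X : L.PsdStr Φ) : J ⥤ᵖ L.Total where
  obj a := ⟨Φ.obj a, X.str a⟩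
  map f := Total.Hom.mk (Φ.map f) (X.hom f)
  map₂ α := Total.Hom₂.mk (Φ.map₂ α) (X.two_map₂ α)
  map₂_id f := Total.hom₂_ext (Φ.map₂_id f)
  map₂_comp α β := Total.hom₂_ext (Φ.map₂_comp α β)
  mapId a := Total.isoMk (Φ.mapId a) (X.two_mapId a) (X.two_mapId_inv a)
  mapComp f g := Total.isoMk (Φ.mapComp f g) (X.two_mapComp f g) (X.two_mapComp_inv f g)
  map₂_whisker_left f _ _ α := Total.hom₂_ext (Φ.map₂_whisker_left f α)
  map₂_whisker_right α f := Total.hom₂_ext (Φ.map₂_whisker_right α f)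
  map₂_associator f g h := Total.hom₂_ext (Φ.map₂_associator f g h)
  map₂_left_unitor f := Total.hom₂_ext (Φ.map₂_left_unitor f)
  map₂_right_unitor f := Total.hom₂_ext (Φ.map₂_right_unitor f)

/-- The lifted oplax natural transformation. -/
def PsdHom.toTrans {Φ Ψ : J ⥤ᵖ C} {X : L.PsdStr Φ} {Y : L.PsdStr Ψ}
    {τ : Oplax.OplaxTrans Φ.toOplax Ψ.toOplax} (h : PsdHom X Y τ) :
    Oplax.OplaxTrans X.toPsd.toOplax Y.toPsd.toOplax where
  app a := Total.Hom.mk (τ.app a) (h.app a)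
  naturality f := Total.Hom₂.mk (τ.naturality f) (h.two_naturality f)
  naturality_naturality α := Total.hom₂_ext (τ.naturality_naturality α)
  naturality_id a := Total.hom₂_ext (τ.naturality_id a)
  naturality_comp f g := Total.hom₂_ext (τ.naturality_comp f g)

theorem psd_eqToHom_app {D : Type u'} [Bicategory.{w', v'} D] {Φ Ψ : Psd J D} {f g : Φ ⟶ Ψ}
    (h : f = g) (a : J) :
    (eqToHom h : f ⟶ g).hom.as.app a = eqToHom (by rw [h]) := by
  subst h; rfl

/-- A pseudo-functor with structures on its components is the same thing as a pseudo-functor to the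
bicategory of objects with structure. -/
def psdTotal (J : Type u₁) [Bicategory.{w₁, v₁} J] (L : Layer.{w, v, u, s, t} C) :
    StrictPseudofunctor (L.psd J).Total (Psd J L.Total) :=
  StrictPseudofunctor.mk'
    { obj := fun X => X.str.toPsd
      map := fun f => InducedBicategory.mkHom (Total.Hom.str f).toTrans
      map₂ := fun α => ⟨⟨⟨fun a => Total.Hom₂.mk ((Total.Hom₂.base α).hom.as.app a)
        (Total.Hom₂.prop α a), fun f => Total.hom₂_ext
          ((Total.Hom₂.base α).hom.as.naturality f)⟩⟩⟩
      map₂_id := fun _ => rfl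
      map₂_comp := fun _ _ => rfl
      map_id := fun _ => rfl
      map_comp := fun _ _ => rfl
      map₂_whisker_left := fun _ _ _ _ => by
        refine InducedBicategory.hom₂_ext (Oplax.OplaxTrans.homCategory.ext fun a => ?_)
        refine Total.hom₂_ext ?_
        exact ((Category.id_comp _).trans (Category.comp_id _)).symm
      map₂_whisker_right := fun _ _ => by
        refine InducedBicategory.hom₂_ext (Oplax.OplaxTrans.homCategory.ext fun a => ?_)
        refine Total.hom₂_ext ?_
        exact ((Category.id_comp _).trans (Category.comp_id _)).symm
      map₂_left_unitor := fun f => by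
        refine InducedBicategory.hom₂_ext (Oplax.OplaxTrans.homCategory.ext fun a => ?_)
        refine Total.hom₂_ext ?_
        exact (Category.id_comp _).symm
      map₂_right_unitor := fun f => by
        refine InducedBicategory.hom₂_ext (Oplax.OplaxTrans.homCategory.ext fun a => ?_)
        refine Total.hom₂_ext ?_
        exact (Category.id_comp _).symm
      map₂_associator := fun f g h => by
        refine InducedBicategory.hom₂_ext (Oplax.OplaxTrans.homCategory.ext fun a => ?_)
        refine Total.hom₂_ext ?_
        exact ((Category.id_comp _).trans (Category.comp_id _)).symm }

end Layer

namespace Layer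

variable {J : Type u₁} [Bicategory.{w₁, v₁} J]
variable {C : Type u} [Bicategory.{w, v} C] (L : Layer.{w, v, u, s, t} C)

/-- The base of an invertible 2-cell. -/
def Total.isoBase {L : Layer.{w, v, u, s, t} C} {x y : L.Total} {f g : x ⟶ y} (e : f ≅ g) :
    f.base ≅ g.base where
  hom := e.hom.base
  inv := e.inv.base
  hom_inv_id := congrArg Total.Hom₂.base e.hom_inv_id
  inv_hom_id := congrArg Total.Hom₂.base e.inv_hom_id

variable {L} in
/-- The pseudo-functor underlying a pseudo-functor to objects with structure. -/
def basePsd (Φ : J ⥤ᵖ L.Total) : J ⥤ᵖ C where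
  obj a := (Φ.obj a).base
  map f := (Φ.map f).base
  map₂ α := (Φ.map₂ α).base
  map₂_id f := congrArg Total.Hom₂.base (Φ.map₂_id f)
  map₂_comp α β := congrArg Total.Hom₂.base (Φ.map₂_comp α β)
  mapId a := Total.isoBase (Φ.mapId a)
  mapComp f g := Total.isoBase (Φ.mapComp f g)
  map₂_whisker_left f _ _ α := congrArg Total.Hom₂.base (Φ.map₂_whisker_left f α)
  map₂_whisker_right α f := congrArg Total.Hom₂.base (Φ.map₂_whisker_right α f)
  map₂_associator f g h := congrArg Total.Hom₂.base (Φ.map₂_associator f g h)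
  map₂_left_unitor f := congrArg Total.Hom₂.base (Φ.map₂_left_unitor f)
  map₂_right_unitor f := congrArg Total.Hom₂.base (Φ.map₂_right_unitor f)

variable {L} in
/-- The oplax transformation underlying one between pseudo-functors to objects with structure. -/
def baseTrans {Φ Ψ : J ⥤ᵖ L.Total} (τ : Oplax.OplaxTrans Φ.toOplax Ψ.toOplax) :
    Oplax.OplaxTrans (basePsd Φ).toOplax (basePsd Ψ).toOplax where
  app a := (τ.app a).base
  naturality f := (τ.naturality f).base
  naturality_naturality α := congrArg Total.Hom₂.base (τ.naturality_naturality α)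
  naturality_id a := congrArg Total.Hom₂.base (τ.naturality_id a)
  naturality_comp f g := congrArg Total.Hom₂.base (τ.naturality_comp f g)

variable (J) in
/-- Composition with the 2-functor forgetting the structure. -/
def psdForget : StrictPseudofunctor (Psd J L.Total) (Psd J C) :=
  StrictPseudofunctor.mk'
    { obj := fun Φ => basePsd Φ
      map := fun τ => InducedBicategory.mkHom (baseTrans τ.hom)
      map₂ := fun Γ => ⟨⟨⟨fun a => (Γ.hom.as.app a).base, fun f =>
        congrArg Total.Hom₂.base (Γ.hom.as.naturality f)⟩⟩⟩
      map₂_id := fun _ => rfl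
      map₂_comp := fun _ _ => rfl
      map_id := fun _ => rfl
      map_comp := fun _ _ => rfl
      map₂_whisker_left := fun _ _ _ _ => by
        refine InducedBicategory.hom₂_ext (Oplax.OplaxTrans.homCategory.ext fun a => ?_)
        exact ((Category.id_comp _).trans (Category.comp_id _)).symm
      map₂_whisker_right := fun _ _ => by
        refine InducedBicategory.hom₂_ext (Oplax.OplaxTrans.homCategory.ext fun a => ?_)
        exact ((Category.id_comp _).trans (Category.comp_id _)).symm
      map₂_left_unitor := fun f => by
        refine InducedBicategory.hom₂_ext (Oplax.OplaxTrans.homCategory.ext fun a => ?_)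
        exact (Category.id_comp _).symm
      map₂_right_unitor := fun f => by
        refine InducedBicategory.hom₂_ext (Oplax.OplaxTrans.homCategory.ext fun a => ?_)
        exact (Category.id_comp _).symm
      map₂_associator := fun f g h => by
        refine InducedBicategory.hom₂_ext (Oplax.OplaxTrans.homCategory.ext fun a => ?_)
        exact ((Category.id_comp _).trans (Category.comp_id _)).symm }

variable {D : Type u'} [Bicategory.{w', v'} D]

/-- A way of lifting a 2-functor to objects with structure. -/
structure Lift (T : StrictPseudofunctor C D) (M : Layer.{w, v, u, s, t} C)
    (N : Layer.{w', v', u', s', t'} D) where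
  str : ∀ {c : C}, M.Str c → N.Str (T.obj c)
  hom : ∀ {c d : C} {x : M.Str c} {y : M.Str d} {f : c ⟶ d},
    M.Hom x y f → N.Hom (str x) (str y) (T.map f)
  two : ∀ {c d : C} {x : M.Str c} {y : M.Str d} {f g : c ⟶ d} {h : M.Hom x y f} {k : M.Hom x y g}
    {α : f ⟶ g}, M.Two h k α → N.Two (hom h) (hom k) (T.map₂ α)
  hom_id : ∀ {c : C} (x : M.Str c), hom (M.idHom x) ≍ N.idHom (str x)
  hom_comp : ∀ {c d e : C} {x : M.Str c} {y : M.Str d} {z : M.Str e} {f : c ⟶ d} {g : d ⟶ e}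
    (h : M.Hom x y f) (k : M.Hom y z g), hom (M.compHom h k) ≍ N.compHom (hom h) (hom k)

/-- The lifted 2-functor. -/
def Lift.functor {T : StrictPseudofunctor C D} {M : Layer.{w, v, u, s, t} C}
    {N : Layer.{w', v', u', s', t'} D} (l : Lift T M N) : StrictPseudofunctor M.Total N.Total :=
  StrictPseudofunctor.mk'
    { obj := fun x => ⟨T.obj x.base, l.str x.str⟩
      map := fun f => Total.Hom.mk (T.map (Total.Hom.base f)) (l.hom (Total.Hom.str f))
      map₂ := fun α => Total.Hom₂.mk (T.map₂ (Total.Hom₂.base α)) (l.two (Total.Hom₂.prop α))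
      map₂_id := fun f => Total.hom₂_ext (T.map₂_id (Total.Hom.base f))
      map₂_comp := fun α β =>
        Total.hom₂_ext (T.map₂_comp (Total.Hom₂.base α) (Total.Hom₂.base β))
      map_id := fun x => Total.hom_ext (T.map_id x.base) (l.hom_id x.str)
      map_comp := fun f g => Total.hom_ext (T.map_comp _ _) (l.hom_comp _ _)
      map₂_whisker_left := fun f _ _ α => by
        refine Total.hom₂_ext ?_
        simp only [Total.comp_base, Total.eqToHom_base]
        refine (T.map₂_whisker_left (Total.Hom.base f) (Total.Hom₂.base α)).trans ?_
        simp only [T.mapComp_eq_eqToIso]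
        rfl
      map₂_whisker_right := fun α f => by
        refine Total.hom₂_ext ?_
        simp only [Total.comp_base, Total.eqToHom_base]
        refine (T.map₂_whisker_right (Total.Hom₂.base α) (Total.Hom.base f)).trans ?_
        simp only [T.mapComp_eq_eqToIso]
        rfl
      map₂_left_unitor := fun f => by
        refine Total.hom₂_ext ?_
        simp only [Total.comp_base, Total.eqToHom_base]
        refine (T.map₂_left_unitor (Total.Hom.base f)).trans ?_
        simp [T.mapComp_eq_eqToIso, T.mapId_eq_eqToIso]
        rfl
      map₂_right_unitor := fun f => by
        refine Total.hom₂_ext ?_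
        simp only [Total.comp_base, Total.eqToHom_base]
        refine (T.map₂_right_unitor (Total.Hom.base f)).trans ?_
        simp [T.mapComp_eq_eqToIso, T.mapId_eq_eqToIso]
        rfl
      map₂_associator := fun f g h => by
        refine Total.hom₂_ext ?_
        simp only [Total.comp_base, Total.eqToHom_base]
        refine (T.map₂_associator (Total.Hom.base f) (Total.Hom.base g) (Total.Hom.base h)).trans ?_
        simp [T.mapComp_eq_eqToIso]
        rfl }

end Layer
end FibMon

namespace FibMon

/-- Objects satisfying a property, with all 1-cells and 2-cells. -/
def objLayer {C : Type u} [Bicategory.{w, v} C] (P : C → Prop) : Layer.{w, v, u, 0, 0} C where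
  Str a := PLift (P a)
  Hom _ _ _ := PUnit
  Two _ _ _ := True
  idHom _ := ⟨⟩
  compHom _ _ := ⟨⟩
  two_id _ := trivial
  two_comp _ _ := trivial
  two_whiskerLeft _ _ _ _ _ := trivial
  two_whiskerRight _ _ := trivial
  two_associator _ _ _ := trivial
  two_associator_inv _ _ _ := trivial
  two_leftUnitor _ := trivial
  two_leftUnitor_inv _ := trivial
  two_rightUnitor _ := trivial
  two_rightUnitor_inv _ := trivial

/-- Objects and 1-cells satisfying a property, with all 2-cells. -/
def propLayer {C : Type u} [Bicategory.{w, v} C] (P : C → Prop)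
    (Q : ∀ {a b : C}, P a → P b → (a ⟶ b) → Prop)
    (id : ∀ {a : C} (ha : P a), Q ha ha (𝟙 a))
    (comp : ∀ {a b c : C} {ha : P a} {hb : P b} {hc : P c} {f : a ⟶ b} {g : b ⟶ c},
      Q ha hb f → Q hb hc g → Q ha hc (f ≫ g)) :
    Layer.{w, v, u, 0, 0} C where
  Str a := PLift (P a)
  Hom x y f := PLift (Q x.down y.down f)
  Two _ _ _ := True
  idHom x := ⟨id x.down⟩
  compHom h k := ⟨comp h.down k.down⟩
  two_id _ := trivial
  two_comp _ _ := trivial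
  two_whiskerLeft _ _ _ _ _ := trivial
  two_whiskerRight _ _ := trivial
  two_associator _ _ _ := trivial
  two_associator_inv _ _ _ := trivial
  two_leftUnitor _ := trivial
  two_leftUnitor_inv _ := trivial
  two_rightUnitor _ := trivial
  two_rightUnitor_inv _ := trivial

section Monoidal

open MonoidalCategory

/-- Monoidal structures on categories, lax monoidal structures on functors, monoidal natural
transformations. -/
def monLayer : Layer.{max v u, max v u, max (v + 1) (u + 1)} Cat.{v, u} where
  Str C := MonoidalCategory C
  Hom {C D} x y F := @Functor.LaxMonoidal C _ x D _ y F.toFunctor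
  Two {C D x y F G} h k α := @NatTrans.IsMonoidal C _ x D _ y F.toFunctor G.toFunctor α.toNatTrans h k
  idHom {C} x := @Functor.LaxMonoidal.id C _ x
  compHom {C D E x y z F G} h k :=
    @Functor.LaxMonoidal.comp C _ x D _ y E _ z F.toFunctor G.toFunctor h k
  two_id {C D x y F} h := @NatTrans.IsMonoidal.id C _ x D _ y F.toFunctor h
  two_comp {C D x y F G H h k l α β} hα hβ :=
    @NatTrans.IsMonoidal.comp C _ x D _ y F.toFunctor G.toFunctor H.toFunctor α.toNatTrans
      h k l β.toNatTrans hα hβ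
  two_whiskerLeft {C D E x y z F G H} hF {hG hH α} hα :=
    @NatTrans.IsMonoidal.whiskerLeft C _ x D _ y E _ z F.toFunctor hF G.toFunctor H.toFunctor
      hG hH α.toNatTrans hα
  two_whiskerRight {C D E x y z F G H hF hG α} hH hα :=
    @NatTrans.IsMonoidal.whiskerRight C _ x D _ y E _ z F.toFunctor G.toFunctor α.toNatTrans
      hF hG H.toFunctor hH hα
  two_associator {C D E E' x y z w F G H} hF hG hH := by
    let _ := x; let _ := y; let _ := z; let _ := w
    let _ : F.toFunctor.LaxMonoidal := hF
    let _ : G.toFunctor.LaxMonoidal := hG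
    let _ : H.toFunctor.LaxMonoidal := hH
    exact inferInstanceAs
      (NatTrans.IsMonoidal (Functor.associator F.toFunctor G.toFunctor H.toFunctor).hom)
  two_associator_inv {C D E E' x y z w F G H} hF hG hH := by
    let _ := x; let _ := y; let _ := z; let _ := w
    let _ : F.toFunctor.LaxMonoidal := hF
    let _ : G.toFunctor.LaxMonoidal := hG
    let _ : H.toFunctor.LaxMonoidal := hH
    exact inferInstanceAs
      (NatTrans.IsMonoidal (Functor.associator F.toFunctor G.toFunctor H.toFunctor).inv)
  two_leftUnitor {C D x y F} hF := by
    let _ := x; let _ := y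
    let _ : F.toFunctor.LaxMonoidal := hF
    exact inferInstanceAs (NatTrans.IsMonoidal F.toFunctor.leftUnitor.hom)
  two_leftUnitor_inv {C D x y F} hF := by
    let _ := x; let _ := y
    let _ : F.toFunctor.LaxMonoidal := hF
    exact inferInstanceAs (NatTrans.IsMonoidal F.toFunctor.leftUnitor.inv)
  two_rightUnitor {C D x y F} hF := by
    let _ := x; let _ := y
    let _ : F.toFunctor.LaxMonoidal := hF
    exact inferInstanceAs (NatTrans.IsMonoidal F.toFunctor.rightUnitor.hom)
  two_rightUnitor_inv {C D x y F} hF := by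
    let _ := x; let _ := y
    let _ : F.toFunctor.LaxMonoidal := hF
    exact inferInstanceAs (NatTrans.IsMonoidal F.toFunctor.rightUnitor.inv)

/-- Monoidal categories, (lax) monoidal functors and monoidal natural transformations. -/
abbrev MonCat := (monLayer.{v, u}).Total

instance (V : MonCat.{v, u}) : MonoidalCategory V.base := V.str

instance {V W : MonCat.{v, u}} (F : V ⟶ W) : F.base.toFunctor.LaxMonoidal := F.str

/-- The monoidal functor has invertible structure morphisms. -/
def IsStrongFunctor {V W : MonCat.{v, u}} (F : V ⟶ W) : Prop :=
  IsIso (Functor.LaxMonoidal.ε F.base.toFunctor) ∧ ∀ X Y : V.base, IsIso (Functor.LaxMonoidal.μ F.base.toFunctor X Y)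

/-- All monoidal categories, strong monoidal functors. -/
def strongLayer : Layer.{max v u, max v u, max (v + 1) (u + 1), 0, 0} MonCat.{v, u} :=
  propLayer (fun _ => True) (fun _ _ F => IsStrongFunctor F)
    (fun {V} _ => ⟨inferInstanceAs (IsIso (𝟙 (𝟙_ V.base))),
      fun X Y => inferInstanceAs (IsIso (𝟙 (X ⊗ Y)))⟩)
    (fun {V W Z _ _ _ F G} hF hG => by
      have := hF.1
      have := hG.1
      refine ⟨inferInstanceAs (IsIso (Functor.LaxMonoidal.ε G.base.toFunctor ≫
        G.base.toFunctor.map (Functor.LaxMonoidal.ε F.base.toFunctor))), fun X Y => ?_⟩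
      have := hF.2 X Y
      have := hG.2 (F.base.toFunctor.obj X) (F.base.toFunctor.obj Y)
      exact inferInstanceAs (IsIso (Functor.LaxMonoidal.μ G.base.toFunctor _ _ ≫
        G.base.toFunctor.map (Functor.LaxMonoidal.μ F.base.toFunctor X Y))))

/-- The monoidal functor is compatible with the given symmetries. -/
def IsSymmetricFunctor {V W : MonCat.{v, u}} (x : SymmetricCategory V.base)
    (y : SymmetricCategory W.base) (F : V ⟶ W) : Prop :=
  ∀ X Y : V.base, Functor.LaxMonoidal.μ F.base.toFunctor X Y ≫ F.base.toFunctor.map (β_ X Y).hom =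
    (β_ (F.base.toFunctor.obj X) (F.base.toFunctor.obj Y)).hom ≫ Functor.LaxMonoidal.μ F.base.toFunctor Y X

theorem IsSymmetricFunctor.id {V : MonCat.{v, u}} (x : SymmetricCategory V.base) :
    IsSymmetricFunctor x x (𝟙 V) :=
  fun X Y => (Category.id_comp (β_ X Y).hom).trans (Category.comp_id _).symm

theorem IsSymmetricFunctor.comp {V W Z : MonCat.{v, u}} {x : SymmetricCategory V.base}
    {y : SymmetricCategory W.base} {z : SymmetricCategory Z.base} {F : V ⟶ W} {G : W ⟶ Z}
    (h : IsSymmetricFunctor x y F) (k : IsSymmetricFunctor y z G) :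
    IsSymmetricFunctor x z (F ≫ G) := by
  intro X Y
  have h₁ := h X Y
  have h₂ := k (F.base.toFunctor.obj X) (F.base.toFunctor.obj Y)
  change (Functor.LaxMonoidal.μ G.base.toFunctor _ _ ≫ G.base.toFunctor.map (Functor.LaxMonoidal.μ F.base.toFunctor X Y)) ≫
      G.base.toFunctor.map (F.base.toFunctor.map (β_ X Y).hom) =
    (β_ (G.base.toFunctor.obj (F.base.toFunctor.obj X))
      (G.base.toFunctor.obj (F.base.toFunctor.obj Y))).hom ≫
        Functor.LaxMonoidal.μ G.base.toFunctor _ _ ≫ G.base.toFunctor.map (Functor.LaxMonoidal.μ F.base.toFunctor Y X)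
  rw [Category.assoc, ← Functor.map_comp, h₁, Functor.map_comp, reassoc_of% h₂]

/-- Symmetries on monoidal categories, and monoidal functors compatible with them. -/
def symLayer : Layer.{max v u, max v u, max (v + 1) (u + 1), max v u, 0} MonCat.{v, u} where
  Str V := SymmetricCategory V.base
  Hom x y F := PLift (IsSymmetricFunctor x y F)
  Two _ _ _ := True
  idHom x := ⟨IsSymmetricFunctor.id x⟩
  compHom h k := ⟨h.down.comp k.down⟩
  two_id _ := trivial
  two_comp _ _ := trivial
  two_whiskerLeft _ _ _ _ _ := trivial
  two_whiskerRight _ _ := trivial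
  two_associator _ _ _ := trivial
  two_associator_inv _ _ _ := trivial
  two_leftUnitor _ := trivial
  two_leftUnitor_inv _ := trivial
  two_rightUnitor _ := trivial
  two_rightUnitor_inv _ := trivial

end Monoidal
end FibMon

namespace FibMon

section Fibre

variable {B : Type u₁} [Category.{v₁} B] {E : Type u} [Category.{v} E] {p : E ⥤ B}

/-- Arrows between objects of fibres, lying over a given arrow of the base. -/
abbrev ArrOver (p : E ⥤ B) {R S : B} (f : R ⟶ S) (a : p.Fiber R) (b : p.Fiber S) : Type v :=
  {φ : a.1 ⟶ b.1 // p.IsHomLift f φ}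

namespace ArrOver

/-- Composition. -/
def comp {R S T : B} {f : R ⟶ S} {g : S ⟶ T} {a : p.Fiber R} {b : p.Fiber S} {c : p.Fiber T}
    (φ : ArrOver p f a b) (ψ : ArrOver p g b c) : ArrOver p (f ≫ g) a c :=
  ⟨φ.1 ≫ ψ.1, by have := φ.2; have := ψ.2; infer_instance⟩

/-- The same arrow over an equal arrow of the base. -/
def cast {R S : B} {f g : R ⟶ S} (h : f = g) {a : p.Fiber R} {b : p.Fiber S}
    (φ : ArrOver p f a b) : ArrOver p g a b :=
  ⟨φ.1, h ▸ φ.2⟩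

/-- The identity. -/
def id {S : B} (a : p.Fiber S) : ArrOver p (𝟙 S) a a := ⟨𝟙 a.1, (𝟙 a : a ⟶ a).2⟩

/-- Precomposition with a vertical arrow. -/
def vcomp {R S : B} {f : R ⟶ S} {a a' : p.Fiber R} {b : p.Fiber S}
    (u : a ⟶ a') (φ : ArrOver p f a' b) : ArrOver p f a b :=
  cast (Category.id_comp f) (comp (f := 𝟙 R) u φ)

/-- Postcomposition with a vertical arrow. -/
def compv {R S : B} {f : R ⟶ S} {a : p.Fiber R} {b b' : p.Fiber S}
    (φ : ArrOver p f a b) (u : b ⟶ b') : ArrOver p f a b' :=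
  cast (Category.comp_id f) (comp (g := 𝟙 S) φ u)

@[simp] theorem comp_val {R S T : B} {f : R ⟶ S} {g : S ⟶ T} {a : p.Fiber R} {b : p.Fiber S}
    {c : p.Fiber T} (φ : ArrOver p f a b) (ψ : ArrOver p g b c) : (comp φ ψ).1 = φ.1 ≫ ψ.1 := rfl

@[simp] theorem cast_val {R S : B} {f g : R ⟶ S} (h : f = g) {a : p.Fiber R} {b : p.Fiber S}
    (φ : ArrOver p f a b) : (cast h φ).1 = φ.1 := rfl

@[simp] theorem id_val {S : B} (a : p.Fiber S) : (id a).1 = 𝟙 a.1 := rfl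

@[simp] theorem vcomp_val {R S : B} {f : R ⟶ S} {a a' : p.Fiber R} {b : p.Fiber S}
    (u : a ⟶ a') (φ : ArrOver p f a' b) : (vcomp u φ).1 = u.1 ≫ φ.1 := rfl

@[simp] theorem compv_val {R S : B} {f : R ⟶ S} {a : p.Fiber R} {b b' : p.Fiber S}
    (φ : ArrOver p f a b) (u : b ⟶ b') : (compv φ u).1 = φ.1 ≫ u.1 := rfl

/-- The arrow is Cartesian. -/
abbrev IsCart {R S : B} {f : R ⟶ S} {a : p.Fiber R} {b : p.Fiber S} (φ : ArrOver p f a b) : Prop :=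
  p.IsStronglyCartesian f φ.1

/-- The vertical arrow induced by a Cartesian arrow. -/
noncomputable def IsCart.lift {R S : B} {f : R ⟶ S} {a c : p.Fiber R} {b : p.Fiber S}
    {φ : ArrOver p f a b} (hφ : φ.IsCart) (ψ : ArrOver p f c b) : c ⟶ a :=
  have := ψ.2
  ⟨Functor.IsStronglyCartesian.map p f φ.1 (Category.id_comp f).symm ψ.1, inferInstance⟩

@[simp] theorem IsCart.lift_fac {R S : B} {f : R ⟶ S} {a c : p.Fiber R} {b : p.Fiber S}
    {φ : ArrOver p f a b} (hφ : φ.IsCart) (ψ : ArrOver p f c b) : (hφ.lift ψ).1 ≫ φ.1 = ψ.1 :=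
  have := ψ.2
  Functor.IsStronglyCartesian.fac p f φ.1 (Category.id_comp f).symm ψ.1

@[simp] theorem IsCart.lift_fac_assoc {R S : B} {f : R ⟶ S} {a c : p.Fiber R} {b : p.Fiber S}
    {φ : ArrOver p f a b} (hφ : φ.IsCart) (ψ : ArrOver p f c b) {z : E} (k : b.1 ⟶ z) :
    (hφ.lift ψ).1 ≫ φ.1 ≫ k = ψ.1 ≫ k := by
  rw [← Category.assoc, hφ.lift_fac]

theorem IsCart.ext {R S : B} {f : R ⟶ S} {a c : p.Fiber R} {b : p.Fiber S}
    {φ : ArrOver p f a b} (hφ : φ.IsCart) {u v : c ⟶ a} (h : u.1 ≫ φ.1 = v.1 ≫ φ.1) : u = v := by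
  have := u.2
  have := v.2
  exact Subtype.ext (Functor.IsStronglyCartesian.ext p f φ.1 (𝟙 R) h)

theorem IsCart.comp {R S T : B} {f : R ⟶ S} {g : S ⟶ T} {a : p.Fiber R} {b : p.Fiber S}
    {c : p.Fiber T} {φ : ArrOver p f a b} {ψ : ArrOver p g b c} (hφ : φ.IsCart) (hψ : ψ.IsCart) :
    (ArrOver.comp φ ψ).IsCart :=
  Functor.IsStronglyCartesian.comp p

theorem IsCart.cast {R S : B} {f g : R ⟶ S} (h : f = g) {a : p.Fiber R} {b : p.Fiber S}
    {φ : ArrOver p f a b} (hφ : φ.IsCart) : (ArrOver.cast h φ).IsCart := by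
  subst h; exact hφ

theorem IsCart.id {S : B} (a : p.Fiber S) : (ArrOver.id a).IsCart := by
  have := (𝟙 a : a ⟶ a).2
  have h : p.IsHomLift (𝟙 S) (𝟙 a.1) := (ArrOver.id a).2
  exact Functor.IsStronglyCartesian.of_isIso p (𝟙 S) (𝟙 a.1)

end ArrOver

/-- A choice of Cartesian arrows. -/
structure Cleavage (p : E ⥤ B) where
  obj : ∀ {R S : B} (f : R ⟶ S), p.Fiber S → p.Fiber R
  arr : ∀ {R S : B} (f : R ⟶ S) (a : p.Fiber S), ArrOver p f (obj f a) a
  cart : ∀ {R S : B} (f : R ⟶ S) (a : p.Fiber S), (arr f a).IsCart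

namespace Fib

@[simp] theorem comp_val {S : B} {a b c : p.Fiber S} (u : a ⟶ b) (v : b ⟶ c) :
    (u ≫ v).1 = u.1 ≫ v.1 := rfl

@[simp] theorem id_val {S : B} (a : p.Fiber S) : (𝟙 a : a ⟶ a).1 = 𝟙 a.1 := rfl

end Fib

namespace Cleavage

variable (κ : Cleavage p)

/-- The inverse image of a vertical arrow. -/
noncomputable def map {R S : B} (f : R ⟶ S) {a b : p.Fiber S} (u : a ⟶ b) :
    κ.obj f a ⟶ κ.obj f b :=
  (κ.cart f b).lift (ArrOver.compv (κ.arr f a) u)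

@[simp] theorem map_fac {R S : B} (f : R ⟶ S) {a b : p.Fiber S} (u : a ⟶ b) :
    (κ.map f u).1 ≫ (κ.arr f b).1 = (κ.arr f a).1 ≫ u.1 :=
  (κ.cart f b).lift_fac _

@[simp] theorem map_fac_assoc {R S : B} (f : R ⟶ S) {a b : p.Fiber S} (u : a ⟶ b) {z : E}
    (k : b.1 ⟶ z) : (κ.map f u).1 ≫ (κ.arr f b).1 ≫ k = (κ.arr f a).1 ≫ u.1 ≫ k := by
  rw [← Category.assoc, map_fac, Category.assoc]

theorem map_id {R S : B} (f : R ⟶ S) (a : p.Fiber S) : κ.map f (𝟙 a) = 𝟙 (κ.obj f a) :=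
  (κ.cart f a).ext (by simp)

theorem map_comp {R S : B} (f : R ⟶ S) {a b c : p.Fiber S} (u : a ⟶ b) (v : b ⟶ c) :
    κ.map f (u ≫ v) = κ.map f u ≫ κ.map f v :=
  (κ.cart f c).ext (by simp)

/-- The inverse image functor. -/
noncomputable def pull {R S : B} (f : R ⟶ S) : p.Fiber S ⥤ p.Fiber R where
  obj a := κ.obj f a
  map u := κ.map f u
  map_id a := κ.map_id f a
  map_comp u v := κ.map_comp f u v

/-- Comparison of the inverse images along equal arrows. -/
noncomputable def eqv {R S : B} {f g : R ⟶ S} (h : f = g) (a : p.Fiber S) :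
    κ.obj f a ⟶ κ.obj g a :=
  (κ.cart g a).lift (ArrOver.cast h (κ.arr f a))

@[simp] theorem eqv_fac {R S : B} {f g : R ⟶ S} (h : f = g) (a : p.Fiber S) :
    (κ.eqv h a).1 ≫ (κ.arr g a).1 = (κ.arr f a).1 :=
  (κ.cart g a).lift_fac _

@[simp] theorem eqv_fac_assoc {R S : B} {f g : R ⟶ S} (h : f = g) (a : p.Fiber S) {z : E}
    (k : a.1 ⟶ z) : (κ.eqv h a).1 ≫ (κ.arr g a).1 ≫ k = (κ.arr f a).1 ≫ k := by
  rw [← Category.assoc, eqv_fac]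

/-- The vertical arrow from the inverse image along an identity. -/
def unitHom {S : B} (a : p.Fiber S) : κ.obj (𝟙 S) a ⟶ a := κ.arr (𝟙 S) a

@[simp] theorem unitHom_val {S : B} (a : p.Fiber S) : (κ.unitHom a).1 = (κ.arr (𝟙 S) a).1 := rfl

/-- The vertical arrow to the inverse image along an identity. -/
noncomputable def unitInv {S : B} (a : p.Fiber S) : a ⟶ κ.obj (𝟙 S) a :=
  (κ.cart (𝟙 S) a).lift (ArrOver.id a)

@[simp] theorem unitInv_fac {S : B} (a : p.Fiber S) :
    (κ.unitInv a).1 ≫ (κ.arr (𝟙 S) a).1 = 𝟙 a.1 :=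
  (κ.cart (𝟙 S) a).lift_fac _

/-- The inverse image along a composite compared with the iterated one. -/
noncomputable def compHom {R S T : B} (f : R ⟶ S) (g : S ⟶ T) (a : p.Fiber T) :
    κ.obj (f ≫ g) a ⟶ κ.obj f (κ.obj g a) :=
  ((κ.cart f _).comp (κ.cart g a)).lift (κ.arr (f ≫ g) a)

@[simp] theorem compHom_fac {R S T : B} (f : R ⟶ S) (g : S ⟶ T) (a : p.Fiber T) :
    (κ.compHom f g a).1 ≫ (κ.arr f (κ.obj g a)).1 ≫ (κ.arr g a).1 = (κ.arr (f ≫ g) a).1 :=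
  ((κ.cart f _).comp (κ.cart g a)).lift_fac (κ.arr (f ≫ g) a)

@[simp] theorem compHom_fac_assoc {R S T : B} (f : R ⟶ S) (g : S ⟶ T) (a : p.Fiber T) {z : E}
    (k : a.1 ⟶ z) : (κ.compHom f g a).1 ≫ (κ.arr f (κ.obj g a)).1 ≫ (κ.arr g a).1 ≫ k =
      (κ.arr (f ≫ g) a).1 ≫ k := by
  rw [← κ.compHom_fac f g a]; simp only [Category.assoc]

/-- The iterated inverse image compared with the one along a composite. -/
noncomputable def compInv {R S T : B} (f : R ⟶ S) (g : S ⟶ T) (a : p.Fiber T) :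
    κ.obj f (κ.obj g a) ⟶ κ.obj (f ≫ g) a :=
  (κ.cart (f ≫ g) a).lift (ArrOver.comp (κ.arr f _) (κ.arr g a))

@[simp] theorem compInv_fac {R S T : B} (f : R ⟶ S) (g : S ⟶ T) (a : p.Fiber T) :
    (κ.compInv f g a).1 ≫ (κ.arr (f ≫ g) a).1 = (κ.arr f (κ.obj g a)).1 ≫ (κ.arr g a).1 :=
  (κ.cart (f ≫ g) a).lift_fac _

@[simp] theorem compInv_fac_assoc {R S T : B} (f : R ⟶ S) (g : S ⟶ T) (a : p.Fiber T) {z : E}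
    (k : a.1 ⟶ z) : (κ.compInv f g a).1 ≫ (κ.arr (f ≫ g) a).1 ≫ k =
      (κ.arr f (κ.obj g a)).1 ≫ (κ.arr g a).1 ≫ k := by
  rw [← Category.assoc, compInv_fac, Category.assoc]

theorem ext₂ {R S T : B} {f : R ⟶ S} {g : S ⟶ T} {a : p.Fiber T} {c : p.Fiber R}
    {u v : c ⟶ κ.obj f (κ.obj g a)}
    (h : u.1 ≫ (κ.arr f (κ.obj g a)).1 ≫ (κ.arr g a).1 =
      v.1 ≫ (κ.arr f (κ.obj g a)).1 ≫ (κ.arr g a).1) : u = v :=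
  ((κ.cart f _).comp (κ.cart g a)).ext h

/-- Inverse image along an identity. -/
noncomputable def pullId (S : B) : κ.pull (𝟙 S) ≅ 𝟭 (p.Fiber S) :=
  NatIso.ofComponents
    (fun a =>
      { hom := κ.unitHom a
        inv := κ.unitInv a
        hom_inv_id := (κ.cart (𝟙 S) a).ext (v := 𝟙 (κ.obj (𝟙 S) a)) (by
          change (κ.unitHom a ≫ κ.unitInv a).1 ≫ _ = _
          simp)
        inv_hom_id := Subtype.ext (κ.unitInv_fac a) })
    (fun {a b} u => Subtype.ext (κ.map_fac (𝟙 S) u))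

/-- Inverse image along a composite. -/
noncomputable def pullComp {R S T : B} (f : R ⟶ S) (g : S ⟶ T) :
    κ.pull (f ≫ g) ≅ κ.pull g ⋙ κ.pull f :=
  NatIso.ofComponents
    (fun a =>
      { hom := κ.compHom f g a
        inv := κ.compInv f g a
        hom_inv_id := (κ.cart (f ≫ g) a).ext (v := 𝟙 (κ.obj (f ≫ g) a)) (by
          change (κ.compHom f g a ≫ κ.compInv f g a).1 ≫ _ = _
          simp)
        inv_hom_id := κ.ext₂ (v := 𝟙 (κ.obj f (κ.obj g a))) (by
          change (κ.compInv f g a ≫ κ.compHom f g a).1 ≫ _ = _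
          simp) })
    (fun {a b} u => κ.ext₂ (by
      change (κ.map (f ≫ g) u ≫ κ.compHom f g b).1 ≫ _ =
        (κ.compHom f g a ≫ κ.map f (κ.map g u)).1 ≫ _
      simp))

/-- The arrow of the base underlying a 1-cell. -/
abbrev bs {X Y : LocallyDiscrete Bᵒᵖ} (f : X ⟶ Y) : Y.as.unop ⟶ X.as.unop := f.as.unop

theorem bs_eq {X Y : LocallyDiscrete Bᵒᵖ} {f g : X ⟶ Y} (α : f ⟶ g) : bs f = bs g := by
  rw [LocallyDiscrete.eq_of_hom α]

/-- Comparison of the inverse image functors along equal arrows. -/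
noncomputable def pullEq {R S : B} {f g : R ⟶ S} (h : f = g) : κ.pull f ⟶ κ.pull g where
  app a := κ.eqv h a
  naturality a b u := (κ.cart g b).ext (by
    change (κ.map f u ≫ κ.eqv h b).1 ≫ _ = (κ.eqv h a ≫ κ.map g u).1 ≫ _
    simp)

theorem hom₂_ext {C D : Cat.{v, u}} {F G : C ⟶ D} {α β : F ⟶ G}
    (h : ∀ a, α.toNatTrans.app a = β.toNatTrans.app a) : α = β :=
  Cat.Hom₂.ext (NatTrans.ext (funext h))

theorem eqv_refl {R S : B} {f : R ⟶ S} (h : f = f) (a : p.Fiber S) : κ.eqv h a = 𝟙 (κ.obj f a) :=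
  (κ.cart f a).ext (by simp)

theorem eqv_trans {R S : B} {f g k : R ⟶ S} (h : f = k) (h₁ : f = g) (h₂ : g = k) (a : p.Fiber S) :
    κ.eqv h a = κ.eqv h₁ a ≫ κ.eqv h₂ a :=
  (κ.cart k a).ext (by simp)

theorem eqv_whiskerLeft {R S T : B} {f f' : R ⟶ S} {g : S ⟶ T} (h : f ≫ g = f' ≫ g) (h' : f = f')
    (a : p.Fiber T) :
    κ.eqv h a = κ.compHom f g a ≫ κ.eqv h' (κ.obj g a) ≫ κ.compInv f' g a :=
  (κ.cart (f' ≫ g) a).ext (by simp)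

theorem eqv_whiskerRight {R S T : B} {f : R ⟶ S} {g g' : S ⟶ T} (h : f ≫ g = f ≫ g') (h' : g = g')
    (a : p.Fiber T) :
    κ.eqv h a = κ.compHom f g a ≫ κ.map f (κ.eqv h' a) ≫ κ.compInv f g' a :=
  (κ.cart (f ≫ g') a).ext (by simp)

theorem eqv_assoc {R S T U : B} (f : R ⟶ S) (g : S ⟶ T) (k : T ⟶ U)
    (h : f ≫ g ≫ k = (f ≫ g) ≫ k) (a : p.Fiber U) :
    κ.eqv h a = κ.compHom f (g ≫ k) a ≫ κ.map f (κ.compHom g k a) ≫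
      𝟙 (κ.obj f (κ.obj g (κ.obj k a))) ≫ κ.compInv f g (κ.obj k a) ≫ κ.compInv (f ≫ g) k a :=
  (κ.cart ((f ≫ g) ≫ k) a).ext (by simp)

theorem eqv_leftUnit {R S : B} (f : R ⟶ S) (h : f ≫ 𝟙 S = f) (a : p.Fiber S) :
    κ.eqv h a = κ.compHom f (𝟙 S) a ≫ κ.map f (κ.unitHom a) ≫ 𝟙 (κ.obj f a) :=
  (κ.cart f a).ext (by simp)

theorem eqv_rightUnit {R S : B} (f : R ⟶ S) (h : 𝟙 R ≫ f = f) (a : p.Fiber S) :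
    κ.eqv h a = κ.compHom (𝟙 R) f a ≫ κ.unitHom (κ.obj f a) ≫ 𝟙 (κ.obj f a) :=
  (κ.cart f a).ext (by simp)

/-- The pseudo-functor of fibres and inverse image functors. -/
noncomputable def psd : LocallyDiscrete Bᵒᵖ ⥤ᵖ Cat.{v, u} where
  obj X := Cat.of (p.Fiber X.as.unop)
  map f := (κ.pull (bs f)).toCatHom
  map₂ α := (κ.pullEq (bs_eq α)).toCatHom₂
  map₂_id f := hom₂_ext fun a => κ.eqv_refl _ a
  map₂_comp α β := hom₂_ext fun a => κ.eqv_trans _ (bs_eq α) (bs_eq β) a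
  mapId X := Cat.Hom.isoMk (κ.pullId X.as.unop)
  mapComp f g := Cat.Hom.isoMk (κ.pullComp (bs g) (bs f))
  map₂_whisker_left f g h α := hom₂_ext fun a => κ.eqv_whiskerLeft _ (bs_eq α) a
  map₂_whisker_right α h := hom₂_ext fun a => κ.eqv_whiskerRight _ (bs_eq α) a
  map₂_associator f g h := hom₂_ext fun a => κ.eqv_assoc (bs h) (bs g) (bs f) _ a
  map₂_left_unitor f := hom₂_ext fun a => κ.eqv_leftUnit (bs f) _ a
  map₂_right_unitor f := hom₂_ext fun a => κ.eqv_rightUnit (bs f) _ a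

end Cleavage
end Fibre
end FibMon

namespace FibMon

section Based

variable {B : Type u₁} [Category.{v₁} B]

/-- Fibrations over `B`, functors over `B`, vertical natural transformations. -/
def fibLayer (B : Type u₁) [Category.{v₁} B] : Layer (BasedCategory.{v, u} B) :=
  objLayer (fun P => P.p.IsFibered)

/-- The 2-category of fibrations over `B`. -/
abbrev Fibr (B : Type u₁) [Category.{v₁} B] := (fibLayer.{v, u} B).Total

variable {P Q R : BasedCategory.{v, u} B}

/-- The action of a functor over `B` on objects of fibres. -/
abbrev fibObj (F : P ⟶ Q) {S : B} (a : P.p.Fiber S) : Q.p.Fiber S :=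
  ⟨F.obj a.1, (BasedFunctor.w_obj F a.1).trans a.2⟩

/-- The action of a functor over `B` on arrows between objects of fibres. -/
def fibArr (F : P ⟶ Q) {S T : B} {f : S ⟶ T} {a : P.p.Fiber S} {b : P.p.Fiber T}
    (φ : ArrOver P.p f a b) : ArrOver Q.p f (fibObj F a) (fibObj F b) :=
  ⟨F.map φ.1, have := φ.2; BasedFunctor.preserves_isHomLift F f φ.1⟩

/-- The action of a functor over `B` on vertical arrows. -/
def fibMap (F : P ⟶ Q) {S : B} {a b : P.p.Fiber S} (u : a ⟶ b) : fibObj F a ⟶ fibObj F b :=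
  fibArr F (f := 𝟙 S) u

@[simp] theorem fibArr_val (F : P ⟶ Q) {S T : B} {f : S ⟶ T} {a : P.p.Fiber S} {b : P.p.Fiber T}
    (φ : ArrOver P.p f a b) : (fibArr F φ).1 = F.map φ.1 := rfl

@[simp] theorem fibMap_val (F : P ⟶ Q) {S : B} {a b : P.p.Fiber S} (u : a ⟶ b) :
    (fibMap F u).1 = F.map u.1 := rfl

/-- The restriction of a functor over `B` to fibres. -/
def fibFun (F : P ⟶ Q) (S : B) : P.p.Fiber S ⥤ Q.p.Fiber S where
  obj a := fibObj F a
  map u := fibMap F u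
  map_id a := Subtype.ext (F.map_id a.1)
  map_comp u v := Subtype.ext (F.map_comp u.1 v.1)

/-- The component of a vertical natural transformation at an object of a fibre. -/
def fibApp {F G : P ⟶ Q} (α : F ⟶ G) {S : B} (a : P.p.Fiber S) : fibObj F a ⟶ fibObj G a :=
  ⟨α.toNatTrans.app a.1, BasedNatTrans.isHomLift α a.2⟩

@[simp] theorem fibApp_val {F G : P ⟶ Q} (α : F ⟶ G) {S : B} (a : P.p.Fiber S) :
    (fibApp α a).1 = α.toNatTrans.app a.1 := rfl

/-- The restriction of a vertical natural transformation to fibres. -/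
def fibNat {F G : P ⟶ Q} (α : F ⟶ G) (S : B) : fibFun F S ⟶ fibFun G S where
  app a := fibApp α a
  naturality a b u := Subtype.ext (α.toNatTrans.naturality u.1)

variable (κ : Cleavage P.p) (κ' : Cleavage Q.p)

/-- The vertical arrow `F(f^* a) ⟶ f^*(F a)`. -/
noncomputable def xi (F : P ⟶ Q) {S T : B} (f : S ⟶ T) (a : P.p.Fiber T) :
    fibObj F (κ.obj f a) ⟶ κ'.obj f (fibObj F a) :=
  (κ'.cart f _).lift (fibArr F (κ.arr f a))

@[simp] theorem xi_fac (F : P ⟶ Q) {S T : B} (f : S ⟶ T) (a : P.p.Fiber T) :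
    (xi κ κ' F f a).1 ≫ (κ'.arr f (fibObj F a)).1 = F.map (κ.arr f a).1 :=
  (κ'.cart f _).lift_fac _

@[simp] theorem xi_fac_assoc (F : P ⟶ Q) {S T : B} (f : S ⟶ T) (a : P.p.Fiber T) {z : Q.obj}
    (k : F.obj a.1 ⟶ z) :
    (xi κ κ' F f a).1 ≫ (κ'.arr f (fibObj F a)).1 ≫ k = F.map (κ.arr f a).1 ≫ k := by
  rw [← xi_fac κ κ']; exact (Category.assoc _ _ _).symm

theorem xi_natural (F : P ⟶ Q) {S T : B} (f : S ⟶ T) {a b : P.p.Fiber T} (u : a ⟶ b) :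
    fibMap F (κ.map f u) ≫ xi κ κ' F f b = xi κ κ' F f a ≫ κ'.map f (fibMap F u) :=
  (κ'.cart f (fibObj F b)).ext (by simp [← Functor.map_comp])

/-- The natural transformation comparing a functor over `B` with inverse images. -/
noncomputable def xiNat (F : P ⟶ Q) {S T : B} (f : S ⟶ T) :
    κ.pull f ⋙ fibFun F S ⟶ fibFun F T ⋙ κ'.pull f where
  app a := xi κ κ' F f a
  naturality a b u := xi_natural κ κ' F f u

theorem xi_eqv (F : P ⟶ Q) {S T : B} {f g : S ⟶ T} (h : f = g) (a : P.p.Fiber T) :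
    fibMap F (κ.eqv h a) ≫ xi κ κ' F g a = xi κ κ' F f a ≫ κ'.eqv h (fibObj F a) :=
  (κ'.cart g (fibObj F a)).ext (by simp [← Functor.map_comp])

theorem xi_id (F : P ⟶ Q) {S : B} (a : P.p.Fiber S) :
    xi κ κ' F (𝟙 S) a ≫ κ'.unitHom (fibObj F a) =
      fibMap F (κ.unitHom a) ≫ 𝟙 (fibObj F a) ≫ 𝟙 (fibObj F a) :=
  Subtype.ext (by simp)

theorem xi_comp (F : P ⟶ Q) {S T U : B} (f : S ⟶ T) (g : T ⟶ U) (a : P.p.Fiber U) :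
    xi κ κ' F (f ≫ g) a ≫ κ'.compHom f g (fibObj F a) =
      fibMap F (κ.compHom f g a) ≫ 𝟙 (fibObj F (κ.obj f (κ.obj g a))) ≫
        xi κ κ' F f (κ.obj g a) ≫ 𝟙 (κ'.obj f (fibObj F (κ.obj g a))) ≫
          κ'.map f (xi κ κ' F g a) ≫ 𝟙 (κ'.obj f (κ'.obj g (fibObj F a))) :=
  κ'.ext₂ (by simp [← Functor.map_comp])

/-- The oplax natural transformation associated with a functor over `B`. -/
noncomputable def fibTrans (F : P ⟶ Q) :
    Oplax.OplaxTrans κ.psd.toOplax κ'.psd.toOplax where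
  app X := (fibFun F X.as.unop).toCatHom
  naturality f := (xiNat κ κ' F (Cleavage.bs f)).toCatHom₂
  naturality_naturality α := Cleavage.hom₂_ext fun a => xi_eqv κ κ' F (Cleavage.bs_eq α) a
  naturality_id X := Cleavage.hom₂_ext fun a => xi_id κ κ' F a
  naturality_comp f g := Cleavage.hom₂_ext fun a =>
    xi_comp κ κ' F (Cleavage.bs g) (Cleavage.bs f) a

theorem xi_app {F G : P ⟶ Q} (α : F ⟶ G) {S T : B} (f : S ⟶ T) (a : P.p.Fiber T) :
    fibApp α (κ.obj f a) ≫ xi κ κ' G f a = xi κ κ' F f a ≫ κ'.map f (fibApp α a) :=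
  (κ'.cart f (fibObj G a)).ext (by simp)

/-- The modification associated with a vertical natural transformation. -/
noncomputable def fibMod {F G : P ⟶ Q} (α : F ⟶ G) :
    Oplax.OplaxTrans.Modification (fibTrans κ κ' F) (fibTrans κ κ' G) where
  app X := (fibNat α X.as.unop).toCatHom₂
  naturality f := Cleavage.hom₂_ext fun a => xi_app κ κ' α (Cleavage.bs f) a

theorem xi_idFun {S T : B} (f : S ⟶ T) (a : P.p.Fiber T) :
    xi κ κ (𝟙 P) f a = 𝟙 (κ.obj f a) ≫ 𝟙 (κ.obj f a) :=
  (κ.cart f a).ext (by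
    refine (xi_fac κ κ (𝟙 P) f a).trans ?_
    change (κ.arr f a).1 = (𝟙 (κ.obj f a) ≫ 𝟙 (κ.obj f a)).1 ≫ (κ.arr f a).1
    simp)

theorem xi_compFun (κ'' : Cleavage R.p) (F : P ⟶ Q) (G : Q ⟶ R) {S T : B} (f : S ⟶ T)
    (a : P.p.Fiber T) :
    xi κ κ'' (F ≫ G) f a = 𝟙 (fibObj G (fibObj F (κ.obj f a))) ≫ fibMap G (xi κ κ' F f a) ≫
      𝟙 (fibObj G (κ'.obj f (fibObj F a))) ≫ xi κ' κ'' G f (fibObj F a) ≫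
        𝟙 (κ''.obj f (fibObj G (fibObj F a))) :=
  (κ''.cart f (fibObj G (fibObj F a))).ext (by
    refine (xi_fac κ κ'' (F ≫ G) f a).trans ?_
    change G.map (F.map (κ.arr f a).1) = (𝟙 (fibObj G (fibObj F (κ.obj f a))) ≫
      fibMap G (xi κ κ' F f a) ≫ 𝟙 (fibObj G (κ'.obj f (fibObj F a))) ≫
        xi κ' κ'' G f (fibObj F a) ≫ 𝟙 (κ''.obj f (fibObj G (fibObj F a)))).1 ≫
          (κ''.arr f (fibObj G (fibObj F a))).1
    simp [← Functor.map_comp])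

/-- The index 2-category. -/
abbrev Idx (B : Type u₁) [Category.{v₁} B] := LocallyDiscrete Bᵒᵖ

theorem psd_hom_ext {J : Type u₁} [Bicategory.{w₁, v₁} J] {D : Type u'} [Bicategory.{w', v'} D]
    {Φ Ψ : Psd J D} {f g : Φ ⟶ Ψ} (h : ∀ a, f.hom.app a = g.hom.app a)
    (h' : ∀ {a b : J} (k : a ⟶ b), f.hom.naturality k ≍ g.hom.naturality k) : f = g := by
  obtain ⟨f⟩ := f
  obtain ⟨g⟩ := g
  obtain ⟨f, fn, _, _, _⟩ : Oplax.OplaxTrans Φ.toOplax Ψ.toOplax := f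
  obtain ⟨g, gn, _, _, _⟩ : Oplax.OplaxTrans Φ.toOplax Ψ.toOplax := g
  obtain rfl : f = g := funext h
  obtain rfl : @fn = @gn := by
    funext a b k
    exact eq_of_heq (h' k)
  rfl

theorem psd_sandwich {J : Type u₁} [Bicategory.{w₁, v₁} J] {D : Type u'} [Bicategory.{w', v'} D]
    {Φ Ψ : Psd J D} {f g f' g' : Φ ⟶ Ψ} (h : f = f') (Γ : f' ⟶ g') (h' : g' = g) (a : J) :
    (eqToHom h ≫ Γ ≫ eqToHom h').hom.as.app a =
      eqToHom (by rw [h]) ≫ Γ.hom.as.app a ≫ eqToHom (by rw [h']) := by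
  subst h h'
  rfl

theorem psd_sandwich' {J : Type u₁} [Bicategory.{w₁, v₁} J] {D : Type u'} [Bicategory.{w', v'} D]
    {Φ Ψ : Psd J D} {f f' g' : Φ ⟶ Ψ} (h : f = f') (Γ : f' ⟶ g') (a : J) :
    (eqToHom h ≫ Γ).hom.as.app a = eqToHom (by rw [h]) ≫ Γ.hom.as.app a := by
  subst h
  rfl

/-- The 2-functor sending a fibration to its pseudo-functor of fibres. -/
noncomputable def fibIndexed (κ : ∀ P : Fibr.{v, u} B, Cleavage P.base.p) :
    StrictPseudofunctor (Fibr.{v, u} B) (Psd (Idx B) Cat.{v, u}) :=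
  StrictPseudofunctor.mk'
    { obj := fun P => (κ P).psd
      map := fun {P Q} F => InducedBicategory.mkHom (fibTrans (κ P) (κ Q) F.base)
      map₂ := fun {P Q F G} α => ⟨⟨fibMod (κ P) (κ Q) (Layer.Total.Hom₂.base α)⟩⟩
      map₂_id := fun _ => rfl
      map₂_comp := fun _ _ => rfl
      map_id := fun P => psd_hom_ext (fun _ => rfl) (fun f => heq_of_eq
        (Cleavage.hom₂_ext fun a => xi_idFun (κ P) (Cleavage.bs f) a))
      map_comp := fun {P Q R} F G => psd_hom_ext (fun _ => rfl) (fun f => heq_of_eq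
        (Cleavage.hom₂_ext fun a => xi_compFun (κ P) (κ Q) (κ R) F.base G.base (Cleavage.bs f) a))
      map₂_whisker_left := fun f g h α => by
        refine InducedBicategory.hom₂_ext (Oplax.OplaxTrans.homCategory.ext fun a => ?_)
        refine Eq.trans ?_ (psd_sandwich _ _ _ a).symm
        exact ((Category.id_comp _).trans (Category.comp_id _)).symm
      map₂_whisker_right := fun α f => by
        refine InducedBicategory.hom₂_ext (Oplax.OplaxTrans.homCategory.ext fun a => ?_)
        refine Eq.trans ?_ (psd_sandwich _ _ _ a).symm
        exact ((Category.id_comp _).trans (Category.comp_id _)).symm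
      map₂_left_unitor := fun f => by
        refine InducedBicategory.hom₂_ext (Oplax.OplaxTrans.homCategory.ext fun a => ?_)
        refine Eq.trans ?_ (psd_sandwich' _ _ a).symm
        exact (Category.id_comp _).symm
      map₂_right_unitor := fun f => by
        refine InducedBicategory.hom₂_ext (Oplax.OplaxTrans.homCategory.ext fun a => ?_)
        refine Eq.trans ?_ (psd_sandwich' _ _ a).symm
        exact (Category.id_comp _).symm
      map₂_associator := fun f g h => by
        refine InducedBicategory.hom₂_ext (Oplax.OplaxTrans.homCategory.ext fun a => ?_)
        refine Eq.trans ?_ (psd_sandwich _ _ _ a).symm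
        exact ((Category.id_comp _).trans (Category.comp_id _)).symm }

end Based
end FibMon

namespace FibMon

section FibreMonoidal

open MonoidalCategory

variable {B : Type u₁} [Category.{v₁} B] {E : Type u} [Category.{v} E] {p : E ⥤ B}

/-- Given monoidal structures on the fibres, an extension of them to arrows lying over an arbitrary
arrow of the base: the tensor product becomes a functor `E ×_B E ⥤ E` over `B`, the unit a functor
`B ⥤ E` over `B`, and the associativity and unit isomorphisms are natural on all of `E`. -/
structure FibTensor (p : E ⥤ B) [∀ S : B, MonoidalCategory (p.Fiber S)] where
  tensor : ∀ {R S : B} {f : R ⟶ S} {a a' : p.Fiber R} {b b' : p.Fiber S},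
    ArrOver p f a b → ArrOver p f a' b' → ArrOver p f (a ⊗ a') (b ⊗ b')
  unit : ∀ {R S : B} (f : R ⟶ S), ArrOver p f (𝟙_ (p.Fiber R)) (𝟙_ (p.Fiber S))
  tensor_vert : ∀ {S : B} {a a' b b' : p.Fiber S} (u : a ⟶ b) (u' : a' ⟶ b'),
    tensor (f := 𝟙 S) u u' = u ⊗ₘ u'
  tensor_comp : ∀ {R S T : B} {f : R ⟶ S} {g : S ⟶ T} {a a' : p.Fiber R} {b b' : p.Fiber S}
    {c c' : p.Fiber T} (φ : ArrOver p f a b) (φ' : ArrOver p f a' b') (ψ : ArrOver p g b c)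
    (ψ' : ArrOver p g b' c'),
    tensor (ArrOver.comp φ ψ) (ArrOver.comp φ' ψ') =
      ArrOver.comp (tensor φ φ') (tensor ψ ψ')
  unit_id : ∀ S : B, unit (𝟙 S) = ArrOver.id (𝟙_ (p.Fiber S))
  unit_comp : ∀ {R S T : B} (f : R ⟶ S) (g : S ⟶ T),
    unit (f ≫ g) = ArrOver.comp (unit f) (unit g)
  associator_natural : ∀ {R S : B} {f : R ⟶ S} {a a' a'' : p.Fiber R} {b b' b'' : p.Fiber S}
    (φ : ArrOver p f a b) (φ' : ArrOver p f a' b') (φ'' : ArrOver p f a'' b''),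
    (tensor (tensor φ φ') φ'').1 ≫ (α_ b b' b'').hom.1 =
      (α_ a a' a'').hom.1 ≫ (tensor φ (tensor φ' φ'')).1
  leftUnitor_natural : ∀ {R S : B} {f : R ⟶ S} {a : p.Fiber R} {b : p.Fiber S}
    (φ : ArrOver p f a b), (tensor (unit f) φ).1 ≫ (λ_ b).hom.1 = (λ_ a).hom.1 ≫ φ.1
  rightUnitor_natural : ∀ {R S : B} {f : R ⟶ S} {a : p.Fiber R} {b : p.Fiber S}
    (φ : ArrOver p f a b), (tensor φ (unit f)).1 ≫ (ρ_ b).hom.1 = (ρ_ a).hom.1 ≫ φ.1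

/-- A monoidal structure on a category over `B`: a tensor product `E ×_B E ⥤ E` and a unit section
`B ⥤ E`, both functors over `B`, with vertical natural associativity and unit isomorphisms
satisfying the coherence axioms (which are equations between arrows of fibres). -/
structure FibMonStr (p : E ⥤ B) where
  mon : ∀ S : B, MonoidalCategory (p.Fiber S)
  ten : FibTensor p

namespace FibTensor

variable [∀ S : B, MonoidalCategory (p.Fiber S)] (x : FibTensor p)

theorem tensor_cast {R S : B} {f g : R ⟶ S} (h : f = g) {a a' : p.Fiber R} {b b' : p.Fiber S}
    (φ : ArrOver p f a b) (φ' : ArrOver p f a' b') :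
    (x.tensor (ArrOver.cast h φ) (ArrOver.cast h φ')).1 = (x.tensor φ φ').1 := by
  subst h; rfl

/-- Tensor products of arrows over equal arrows of the base with equal values are equal. -/
theorem tensor_congr {R S : B} {f g : R ⟶ S} (h : f = g) {a a' : p.Fiber R} {b b' : p.Fiber S}
    {φ : ArrOver p f a b} {φ' : ArrOver p f a' b'} {ψ : ArrOver p g a b} {ψ' : ArrOver p g a' b'}
    (e : φ.1 = ψ.1) (e' : φ'.1 = ψ'.1) : (x.tensor φ φ').1 = (x.tensor ψ ψ').1 := by
  subst h
  rw [Subtype.ext e, Subtype.ext e']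

theorem unit_cast {R S : B} {f g : R ⟶ S} (h : f = g) : (x.unit f).1 = (x.unit g).1 := by
  subst h; rfl

theorem tensor_vcomp {R S : B} {f : R ⟶ S} {a a' c c' : p.Fiber R} {b b' : p.Fiber S}
    (u : c ⟶ a) (u' : c' ⟶ a') (φ : ArrOver p f a b) (φ' : ArrOver p f a' b') :
    (x.tensor (ArrOver.vcomp u φ) (ArrOver.vcomp u' φ')).1 = (u ⊗ₘ u').1 ≫ (x.tensor φ φ').1 := by
  rw [← x.tensor_vert]
  exact (x.tensor_cast _ _ _).trans (congrArg Subtype.val (x.tensor_comp (f := 𝟙 R) u u' φ φ'))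

theorem tensor_compv {R S : B} {f : R ⟶ S} {a a' : p.Fiber R} {b b' c c' : p.Fiber S}
    (φ : ArrOver p f a b) (φ' : ArrOver p f a' b') (u : b ⟶ c) (u' : b' ⟶ c') :
    (x.tensor (ArrOver.compv φ u) (ArrOver.compv φ' u')).1 = (x.tensor φ φ').1 ≫ (u ⊗ₘ u').1 := by
  rw [← x.tensor_vert]
  exact (x.tensor_cast _ _ _).trans (congrArg Subtype.val (x.tensor_comp (g := 𝟙 S) φ φ' u u'))

variable (κ : Cleavage p)

/-- The structure morphism `f^* a ⊗ f^* b ⟶ f^*(a ⊗ b)`. -/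
noncomputable def pullμ {R S : B} (f : R ⟶ S) (a b : p.Fiber S) :
    κ.obj f a ⊗ κ.obj f b ⟶ κ.obj f (a ⊗ b) :=
  (κ.cart f (a ⊗ b)).lift (x.tensor (κ.arr f a) (κ.arr f b))

/-- The structure morphism `I ⟶ f^* I`. -/
noncomputable def pullε {R S : B} (f : R ⟶ S) : 𝟙_ (p.Fiber R) ⟶ κ.obj f (𝟙_ (p.Fiber S)) :=
  (κ.cart f _).lift (x.unit f)

@[simp] theorem pullμ_fac {R S : B} (f : R ⟶ S) (a b : p.Fiber S) :
    (x.pullμ κ f a b).1 ≫ (κ.arr f (a ⊗ b)).1 = (x.tensor (κ.arr f a) (κ.arr f b)).1 :=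
  (κ.cart f _).lift_fac _

@[simp] theorem pullε_fac {R S : B} (f : R ⟶ S) :
    (x.pullε κ f).1 ≫ (κ.arr f (𝟙_ (p.Fiber S))).1 = (x.unit f).1 :=
  (κ.cart f _).lift_fac _

@[simp] theorem pullμ_fac_assoc {R S : B} (f : R ⟶ S) (a b : p.Fiber S) {z : E}
    (k : (a ⊗ b).1 ⟶ z) : (x.pullμ κ f a b).1 ≫ (κ.arr f (a ⊗ b)).1 ≫ k =
      (x.tensor (κ.arr f a) (κ.arr f b)).1 ≫ k := by
  rw [← Category.assoc, pullμ_fac]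

@[simp] theorem pullε_fac_assoc {R S : B} (f : R ⟶ S) {z : E} (k : (𝟙_ (p.Fiber S)).1 ⟶ z) :
    (x.pullε κ f).1 ≫ (κ.arr f (𝟙_ (p.Fiber S))).1 ≫ k = (x.unit f).1 ≫ k := by
  rw [← Category.assoc, pullε_fac]

theorem pullμ_natural {R S : B} (f : R ⟶ S) {a b a' b' : p.Fiber S} (u : a ⟶ b) (u' : a' ⟶ b') :
    (κ.map f u ⊗ₘ κ.map f u') ≫ x.pullμ κ f b b' = x.pullμ κ f a a' ≫ κ.map f (u ⊗ₘ u') :=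
  (κ.cart f _).ext (by
    simp [← tensor_vcomp, ← tensor_compv]
    exact x.tensor_congr rfl (by simp) (by simp))

theorem pull_assoc {R S : B} (f : R ⟶ S) (a b c : p.Fiber S) :
    (x.pullμ κ f a b ⊗ₘ 𝟙 (κ.obj f c)) ≫ x.pullμ κ f (a ⊗ b) c ≫ κ.map f (α_ a b c).hom =
      (α_ (κ.obj f a) (κ.obj f b) (κ.obj f c)).hom ≫ (𝟙 (κ.obj f a) ⊗ₘ x.pullμ κ f b c) ≫
        x.pullμ κ f a (b ⊗ c) :=
  (κ.cart f _).ext (by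
    have h₁ := x.tensor_vcomp (x.pullμ κ f a b) (𝟙 (κ.obj f c)) (κ.arr f (a ⊗ b)) (κ.arr f c)
    have h₂ := x.tensor_vcomp (𝟙 (κ.obj f a)) (x.pullμ κ f b c) (κ.arr f a) (κ.arr f (b ⊗ c))
    have h₃ := x.associator_natural (κ.arr f a) (κ.arr f b) (κ.arr f c)
    simp only [Fib.comp_val, Category.assoc, Cleavage.map_fac, pullμ_fac_assoc, pullμ_fac]
    rw [← h₂, ← Category.assoc, ← h₁]
    refine Eq.trans ?_ (h₃.trans ?_)
    · exact congrArg (· ≫ _) (x.tensor_congr rfl (by simp) (by simp))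
    · exact congrArg (_ ≫ ·) (x.tensor_congr rfl (by simp) (by simp)))

theorem pull_leftUnit {R S : B} (f : R ⟶ S) (a : p.Fiber S) :
    (λ_ (κ.obj f a)).hom =
      (x.pullε κ f ⊗ₘ 𝟙 (κ.obj f a)) ≫ x.pullμ κ f (𝟙_ _) a ≫ κ.map f (λ_ a).hom :=
  (κ.cart f _).ext (by
    have h₁ := x.tensor_vcomp (x.pullε κ f) (𝟙 (κ.obj f a)) (κ.arr f _) (κ.arr f a)
    have h₃ := x.leftUnitor_natural (κ.arr f a)
    simp only [Fib.comp_val, Category.assoc, Cleavage.map_fac, pullμ_fac_assoc]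
    rw [← Category.assoc, ← h₁, ← h₃]
    exact congrArg (· ≫ _) (x.tensor_congr rfl (by simp) (by simp)))

theorem pull_rightUnit {R S : B} (f : R ⟶ S) (a : p.Fiber S) :
    (ρ_ (κ.obj f a)).hom =
      (𝟙 (κ.obj f a) ⊗ₘ x.pullε κ f) ≫ x.pullμ κ f a (𝟙_ _) ≫ κ.map f (ρ_ a).hom :=
  (κ.cart f _).ext (by
    have h₁ := x.tensor_vcomp (𝟙 (κ.obj f a)) (x.pullε κ f) (κ.arr f a) (κ.arr f _)
    have h₃ := x.rightUnitor_natural (κ.arr f a)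
    simp only [Fib.comp_val, Category.assoc, Cleavage.map_fac, pullμ_fac_assoc]
    rw [← Category.assoc, ← h₁, ← h₃]
    exact congrArg (· ≫ _) (x.tensor_congr rfl (by simp) (by simp)))

/-- The monoidal structure of the inverse image functors. -/
@[reducible] noncomputable def pullLax {R S : B} (f : R ⟶ S) : (κ.pull f).LaxMonoidal :=
  Functor.LaxMonoidal.ofTensorHom (F := κ.pull f) (x.pullε κ f) (fun a b => x.pullμ κ f a b)
    (fun u u' => x.pullμ_natural κ f u u') (fun a b c => x.pull_assoc κ f a b c)
    (fun a => x.pull_leftUnit κ f a) (fun a => x.pull_rightUnit κ f a)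

theorem eqv_unit {R S : B} {f g : R ⟶ S} (h : f = g) :
    x.pullε κ f ≫ κ.eqv h (𝟙_ _) = x.pullε κ g :=
  (κ.cart g _).ext (by simp [x.unit_cast h])

theorem eqv_tensor {R S : B} {f g : R ⟶ S} (h : f = g) (a b : p.Fiber S) :
    x.pullμ κ f a b ≫ κ.eqv h (a ⊗ b) = (κ.eqv h a ⊗ₘ κ.eqv h b) ≫ x.pullμ κ g a b :=
  (κ.cart g _).ext (by
    simp only [Fib.comp_val, Category.assoc, Cleavage.eqv_fac, pullμ_fac]
    rw [← x.tensor_vcomp]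
    exact x.tensor_congr h (by simp) (by simp))

theorem id_unit (S : B) : x.pullε κ (𝟙 S) ≫ κ.unitHom (𝟙_ _) = 𝟙 (𝟙_ (p.Fiber S)) :=
  Subtype.ext (by simp [x.unit_id])

theorem id_tensor {S : B} (a b : p.Fiber S) :
    x.pullμ κ (𝟙 S) a b ≫ κ.unitHom (a ⊗ b) = (κ.unitHom a ⊗ₘ κ.unitHom b) ≫ 𝟙 (a ⊗ b) :=
  Subtype.ext (by
    simp only [Fib.comp_val, Cleavage.unitHom_val, pullμ_fac, Category.comp_id, ← x.tensor_vert]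
    rfl)

theorem comp_unit {R S T : B} (f : R ⟶ S) (g : S ⟶ T) :
    x.pullε κ (f ≫ g) ≫ κ.compHom f g (𝟙_ _) = x.pullε κ f ≫ κ.map f (x.pullε κ g) :=
  κ.ext₂ (by simp [x.unit_comp])

theorem comp_tensor {R S T : B} (f : R ⟶ S) (g : S ⟶ T) (a b : p.Fiber T) :
    x.pullμ κ (f ≫ g) a b ≫ κ.compHom f g (a ⊗ b) = (κ.compHom f g a ⊗ₘ κ.compHom f g b) ≫
      x.pullμ κ f (κ.obj g a) (κ.obj g b) ≫ κ.map f (x.pullμ κ g a b) :=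
  κ.ext₂ (by
    simp only [Fib.comp_val, Category.assoc, Cleavage.compHom_fac, pullμ_fac, pullμ_fac_assoc,
      Cleavage.map_fac_assoc]
    have h := congrArg Subtype.val
      (x.tensor_comp (κ.arr f (κ.obj g a)) (κ.arr f (κ.obj g b)) (κ.arr g a) (κ.arr g b))
    rw [ArrOver.comp_val] at h
    rw [← h, ← x.tensor_vcomp]
    exact x.tensor_congr rfl (by simp) (by simp))

end FibTensor

end FibreMonoidal
end FibMon

namespace FibMon

section FibredMonoidal

open MonoidalCategory

variable {B : Type u₁} [Category.{v₁} B]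

theorem monLayer_two_inv {C D : Cat.{v, u}} {x : monLayer.Str C} {y : monLayer.Str D}
    {F G : C ⟶ D} {hF : monLayer.Hom x y F} {hG : monLayer.Hom x y G} (e : F ≅ G)
    (h : monLayer.Two hF hG e.hom) : monLayer.Two hG hF e.inv := by
  let _ : MonoidalCategory C := x
  let _ : MonoidalCategory D := y
  let _ : F.toFunctor.LaxMonoidal := hF
  let _ : G.toFunctor.LaxMonoidal := hG
  have : NatTrans.IsMonoidal (Cat.Hom.toNatIso e).hom := h
  exact inferInstanceAs (NatTrans.IsMonoidal (Cat.Hom.toNatIso e).inv)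

theorem monLayer_two_mk {C D : Cat.{v, u}} {x : MonoidalCategory C} {y : MonoidalCategory D}
    {F G : C ⟶ D} {hF : F.toFunctor.LaxMonoidal} {hG : G.toFunctor.LaxMonoidal} {α : F ⟶ G}
    (h : hF.ε ≫ α.toNatTrans.app (𝟙_ C) = hG.ε)
    (h' : ∀ a b : C, hF.μ a b ≫ α.toNatTrans.app (a ⊗ b) =
      (α.toNatTrans.app a ⊗ₘ α.toNatTrans.app b) ≫ hG.μ a b) :
    monLayer.Two (x := x) (y := y) (f := F) (g := G) hF hG α :=
  ⟨h, h'⟩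

/-- The monoidal structures on the fibres and on the inverse image functors. -/
noncomputable def FibMonStr.psdStr {E : Type u} [Category.{v} E] {p : E ⥤ B} (x : FibMonStr p)
    (κ : Cleavage p) : monLayer.{v, u}.PsdStr κ.psd :=
  letI := x.mon
  { str := fun X => x.mon X.as.unop
    hom := fun f => x.ten.pullLax κ (Cleavage.bs f)
    two_map₂ := fun α => monLayer_two_mk (x.ten.eqv_unit κ (Cleavage.bs_eq α))
      (x.ten.eqv_tensor κ (Cleavage.bs_eq α))
    two_mapId := fun X => monLayer_two_mk (x.ten.id_unit κ X.as.unop) (x.ten.id_tensor κ)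
    two_mapId_inv := fun X => monLayer_two_inv _ <|
      monLayer_two_mk (x.ten.id_unit κ X.as.unop) (x.ten.id_tensor κ)
    two_mapComp := fun f g =>
      monLayer_two_mk (x.ten.comp_unit κ (Cleavage.bs g) (Cleavage.bs f))
        (x.ten.comp_tensor κ (Cleavage.bs g) (Cleavage.bs f))
    two_mapComp_inv := fun f g => monLayer_two_inv _ <|
      monLayer_two_mk (x.ten.comp_unit κ (Cleavage.bs g) (Cleavage.bs f))
        (x.ten.comp_tensor κ (Cleavage.bs g) (Cleavage.bs f)) }

variable {P Q R : BasedCategory.{v, u} B}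

/-- Monoidal structures on the restrictions to fibres of a functor over `B`, whose structure
morphisms `F a ⊗ F b ⟶ F(a ⊗ b)` and `I ⟶ F I` are natural with respect to arrows lying over an
arbitrary arrow of the base. -/
structure FibLax [∀ S : B, MonoidalCategory (P.p.Fiber S)]
    [∀ S : B, MonoidalCategory (Q.p.Fiber S)] (x : FibTensor P.p) (y : FibTensor Q.p)
    (F : P ⟶ Q) where
  lax : ∀ S : B, (fibFun F S).LaxMonoidal
  μ_natural : ∀ {S T : B} {f : S ⟶ T} {a a' : P.p.Fiber S} {b b' : P.p.Fiber T}
    (φ : ArrOver P.p f a b) (φ' : ArrOver P.p f a' b'),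
    (y.tensor (fibArr F φ) (fibArr F φ')).1 ≫ ((lax T).μ b b').1 =
      ((lax S).μ a a').1 ≫ F.map (x.tensor φ φ').1
  ε_natural : ∀ {S T : B} (f : S ⟶ T),
    (y.unit f).1 ≫ (lax T).ε.1 = (lax S).ε.1 ≫ F.map (x.unit f).1

namespace FibLax

variable [∀ S : B, MonoidalCategory (P.p.Fiber S)] [∀ S : B, MonoidalCategory (Q.p.Fiber S)]
  [∀ S : B, MonoidalCategory (R.p.Fiber S)] {x : FibTensor P.p} {y : FibTensor Q.p}
  {z : FibTensor R.p}

theorem paste {C : Type u} [Category.{v} C] {D : Type u} [Category.{v} D] (G : C ⥤ D) {X X' : D}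
    {Y Y' Z Z' : C} {t : X ⟶ X'} {m : X ⟶ G.obj Y} {m' : X' ⟶ G.obj Y'} {s : Y ⟶ Y'} {n : Y ⟶ Z}
    {n' : Y' ⟶ Z'} {r : Z ⟶ Z'} (h₂ : t ≫ m' = m ≫ G.map s) (h₁ : s ≫ n' = n ≫ r) :
    t ≫ m' ≫ G.map n' = (m ≫ G.map n) ≫ G.map r := by
  rw [Category.assoc, ← Functor.map_comp, ← h₁, Functor.map_comp, ← Category.assoc,
    ← Category.assoc, h₂]

/-- The identity. -/
def id (x : FibTensor P.p) : FibLax x x (𝟙 P) where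
  lax S := Functor.LaxMonoidal.id (C := P.p.Fiber S)
  μ_natural φ φ' := (Category.comp_id _).trans (Category.id_comp _).symm
  ε_natural f := (Category.comp_id _).trans (Category.id_comp _).symm

/-- The composite. -/
def comp {F : P ⟶ Q} {G : Q ⟶ R} (h : FibLax x y F) (k : FibLax y z G) : FibLax x z (F ≫ G) where
  lax S := letI := h.lax S; letI := k.lax S
    Functor.LaxMonoidal.comp (fibFun F S) (fibFun G S)
  μ_natural φ φ' :=
    paste G.toFunctor (k.μ_natural (fibArr F φ) (fibArr F φ')) (h.μ_natural φ φ')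
  ε_natural f := paste G.toFunctor (k.ε_natural f) (h.ε_natural f)

/-- The structure morphism. -/
def m {F : P ⟶ Q} (h : FibLax x y F) {S : B} (a b : P.p.Fiber S) :
    fibObj F a ⊗ fibObj F b ⟶ fibObj F (a ⊗ b) := (h.lax S).μ a b

/-- The structure morphism. -/
def e {F : P ⟶ Q} (h : FibLax x y F) (S : B) : 𝟙_ (Q.p.Fiber S) ⟶ fibObj F (𝟙_ (P.p.Fiber S)) :=
  (h.lax S).ε

theorem m_natural {F : P ⟶ Q} (h : FibLax x y F) {S T : B} {f : S ⟶ T} {a a' : P.p.Fiber S}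
    {b b' : P.p.Fiber T} (φ : ArrOver P.p f a b) (φ' : ArrOver P.p f a' b') :
    (y.tensor (fibArr F φ) (fibArr F φ')).1 ≫ (h.m b b').1 =
      (h.m a a').1 ≫ F.map (x.tensor φ φ').1 :=
  h.μ_natural φ φ'

theorem e_natural {F : P ⟶ Q} (h : FibLax x y F) {S T : B} (f : S ⟶ T) :
    (y.unit f).1 ≫ (h.e T).1 = (h.e S).1 ≫ F.map (x.unit f).1 :=
  h.ε_natural f

variable (κ : Cleavage P.p) (κ' : Cleavage Q.p)

theorem xi_unit {F : P ⟶ Q} (h : FibLax x y F) {S T : B} (f : S ⟶ T) :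
    (h.e S ≫ fibMap F (x.pullε κ f)) ≫ xi κ κ' F f (𝟙_ _) =
      y.pullε κ' f ≫ κ'.map f (h.e T) :=
  (κ'.cart f _).ext (by
    simp [← Functor.map_comp]
    exact (h.e_natural f).symm)

theorem xi_tensor {F : P ⟶ Q} (h : FibLax x y F) {S T : B} (f : S ⟶ T) (a b : P.p.Fiber T) :
    (h.m (κ.obj f a) (κ.obj f b) ≫ fibMap F (x.pullμ κ f a b)) ≫ xi κ κ' F f (a ⊗ b) =
      (xi κ κ' F f a ⊗ₘ xi κ κ' F f b) ≫ y.pullμ κ' f (fibObj F a) (fibObj F b) ≫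
        κ'.map f (h.m a b) :=
  (κ'.cart f _).ext (by
    simp [← Functor.map_comp]
    have h₁ := y.tensor_vcomp (xi κ κ' F f a) (xi κ κ' F f b) (κ'.arr f _) (κ'.arr f _)
    refine (h.m_natural (κ.arr f a) (κ.arr f b)).symm.trans ?_
    rw [← Category.assoc, ← h₁]
    exact congrArg (· ≫ _) (y.tensor_congr rfl (by simp) (by simp)))

end FibLax

/-- A monoidal structure on a functor over `B`. -/
abbrev FibMonHom (x : FibMonStr P.p) (y : FibMonStr Q.p) (F : P ⟶ Q) :=
  letI := x.mon; letI := y.mon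
  FibLax x.ten y.ten F

/-- The monoidal structure of the restriction to a fibre. -/
@[reducible] def FibMonHom.laxAt {x : FibMonStr P.p} {y : FibMonStr Q.p} {F : P ⟶ Q}
    (h : FibMonHom x y F) (S : B) :
    monLayer.Hom (a := Cat.of (P.p.Fiber S)) (b := Cat.of (Q.p.Fiber S)) (x.mon S) (y.mon S)
      (fibFun F S).toCatHom :=
  letI := x.mon; letI := y.mon
  FibLax.lax h S

/-- The vertical natural transformation is monoidal: its restrictions to fibres are monoidal natural
transformations. -/
def FibMonTwo {x : FibMonStr P.p} {y : FibMonStr Q.p} {F G : P ⟶ Q} (h : FibMonHom x y F)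
    (k : FibMonHom x y G) (α : F ⟶ G) : Prop :=
  ∀ S : B, monLayer.Two (FibMonHom.laxAt h S) (FibMonHom.laxAt k S) (fibNat α S).toCatHom₂

/-- Monoidal structures on fibrations and on functors over `B`, monoidal vertical natural
transformations. -/
def fibMonLayer (B : Type u₁) [Category.{v₁} B] : Layer (Fibr.{v, u} B) where
  Str P := FibMonStr P.base.p
  Hom x y F := FibMonHom x y F.base
  Two h k α := FibMonTwo h k (Layer.Total.Hom₂.base α)
  idHom x := letI := x.mon; FibLax.id x.ten
  compHom {P Q R x y z F G} h k :=
    letI := x.mon; letI := y.mon; letI := z.mon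
    FibLax.comp (x := x.ten) (y := y.ten) (z := z.ten) h k
  two_id h S := monLayer.two_id (FibMonHom.laxAt h S)
  two_comp h k S := monLayer.two_comp (h S) (k S)
  two_whiskerLeft f _ _ _ h S := monLayer.two_whiskerLeft (FibMonHom.laxAt f S) (h S)
  two_whiskerRight f h S := monLayer.two_whiskerRight (FibMonHom.laxAt f S) (h S)
  two_associator f g h S := monLayer.two_associator (FibMonHom.laxAt f S) (FibMonHom.laxAt g S)
    (FibMonHom.laxAt h S)
  two_associator_inv f g h S := monLayer.two_associator_inv (FibMonHom.laxAt f S)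
    (FibMonHom.laxAt g S) (FibMonHom.laxAt h S)
  two_leftUnitor f S := monLayer.two_leftUnitor (FibMonHom.laxAt f S)
  two_leftUnitor_inv f S := monLayer.two_leftUnitor_inv (FibMonHom.laxAt f S)
  two_rightUnitor f S := monLayer.two_rightUnitor (FibMonHom.laxAt f S)
  two_rightUnitor_inv f S := monLayer.two_rightUnitor_inv (FibMonHom.laxAt f S)

/-- Monoidal fibred categories over `B`, monoidal functors over `B` and monoidal vertical natural
transformations. -/
abbrev MonFib (B : Type u₁) [Category.{v₁} B] := (fibMonLayer.{v, u} B).Total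

end FibredMonoidal
end FibMon

namespace FibMon

section MonoidalLift

open MonoidalCategory

namespace Layer

variable {J : Type u₁} [Bicategory.{w₁, v₁} J]
variable {C : Type u} [Bicategory.{w, v} C] {L : Layer.{w, v, u, s, t} C}

theorem PsdHom.heq {Φ Ψ : Psd J C} {X : L.PsdStr (J := J) Φ} {Y : L.PsdStr (J := J) Ψ}
    {τ τ' : Φ ⟶ Ψ} (e : τ = τ') {h : PsdHom X Y τ.hom} {h' : PsdHom X Y τ'.hom}
    (H : ∀ a, h.app a ≍ h'.app a) : h ≍ h' := by
  subst e
  obtain ⟨h, _⟩ := h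
  obtain ⟨h', _⟩ := h'
  obtain rfl : h = h' := funext fun a => eq_of_heq (H a)
  rfl

end Layer

variable {B : Type u₁} [Category.{v₁} B]

/-- The monoidal structure of the oplax natural transformation associated with a monoidal functor
over `B`. -/
noncomputable def FibMonHom.psdHom {P Q : BasedCategory.{v, u} B} {x : FibMonStr P.p}
    {y : FibMonStr Q.p} {F : P ⟶ Q} (κ : Cleavage P.p) (κ' : Cleavage Q.p)
    (h : FibMonHom x y F) :
    Layer.PsdHom (x.psdStr κ) (y.psdStr κ') (fibTrans κ κ' F) where
  app X := FibMonHom.laxAt h X.as.unop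
  two_naturality f := monLayer_two_mk
    (letI := x.mon; letI := y.mon; FibLax.xi_unit κ κ' h (Cleavage.bs f))
    (letI := x.mon; letI := y.mon; FibLax.xi_tensor κ κ' h (Cleavage.bs f))

/-- Structure morphisms of the pseudo-functor of fibres obtained from a monoidal fibred category. -/
noncomputable def monLift (κ : ∀ P : Fibr.{v, u} B, Cleavage P.base.p) :
    Layer.Lift (fibIndexed κ) (fibMonLayer B) (monLayer.psd (Idx B)) where
  str {P} x := FibMonStr.psdStr x (κ P)
  hom {P Q x y F} h := FibMonHom.psdHom (κ P) (κ Q) h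
  two h X := h X.as.unop
  hom_id {P} x := Layer.PsdHom.heq ((fibIndexed κ).map_id P) fun X => HEq.rfl
  hom_comp {P Q R x y z F G} h k :=
    Layer.PsdHom.heq ((fibIndexed κ).map_comp F G) fun X => HEq.rfl

/-- The 2-functor sending a monoidal fibred category to its pseudo-functor of fibres. -/
noncomputable def monIndexed (κ : ∀ P : Fibr.{v, u} B, Cleavage P.base.p) :
    StrictPseudofunctor (MonFib.{v, u} B) (Psd (Idx B) MonCat.{v, u}) :=
  (monLift κ).functor.comp (monLayer.psdTotal (Idx B))

end MonoidalLift
end FibMon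

namespace FibMon

section TwoEquivalence

variable {C : Type u} [Bicategory.{w, v} C] {D : Type u'} [Bicategory.{w', v'} D]

/-- A 2-natural isomorphism. -/
structure TwoNatIso (F G : StrictPseudofunctor C D) where
  hom : ∀ a : C, F.obj a ⟶ G.obj a
  inv : ∀ a : C, G.obj a ⟶ F.obj a
  hom_inv_id : ∀ a : C, hom a ≫ inv a = 𝟙 (F.obj a)
  inv_hom_id : ∀ a : C, inv a ≫ hom a = 𝟙 (G.obj a)
  naturality : ∀ {a b : C} (f : a ⟶ b), F.map f ≫ hom b = hom a ≫ G.map f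
  naturality₂ : ∀ {a b : C} {f g : a ⟶ b} (α : f ⟶ g),
    F.map₂ α ▷ hom b ≫ eqToHom (naturality g) = eqToHom (naturality f) ≫ hom a ◁ G.map₂ α

/-- The 2-functor has an inverse up to 2-natural isomorphisms. -/
def IsTwoEquivalence (T : StrictPseudofunctor C D) : Prop :=
  ∃ S : StrictPseudofunctor D C,
    Nonempty (TwoNatIso (T.comp S) (StrictPseudofunctor.id C)) ∧
      Nonempty (TwoNatIso (S.comp T) (StrictPseudofunctor.id D))

end TwoEquivalence

section Variants

namespace Layer

variable {C : Type u} [Bicategory.{w, v} C]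

/-- A structure on the objects of `C`, viewed as a structure on the objects of `C` that already
have another structure. -/
def onTotal (N : Layer.{w, v, u, s', t'} C) (M : Layer.{w, v, u, s, t} C) : Layer M.Total where
  Str x := N.Str x.base
  Hom x y f := N.Hom x y f.base
  Two h k α := N.Two h k (Total.Hom₂.base α)
  idHom x := N.idHom x
  compHom h k := N.compHom h k
  two_id h := N.two_id h
  two_comp h k := N.two_comp h k
  two_whiskerLeft f _ _ _ h := N.two_whiskerLeft f h
  two_whiskerRight f h := N.two_whiskerRight f h
  two_associator f g h := N.two_associator f g h
  two_associator_inv f g h := N.two_associator_inv f g h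
  two_leftUnitor f := N.two_leftUnitor f
  two_leftUnitor_inv f := N.two_leftUnitor_inv f
  two_rightUnitor f := N.two_rightUnitor f
  two_rightUnitor_inv f := N.two_rightUnitor_inv f

theorem plift_heq {p q : Prop} (a : PLift p) (b : PLift q) : a ≍ b := by
  obtain ⟨a⟩ := a
  obtain ⟨b⟩ := b
  obtain rfl : p = q := propext ⟨fun _ => b, fun _ => a⟩
  rfl

variable {J : Type u₁} [Bicategory.{w₁, v₁} J] {D : Type u'} [Bicategory.{w', v'} D]

/-- Two structures side by side on the components of a pseudo-functor. -/
def PsdStr.prod {N : Layer.{w, v, u, s, t} C} {N' : Layer.{w, v, u, s', t'} C} {Φ : Psd J C}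
    (X : N.PsdStr (J := J) Φ) (X' : N'.PsdStr (J := J) Φ) : (N.prod N').PsdStr (J := J) Φ where
  str a := (X.str a, X'.str a)
  hom f := (X.hom f, X'.hom f)
  two_map₂ α := ⟨X.two_map₂ α, X'.two_map₂ α⟩
  two_mapId a := ⟨X.two_mapId a, X'.two_mapId a⟩
  two_mapId_inv a := ⟨X.two_mapId_inv a, X'.two_mapId_inv a⟩
  two_mapComp f g := ⟨X.two_mapComp f g, X'.two_mapComp f g⟩
  two_mapComp_inv f g := ⟨X.two_mapComp_inv f g, X'.two_mapComp_inv f g⟩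

/-- Two structures side by side on the components of an oplax natural transformation. -/
def PsdHom.prod {N : Layer.{w, v, u, s, t} C} {N' : Layer.{w, v, u, s', t'} C} {Φ Ψ : Psd J C}
    {X : N.PsdStr (J := J) Φ} {X' : N'.PsdStr (J := J) Φ} {Y : N.PsdStr (J := J) Ψ}
    {Y' : N'.PsdStr (J := J) Ψ} {τ : Φ ⟶ Ψ} (h : PsdHom X Y τ.hom) (h' : PsdHom X' Y' τ.hom) :
    PsdHom (X.prod X') (Y.prod Y') τ.hom where
  app a := (h.app a, h'.app a)
  two_naturality f := ⟨h.two_naturality f, h'.two_naturality f⟩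

theorem PsdHom.prod_heq {N : Layer.{w, v, u, s, t} C} {N' : Layer.{w, v, u, s', t'} C}
    {Φ Ψ : Psd J C} {X : N.PsdStr (J := J) Φ} {X' : N'.PsdStr (J := J) Φ}
    {Y : N.PsdStr (J := J) Ψ} {Y' : N'.PsdStr (J := J) Ψ} {τ σ : Φ ⟶ Ψ} (e : τ = σ)
    {h : PsdHom X Y τ.hom} {h' : PsdHom X' Y' τ.hom} {k : PsdHom X Y σ.hom}
    {k' : PsdHom X' Y' σ.hom} (H : h ≍ k) (H' : h' ≍ k') : h.prod h' ≍ k.prod k' := by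
  subst e
  subst H H'
  rfl

/-- Two lifts side by side. -/
def Lift.prod {T : StrictPseudofunctor D (Psd J C)} {M : Layer.{w', v', u'} D}
    {M' : Layer.{w', v', u'} D} {N : Layer.{w, v, u} C}
    {N' : Layer.{w, v, u} C} (l : Lift T M (N.psd J)) (l' : Lift T M' (N'.psd J)) :
    Lift T (M.prod M') ((N.prod N').psd J) where
  str x := PsdStr.prod (l.str x.1) (l'.str x.2)
  hom h := PsdHom.prod (l.hom h.1) (l'.hom h.2)
  two h a := ⟨l.two h.1 a, l'.two h.2 a⟩
  hom_id x := PsdHom.prod_heq (T.map_id _) (l.hom_id x.1) (l'.hom_id x.2)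
  hom_comp h k := PsdHom.prod_heq (T.map_comp _ _) (l.hom_comp h.1 k.1) (l'.hom_comp h.2 k.2)

/-- The inverse of an invertible 2-cell satisfying the condition satisfies it too. -/
def InvClosed (L : Layer.{w, v, u, s, t} C) : Prop :=
  ∀ {a b : C} {x : L.Str a} {y : L.Str b} {f g : a ⟶ b} {h : L.Hom x y f} {k : L.Hom x y g}
    (e : f ≅ g), L.Two h k e.hom → L.Two k h e.inv

theorem InvClosed.isIso {L : Layer.{w, v, u, s, t} C} (H : L.InvClosed) {x y : L.Total}
    {f g : x ⟶ y} (α : f ⟶ g) (h : IsIso (Total.Hom₂.base α)) : IsIso α :=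
  (Total.isoMk (asIso (Total.Hom₂.base α)) (Total.Hom₂.prop α)
    (H (asIso (Total.Hom₂.base α)) (Total.Hom₂.prop α))).isIso_hom

end Layer

/-- The structure cells of the oplax natural transformation are invertible. -/
def IsPseudoNatural {J : Type u₁} [Bicategory.{w₁, v₁} J] {D : Type u} [Bicategory.{w, v} D]
    {Φ Ψ : Psd J D} (τ : Φ ⟶ Ψ) : Prop :=
  ∀ {a b : J} (f : a ⟶ b), IsIso (τ.hom.naturality f)

/-- Pseudo-functors, pseudo-natural transformations and modifications. -/
def pseudoLayer (J : Type u₁) [Bicategory.{w₁, v₁} J] (D : Type u) [Bicategory.{w, v} D] :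
    Layer (Psd J D) :=
  propLayer (fun _ => True) (fun _ _ τ => IsPseudoNatural τ)
    (fun {Φ} _ a b f => by
      change IsIso ((ρ_ (Φ.map f)).hom ≫ (λ_ (Φ.map f)).inv)
      infer_instance)
    (fun {Φ Ψ Θ _ _ _ τ σ} h k a b f => by
      have := h f
      have := k f
      change IsIso ((α_ _ _ _).inv ≫ τ.hom.naturality f ▷ σ.hom.app b ≫ (α_ _ _ _).hom ≫
        τ.hom.app a ◁ σ.hom.naturality f ≫ (α_ _ _ _).inv)
      infer_instance)

/-- A 2-functor to pseudo-functors and oplax natural transformations that sends certain 1-cells to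
pseudo-natural transformations. -/
def pseudoLift {C : Type u'} [Bicategory.{w', v'} C] {J : Type u₁} [Bicategory.{w₁, v₁} J]
    {D : Type u} [Bicategory.{w, v} D] (T : StrictPseudofunctor C (Psd J D))
    (M : Layer.{w', v', u', s, t} C)
    (h : ∀ {c d : C} {x : M.Str c} {y : M.Str d} {f : c ⟶ d}, M.Hom x y f →
      IsPseudoNatural (T.map f)) : Layer.Lift T M (pseudoLayer J D) where
  str _ := ⟨trivial⟩
  hom hf := ⟨h hf⟩
  two _ := trivial
  hom_id _ := Layer.plift_heq _ _
  hom_comp _ _ := Layer.plift_heq _ _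

/-- Pseudo-functors, pseudo-natural transformations and modifications. -/
abbrev PsdP (J : Type u₁) [Bicategory.{w₁, v₁} J] (D : Type u) [Bicategory.{w, v} D] :=
  (pseudoLayer J D).Total

end Variants
end FibMon

namespace FibMon

section FibredVariants

open MonoidalCategory

variable {B : Type u₁} [Category.{v₁} B]

theorem ArrOver.IsCart.isIso_lift {E : Type u} [Category.{v} E] {p : E ⥤ B} {R S : B} {f : R ⟶ S}
    {a c : p.Fiber R} {b : p.Fiber S} {φ : ArrOver p f a b} {ψ : ArrOver p f c b} (hφ : φ.IsCart)
    (hψ : ψ.IsCart) : IsIso (hφ.lift ψ) :=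
  ⟨hψ.lift φ, hψ.ext (by simp), hφ.ext (by simp)⟩

/-- The tensor product and the unit section preserve Cartesian arrows. -/
def FibMonStr.IsStrong {E : Type u} [Category.{v} E] {p : E ⥤ B} (x : FibMonStr p) : Prop :=
  letI := x.mon
  (∀ {R S : B} {f : R ⟶ S} {a a' : p.Fiber R} {b b' : p.Fiber S} (φ : ArrOver p f a b)
    (φ' : ArrOver p f a' b'), φ.IsCart → φ'.IsCart → (x.ten.tensor φ φ').IsCart) ∧
  ∀ {R S : B} (f : R ⟶ S), (x.ten.unit f).IsCart

/-- The fibre of a monoidal fibred category. -/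
abbrev fibre (x : MonFib.{v, u} B) (S : B) : MonCat.{v, u} :=
  ⟨Cat.of (x.base.base.p.Fiber S), x.str.mon S⟩

/-- The restriction to a fibre of a monoidal functor over `B`. -/
abbrev fibreMap {x y : MonFib.{v, u} B} (F : x ⟶ y) (S : B) : fibre x S ⟶ fibre y S :=
  Layer.Total.Hom.mk (fibFun (Layer.Total.Hom.base (Layer.Total.Hom.base F)) S).toCatHom
    (FibMonHom.laxAt (Layer.Total.Hom.str F) S)

/-- Strong monoidal fibred categories and strong monoidal functors over `B`. -/
def fibStrongLayer (B : Type u₁) [Category.{v₁} B] : Layer (MonFib.{v, u} B) :=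
  propLayer (fun x => x.str.IsStrong) (fun _ _ F => ∀ S : B, IsStrongFunctor (fibreMap F S))
    (fun {x} _ S => (strongLayer.idHom (a := fibre x S) ⟨trivial⟩).down)
    (fun {x y z _ _ _ F G} h k S => (strongLayer.compHom (x := ⟨trivial⟩) (y := ⟨trivial⟩)
      (z := ⟨trivial⟩) (f := fibreMap F S) (g := fibreMap G S) ⟨h S⟩ ⟨k S⟩).down)

/-- A symmetry of a monoidal fibred category: symmetries of the fibres, natural with respect to
arrows lying over an arbitrary arrow of the base. -/
structure FibSymStr {E : Type u} [Category.{v} E] {p : E ⥤ B} (x : FibMonStr p) where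
  sym : letI := x.mon; ∀ S : B, SymmetricCategory (p.Fiber S)
  braiding_natural : letI := x.mon; letI := sym
    ∀ {R S : B} {f : R ⟶ S} {a a' : p.Fiber R} {b b' : p.Fiber S} (φ : ArrOver p f a b)
      (φ' : ArrOver p f a' b'),
      (x.ten.tensor φ φ').1 ≫ (β_ b b').hom.1 = (β_ a a').hom.1 ≫ (x.ten.tensor φ' φ).1

/-- Symmetries of monoidal fibred categories, and symmetric monoidal functors over `B`. -/
def fibSymLayer (B : Type u₁) [Category.{v₁} B] : Layer (MonFib.{v, u} B) where
  Str x := FibSymStr x.str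
  Hom {a b} x y F := PLift (∀ S : B,
    IsSymmetricFunctor (V := fibre a S) (W := fibre b S) (x.sym S) (y.sym S) (fibreMap F S))
  Two _ _ _ := True
  idHom {a} x := ⟨fun S => IsSymmetricFunctor.id (V := fibre a S) (x.sym S)⟩
  compHom h k := ⟨fun S => (h.down S).comp (k.down S)⟩
  two_id _ := trivial
  two_comp _ _ := trivial
  two_whiskerLeft _ _ _ _ _ := trivial
  two_whiskerRight _ _ := trivial
  two_associator _ _ _ := trivial
  two_associator_inv _ _ _ := trivial
  two_leftUnitor _ := trivial
  two_leftUnitor_inv _ := trivial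
  two_rightUnitor _ := trivial
  two_rightUnitor_inv _ := trivial

/-- All fibrations, and Cartesian functors over `B`. -/
def fibCartLayer (B : Type u₁) [Category.{v₁} B] : Layer (Fibr.{v, u} B) :=
  propLayer (fun _ => True)
    (fun {P Q} _ _ F => ∀ {R S : B} (f : R ⟶ S) {a b : P.base.obj} (φ : a ⟶ b),
      P.base.p.IsStronglyCartesian f φ →
        Q.base.p.IsStronglyCartesian f ((Layer.Total.Hom.base F).map φ))
    (fun _ _ _ _ _ _ _ h => h)
    (fun h k _ _ f _ _ φ hφ => k f _ (h f φ hφ))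

variable (κ : ∀ P : Fibr.{v, u} B, Cleavage P.base.p)

/-- Strong monoidal structures on inverse image functors. -/
noncomputable def strongLift :
    Layer.Lift (monIndexed κ) (fibStrongLayer B) (strongLayer.psd (Idx B)) where
  str {c} x :=
    { str := fun _ => ⟨trivial⟩
      hom := fun f => ⟨letI := c.str.mon
        ⟨((κ c.base).cart (Cleavage.bs f) _).isIso_lift (x.down.2 (Cleavage.bs f)), fun a b =>
          ((κ c.base).cart (Cleavage.bs f) _).isIso_lift
            (x.down.1 _ _ ((κ c.base).cart (Cleavage.bs f) a)
              ((κ c.base).cart (Cleavage.bs f) b))⟩⟩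
      two_map₂ := fun _ => trivial
      two_mapId := fun _ => trivial
      two_mapId_inv := fun _ => trivial
      two_mapComp := fun _ _ => trivial
      two_mapComp_inv := fun _ _ => trivial }
  hom h :=
    { app := fun X => ⟨h.down X.as.unop⟩
      two_naturality := fun _ => trivial }
  two _ _ := trivial
  hom_id {c} x := Layer.PsdHom.heq ((monIndexed κ).map_id c) fun _ => Layer.plift_heq _ _
  hom_comp {_ _ _ _ _ _ F G} h k :=
    Layer.PsdHom.heq ((monIndexed κ).map_comp F G) fun _ => Layer.plift_heq _ _

theorem FibSymStr.pull {E : Type u} [Category.{v} E] {p : E ⥤ B} {x : FibMonStr p}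
    (y : FibSymStr x) (κ : Cleavage p) {R S : B} (f : R ⟶ S) (a b : p.Fiber S) :
    letI := x.mon; letI := y.sym
    x.ten.pullμ κ f a b ≫ κ.map f (β_ a b).hom =
      (β_ (κ.obj f a) (κ.obj f b)).hom ≫ x.ten.pullμ κ f b a :=
  letI := x.mon; letI := y.sym
  (κ.cart f _).ext (by simpa using y.braiding_natural (κ.arr f a) (κ.arr f b))

/-- Symmetries of the fibres, preserved by inverse image functors. -/
noncomputable def symLift :
    Layer.Lift (monIndexed κ) (fibSymLayer B) (symLayer.psd (Idx B)) where
  str {c} x :=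
    { str := fun X => x.sym X.as.unop
      hom := fun f => ⟨fun a b => x.pull (κ c.base) (Cleavage.bs f) a b⟩
      two_map₂ := fun _ => trivial
      two_mapId := fun _ => trivial
      two_mapId_inv := fun _ => trivial
      two_mapComp := fun _ _ => trivial
      two_mapComp_inv := fun _ _ => trivial }
  hom h :=
    { app := fun X => ⟨h.down X.as.unop⟩
      two_naturality := fun _ => trivial }
  two _ _ := trivial
  hom_id {c} x := Layer.PsdHom.heq ((monIndexed κ).map_id c) fun _ => Layer.plift_heq _ _
  hom_comp {_ _ _ _ _ _ F G} h k :=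
    Layer.PsdHom.heq ((monIndexed κ).map_comp F G) fun _ => Layer.plift_heq _ _

end FibredVariants
end FibMon

namespace FibMon

section Correspondences

variable {B : Type u₁} [Category.{v₁} B]

/-- Monoidal categories, strong monoidal functors, monoidal natural transformations. -/
abbrev MonCatS := (strongLayer.{v, u}).Total

/-- Symmetric monoidal categories, symmetric monoidal functors, monoidal natural transformations. -/
abbrev SymMonCat := (symLayer.{v, u}).Total

/-- Symmetric monoidal categories, strong symmetric monoidal functors, monoidal natural
transformations. -/
abbrev SymMonCatS := (strongLayer.{v, u}.prod symLayer.{v, u}).Total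

/-- Strong monoidal fibred categories, strong monoidal functors over `B`, monoidal vertical natural
transformations. -/
abbrev MonFibS (B : Type u₁) [Category.{v₁} B] := (fibStrongLayer.{v, u} B).Total

/-- Symmetric monoidal fibred categories. -/
abbrev SymMonFib (B : Type u₁) [Category.{v₁} B] := (fibSymLayer.{v, u} B).Total

/-- Strong symmetric monoidal fibred categories. -/
abbrev SymMonFibS (B : Type u₁) [Category.{v₁} B] :=
  ((fibStrongLayer.{v, u} B).prod (fibSymLayer.{v, u} B)).Total

variable (κ : ∀ P : Fibr.{v, u} B, Cleavage P.base.p)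

/-- The 2-functor from strong monoidal fibred categories to pseudo-functors. -/
noncomputable def strongIndexed :
    StrictPseudofunctor (MonFibS.{v, u} B) (Psd (Idx B) MonCatS.{v, u}) :=
  (strongLift κ).functor.comp (strongLayer.psdTotal (Idx B))

/-- The 2-functor from symmetric monoidal fibred categories to pseudo-functors. -/
noncomputable def symIndexed :
    StrictPseudofunctor (SymMonFib.{v, u} B) (Psd (Idx B) SymMonCat.{v, u}) :=
  (symLift κ).functor.comp (symLayer.psdTotal (Idx B))

/-- The 2-functor from strong symmetric monoidal fibred categories to pseudo-functors. -/
noncomputable def strongSymIndexed :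
    StrictPseudofunctor (SymMonFibS.{v, u} B) (Psd (Idx B) SymMonCatS.{v, u}) :=
  ((strongLift κ).prod (symLift κ)).functor.comp ((strongLayer.prod symLayer).psdTotal (Idx B))

theorem xiNat_isIso {P Q : BasedCategory.{v, u} B} (κ : Cleavage P.p) (κ' : Cleavage Q.p)
    (F : P ⟶ Q) (h : ∀ {R S : B} (f : R ⟶ S) {a b : P.obj} (φ : a ⟶ b),
      P.p.IsStronglyCartesian f φ → Q.p.IsStronglyCartesian f (F.map φ)) {S T : B} (f : S ⟶ T) :
    IsIso (xiNat κ κ' F f).toCatHom₂ := by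
  have (a : P.p.Fiber T) : IsIso ((xiNat κ κ' F f).app a) :=
    (κ'.cart f (fibObj F a)).isIso_lift (ψ := fibArr F (κ.arr f a)) (h f _ (κ.cart f a))
  have : IsIso (xiNat κ κ' F f) := NatIso.isIso_of_isIso_app _
  exact (Cat.Hom.isoMk (asIso (xiNat κ κ' F f))).isIso_hom

/-- Cartesian functors give pseudo-natural transformations. -/
noncomputable def cartLift :
    Layer.Lift (fibIndexed κ) (fibCartLayer B) (pseudoLayer (Idx B) Cat.{v, u}) :=
  pseudoLift _ _ fun {P Q _ _ F} h _ _ f =>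
    xiNat_isIso (κ P) (κ Q) (Layer.Total.Hom.base F) h.down (Cleavage.bs f)

/-- Cartesian monoidal functors over `B`. -/
abbrev monCartLayer (B : Type u₁) [Category.{v₁} B] : Layer (MonFib.{v, u} B) :=
  (fibCartLayer B).onTotal (fibMonLayer B)

theorem monLayer_invClosed : (monLayer.{v, u}).InvClosed := fun e h => monLayer_two_inv e h

theorem monIndexed_pseudo {x y : MonFib.{v, u} B} {a : (monCartLayer B).Str x}
    {b : (monCartLayer B).Str y} {F : x ⟶ y} (h : (monCartLayer B).Hom a b F) :
    IsPseudoNatural ((monIndexed κ).map F) :=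
  fun f => monLayer_invClosed.isIso _
    (xiNat_isIso (κ x.base) (κ y.base) (Layer.Total.Hom.base F).base h.down (Cleavage.bs f))

/-- Cartesian monoidal functors give pseudo-natural transformations. -/
noncomputable def monCartLift :
    Layer.Lift (monIndexed κ) (monCartLayer B) (pseudoLayer (Idx B) MonCat.{v, u}) :=
  pseudoLift _ _ fun h => monIndexed_pseudo κ h

/-- Cartesian strong monoidal functors give pseudo-natural transformations. -/
noncomputable def strongCartLift :
    Layer.Lift (strongIndexed κ) ((monCartLayer B).onTotal (fibStrongLayer B))
      (pseudoLayer (Idx B) MonCatS.{v, u}) :=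
  pseudoLift _ _ fun h _ _ f =>
    Layer.InvClosed.isIso (fun _ _ => trivial) _ (monIndexed_pseudo κ (a := ⟨trivial⟩) (b := ⟨trivial⟩) h f)

/-- Cartesian symmetric monoidal functors give pseudo-natural transformations. -/
noncomputable def symCartLift :
    Layer.Lift (symIndexed κ) ((monCartLayer B).onTotal (fibSymLayer B))
      (pseudoLayer (Idx B) SymMonCat.{v, u}) :=
  pseudoLift _ _ fun h _ _ f =>
    Layer.InvClosed.isIso (fun _ _ => trivial) _ (monIndexed_pseudo κ (a := ⟨trivial⟩) (b := ⟨trivial⟩) h f)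

theorem strongSym_invClosed : (strongLayer.{v, u}.prod symLayer.{v, u}).InvClosed :=
  fun _ _ => ⟨trivial, trivial⟩

/-- Cartesian strong symmetric monoidal functors give pseudo-natural transformations. -/
noncomputable def strongSymCartLift :
    Layer.Lift (strongSymIndexed κ)
      ((monCartLayer B).onTotal ((fibStrongLayer B).prod (fibSymLayer B)))
      (pseudoLayer (Idx B) SymMonCatS.{v, u}) :=
  pseudoLift _ _ fun h _ _ f =>
    strongSym_invClosed.isIso _ (monIndexed_pseudo κ (a := ⟨trivial⟩) (b := ⟨trivial⟩) h f)

end Correspondences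
end FibMon

namespace FibMon

/-! ### 2-cells of a strict bicategory up to heterogeneous equality. -/

section StrictCalculus

variable {C : Type u} [Bicategory.{w, v} C]

/-! A strict 2-functor that is bijective on 1-cells and on 2-cells, and hits every object up to
isomorphism, is a 2-equivalence: for each object of the codomain choose an object of the domain
whose image is isomorphic to it, and conjugate 1-cells and 2-cells by the chosen isomorphisms. The
codomains in question are strict, so conjugation is functorial on the nose and the chosen
isomorphisms form 2-natural isomorphisms. This is `IsLocalIso.isTwoEquivalence`, and each
2-equivalence of the theorem is obtained by verifying `IsLocalIso`.

For plain fibrations, every arrow over `f` is uniquely a vertical arrow followed by the chosen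
Cartesian arrow. A functor over the base is therefore determined by its values on vertical arrows
and on chosen Cartesian arrows, and these are the components and the structure cells of an oplax
transformation; `ofTrans` rebuilds the functor from them, and `exists_fibMod` does the same for
modifications. Cartesian arrows need not be preserved, which is why the transformations are only
oplax. For essential surjectivity a pseudo-functor is compared with the fibres of its category of
elements. These fibres are isomorphic, not merely equivalent, to its values, and the comparison is
invertible whatever the cleavage (`projHom_sectHom`, `sectHom_projHom`).

The remaining 2-functors are lifts of this one to objects with further structure, organised as
layers. By `Layer.Lift.isLocalIso` a lift inherits the property if structures over fixed underlying
data correspond bijectively and structures on the codomain can be transported along isomorphisms.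
For structures on the components of a pseudo-functor, such transport reduces to transport in the
target 2-category (`Layer.psd_isoFib`), because an invertible oplax transformation has invertible
structure cells (`isPseudoNatural_of_inverse`).

The bijections between structures come from the same factorisation. A tensor product of arrows over
`f` amounts to morphisms `f^* a ⊗ f^* b ⟶ f^*(a ⊗ b)`, and naturality over the base amounts to
coherence of these (`exists_fibMonStr`). Invertibility of these morphisms and of `I ⟶ f^* I`
corresponds to preservation of Cartesian arrows (`isStrong_of_isIso`), compatibility with the
braidings to naturality of the symmetry (`braiding_natural_of_pull`), and invertibility of the
comparison `F(f^* a) ⟶ f^*(F a)` to Cartesianness of `F` (`isStronglyCartesian_map`). -/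

theorem comp₂_heq {a b a' b' : C} {f g h : a ⟶ b} {f' g' h' : a' ⟶ b'} (ea : a = a') (eb : b = b')
    (ef : f ≍ f') (eg : g ≍ g') (eh : h ≍ h') {α : f ⟶ g} {β : g ⟶ h} {α' : f' ⟶ g'}
    {β' : g' ⟶ h'} (eα : α ≍ α') (eβ : β ≍ β') : α ≫ β ≍ α' ≫ β' := by
  subst ea eb ef eg eh eα eβ
  rfl

theorem whiskerLeft_heq {a b c : C} {f f' : a ⟶ b} {g h g' h' : b ⟶ c} (ef : f = f')
    (eg : g = g') (eh : h = h') {α : g ⟶ h} {α' : g' ⟶ h'} (eα : α ≍ α') :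
    f ◁ α ≍ f' ◁ α' := by
  subst ef eg eh eα
  rfl

theorem whiskerRight_heq {a b c : C} {f g f' g' : a ⟶ b} {h h' : b ⟶ c} (ef : f = f')
    (eg : g = g') (eh : h = h') {α : f ⟶ g} {α' : f' ⟶ g'} (eα : α ≍ α') :
    α ▷ h ≍ α' ▷ h' := by
  subst ef eg eh eα
  rfl

theorem id₂_heq {a b : C} {f g : a ⟶ b} (e : f = g) : 𝟙 f ≍ 𝟙 g := by
  subst e
  rfl

/-- Brings a heterogeneous equality into the form with an `eqToHom` on each side in which a strict
2-functor states its compatibility with whiskering. -/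
theorem eq_of_sandwich {a b : C} {f g f' g' : a ⟶ b} {α : f ⟶ g} {β : f' ⟶ g'} (e : f = f')
    (e' : g' = g) (h : α ≍ β) : α = eqToHom e ≫ β ≫ eqToHom e' := by
  subst e e' h
  simp

theorem eqToHom_sandwich_heq {a b : C} {f g f' g' : a ⟶ b} (e : f = f') (α : f' ⟶ g')
    (e' : g' = g) : eqToHom e ≫ α ≫ eqToHom e' ≍ α := by
  subst e e'
  simp

theorem comp_eqToHom_eq_of_heq {a b : C} {f g f' g' : a ⟶ b} {α : f ⟶ g} {β : f' ⟶ g'}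
    (e : f = f') (e' : g = g') (h : α ≍ β) : α ≫ eqToHom e' = eqToHom e ≫ β := by
  subst e e' h
  simp

variable [Strict C]

/-- Here and in the next four lemmas the unitors and associators are `eqToHom`s, which heterogeneous
equality does not see, so the bicategory law loses its coherence cells. -/
theorem id_whiskerLeft_heq {a b : C} {f g : a ⟶ b} (α : f ⟶ g) : 𝟙 a ◁ α ≍ α := by
  rw [id_whiskerLeft, Strict.leftUnitor_eqToIso, Strict.leftUnitor_eqToIso]
  simp only [eqToIso.hom, eqToIso.inv]
  exact eqToHom_sandwich_heq _ _ _

theorem whiskerRight_id_heq {a b : C} {f g : a ⟶ b} (α : f ⟶ g) : α ▷ 𝟙 b ≍ α := by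
  rw [whiskerRight_id, Strict.rightUnitor_eqToIso, Strict.rightUnitor_eqToIso]
  simp only [eqToIso.hom, eqToIso.inv]
  exact eqToHom_sandwich_heq _ _ _

theorem comp_whiskerLeft_heq {a b c d : C} (f : a ⟶ b) (g : b ⟶ c) {h h' : c ⟶ d} (α : h ⟶ h') :
    (f ≫ g) ◁ α ≍ f ◁ g ◁ α := by
  rw [comp_whiskerLeft, Strict.associator_eqToIso, Strict.associator_eqToIso]
  simp only [eqToIso.hom, eqToIso.inv]
  exact eqToHom_sandwich_heq _ _ _

theorem whiskerRight_comp_heq {a b c d : C} {f f' : a ⟶ b} (α : f ⟶ f') (g : b ⟶ c) (h : c ⟶ d) :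
    α ▷ (g ≫ h) ≍ α ▷ g ▷ h := by
  rw [whiskerRight_comp, Strict.associator_eqToIso, Strict.associator_eqToIso]
  simp only [eqToIso.hom, eqToIso.inv]
  exact eqToHom_sandwich_heq _ _ _

theorem whisker_assoc_heq {a b c d : C} (f : a ⟶ b) {g g' : b ⟶ c} (α : g ⟶ g') (h : c ⟶ d) :
    (f ◁ α) ▷ h ≍ f ◁ (α ▷ h) := by
  rw [whisker_assoc, Strict.associator_eqToIso, Strict.associator_eqToIso]
  simp only [eqToIso.hom, eqToIso.inv]
  exact eqToHom_sandwich_heq _ _ _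

/-- Whiskering with both halves of an equality `f ≫ g = 𝟙` does nothing. -/
theorem whiskerRight_inverse_heq {a b c : C} {h h' : a ⟶ b} (α : h ⟶ h') {f : b ⟶ c} {g : c ⟶ b}
    (e : f ≫ g = 𝟙 b) : α ▷ f ▷ g ≍ α :=
  (whiskerRight_comp_heq α f g).symm.trans
    ((whiskerRight_heq rfl rfl e HEq.rfl).trans (whiskerRight_id_heq α))

theorem whiskerLeft_inverse_heq {a b c : C} {h h' : b ⟶ c} (α : h ⟶ h') {f : b ⟶ a} {g : a ⟶ b}
    (e : f ≫ g = 𝟙 b) : f ◁ g ◁ α ≍ α :=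
  (comp_whiskerLeft_heq f g α).symm.trans
    ((whiskerLeft_heq e rfl rfl HEq.rfl).trans (id_whiskerLeft_heq α))

end StrictCalculus

/-! ### From bijectivity on cells to 2-equivalences. -/

section Equivalences

variable {C : Type u} [Bicategory.{w, v} C] {D : Type u'} [Bicategory.{w', v'} D]

/-- A strict 2-functor that is bijective on 1-cells and 2-cells and surjective on objects up to
isomorphism. -/
structure IsLocalIso (T : StrictPseudofunctor C D) : Prop where
  map_injective : ∀ {a b : C} {f g : a ⟶ b}, T.map f = T.map g → f = g
  map_surjective : ∀ {a b : C} (k : T.obj a ⟶ T.obj b), ∃ f : a ⟶ b, T.map f = k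
  map₂_injective : ∀ {a b : C} {f g : a ⟶ b} {α β : f ⟶ g}, T.map₂ α = T.map₂ β → α = β
  map₂_surjective : ∀ {a b : C} {f g : a ⟶ b} (γ : T.map f ⟶ T.map g), ∃ α : f ⟶ g, T.map₂ α = γ
  exists_iso : ∀ d : D, ∃ (c : C) (h : T.obj c ⟶ d) (k : d ⟶ T.obj c), h ≫ k = 𝟙 _ ∧ k ≫ h = 𝟙 _

theorem map₂_eqToHom' (T : StrictPseudofunctor C D) {a b : C} {f g : a ⟶ b} (h : f = g) :
    T.map₂ (eqToHom h) = eqToHom (congrArg T.map h) := by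
  subst h
  simp

theorem map₂_whiskerLeft_heq (T : StrictPseudofunctor C D) {a b c : C} (f : a ⟶ b) {g h : b ⟶ c}
    (α : g ⟶ h) : T.map₂ (f ◁ α) ≍ T.map f ◁ T.map₂ α := by
  rw [T.map₂_whisker_left, T.mapComp_eq_eqToIso, T.mapComp_eq_eqToIso]
  simp only [eqToIso.hom, eqToIso.inv]
  exact eqToHom_sandwich_heq _ _ _

theorem map₂_whiskerRight_heq (T : StrictPseudofunctor C D) {a b c : C} {f g : a ⟶ b}
    (α : f ⟶ g) (h : b ⟶ c) : T.map₂ (α ▷ h) ≍ T.map₂ α ▷ T.map h := by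
  rw [T.map₂_whisker_right, T.mapComp_eq_eqToIso, T.mapComp_eq_eqToIso]
  simp only [eqToIso.hom, eqToIso.inv]
  exact eqToHom_sandwich_heq _ _ _

namespace IsLocalIso

variable {T : StrictPseudofunctor C D} (hT : IsLocalIso T)
include hT

/-- Strictness consists of equations between 1-cells and between 2-cells; they hold in the codomain
and are reflected, since `T` is strict and injective on both kinds of cells. -/
theorem strict [Strict D] : Strict C := by
  have h₁ : ∀ {a b : C} (f : a ⟶ b), 𝟙 a ≫ f = f := fun f =>
    hT.map_injective (by rw [T.map_comp, T.map_id, Strict.id_comp])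
  have h₂ : ∀ {a b : C} (f : a ⟶ b), f ≫ 𝟙 b = f := fun f =>
    hT.map_injective (by rw [T.map_comp, T.map_id, Strict.comp_id])
  have h₃ : ∀ {a b c d : C} (f : a ⟶ b) (g : b ⟶ c) (h : c ⟶ d), (f ≫ g) ≫ h = f ≫ g ≫ h :=
    fun f g h => hT.map_injective (by simp only [T.map_comp, Strict.assoc])
  refine ⟨h₁, h₂, h₃, fun f => Iso.ext (hT.map₂_injective ?_),
    fun f => Iso.ext (hT.map₂_injective ?_), fun f g h => Iso.ext (hT.map₂_injective ?_)⟩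
  · rw [eqToIso.hom, map₂_eqToHom', T.map₂_left_unitor]
    simp [T.mapComp_eq_eqToIso, T.mapId_eq_eqToIso, Strict.leftUnitor_eqToIso]
  · rw [eqToIso.hom, map₂_eqToHom', T.map₂_right_unitor]
    simp [T.mapComp_eq_eqToIso, T.mapId_eq_eqToIso, Strict.rightUnitor_eqToIso]
  · rw [eqToIso.hom, map₂_eqToHom', T.map₂_associator]
    simp [T.mapComp_eq_eqToIso, Strict.associator_eqToIso]

theorem map₂_heq {a b : C} {f g f' g' : a ⟶ b} (e : f = f') (e' : g = g') {α : f ⟶ g}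
    {β : f' ⟶ g'} (h : T.map₂ α ≍ T.map₂ β) : α ≍ β := by
  subst e e'
  exact heq_of_eq (hT.map₂_injective (eq_of_heq h))

/-- An object with image isomorphic to the given one. -/
noncomputable def invObj (d : D) : C := (hT.exists_iso d).choose

/-- The isomorphism. -/
noncomputable def counit (d : D) : T.obj (hT.invObj d) ⟶ d := (hT.exists_iso d).choose_spec.choose

/-- The inverse of the isomorphism. -/
noncomputable def counitInv (d : D) : d ⟶ T.obj (hT.invObj d) :=
  (hT.exists_iso d).choose_spec.choose_spec.choose

theorem counit_counitInv (d : D) : hT.counit d ≫ hT.counitInv d = 𝟙 _ :=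
  (hT.exists_iso d).choose_spec.choose_spec.choose_spec.1

theorem counitInv_counit (d : D) : hT.counitInv d ≫ hT.counit d = 𝟙 _ :=
  (hT.exists_iso d).choose_spec.choose_spec.choose_spec.2

/-- The 1-cell with the given image. -/
noncomputable def preimage {a b : C} (k : T.obj a ⟶ T.obj b) : a ⟶ b := (hT.map_surjective k).choose

theorem map_preimage {a b : C} (k : T.obj a ⟶ T.obj b) : T.map (hT.preimage k) = k :=
  (hT.map_surjective k).choose_spec

/-- The action on 1-cells of the inverse 2-functor. -/
noncomputable def invMap {a b : D} (f : a ⟶ b) : hT.invObj a ⟶ hT.invObj b :=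
  hT.preimage (hT.counit a ≫ f ≫ hT.counitInv b)

theorem map_invMap {a b : D} (f : a ⟶ b) :
    T.map (hT.invMap f) = hT.counit a ≫ f ≫ hT.counitInv b :=
  hT.map_preimage _

/-- The conjugate of `α` has the required boundary only up to propositional equality. Bracketing it
with `eqToHom` makes surjectivity on 2-cells applicable, and heterogeneous equality drops the
brackets again. -/
theorem exists_invMap₂ {a b : D} {f g : a ⟶ b} (α : f ⟶ g) :
    ∃ β : hT.invMap f ⟶ hT.invMap g, T.map₂ β ≍ hT.counit a ◁ (α ▷ hT.counitInv b) := by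
  obtain ⟨β, hβ⟩ := hT.map₂_surjective (eqToHom (hT.map_invMap f) ≫
    (hT.counit a ◁ (α ▷ hT.counitInv b)) ≫ eqToHom (hT.map_invMap g).symm)
  exact ⟨β, hβ ▸ eqToHom_sandwich_heq _ _ _⟩

/-- The action on 2-cells of the inverse 2-functor. -/
noncomputable def invMap₂ {a b : D} {f g : a ⟶ b} (α : f ⟶ g) : hT.invMap f ⟶ hT.invMap g :=
  (hT.exists_invMap₂ α).choose

theorem map₂_invMap₂ {a b : D} {f g : a ⟶ b} (α : f ⟶ g) :
    T.map₂ (hT.invMap₂ α) ≍ hT.counit a ◁ (α ▷ hT.counitInv b) :=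
  (hT.exists_invMap₂ α).choose_spec

variable [Strict C] [Strict D]

/-- The inverse 2-functor. -/
noncomputable def inverse : StrictPseudofunctor D C :=
  have map_id (a : D) : hT.invMap (𝟙 a) = 𝟙 _ := hT.map_injective (by
    rw [map_invMap, Strict.id_comp, counit_counitInv, T.map_id])
  have map_comp {a b c : D} (f : a ⟶ b) (g : b ⟶ c) :
      hT.invMap (f ≫ g) = hT.invMap f ≫ hT.invMap g := hT.map_injective (by
    rw [T.map_comp, map_invMap, map_invMap, map_invMap]
    simp only [Strict.assoc]
    -- The two conjugates meet in the pair `counitInv b ≫ counit b`, which is an identity.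
    rw [← Strict.assoc (hT.counitInv b), counitInv_counit, Strict.id_comp])
  StrictPseudofunctor.mk''
    { obj := hT.invObj
      map := hT.invMap
      map₂ := hT.invMap₂
      map₂_id := fun {a b} f => hT.map₂_injective (eq_of_heq ((hT.map₂_invMap₂ _).trans (by
        rw [id_whiskerRight, whiskerLeft_id, T.map₂_id]
        exact id₂_heq (hT.map_invMap f).symm)))
      map₂_comp := fun {a b f g h} α β => hT.map₂_injective (eq_of_heq ((hT.map₂_invMap₂ _).trans (by
        rw [comp_whiskerRight, whiskerLeft_comp, T.map₂_comp]
        exact comp₂_heq rfl rfl (heq_of_eq (hT.map_invMap f).symm)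
          (heq_of_eq (hT.map_invMap g).symm) (heq_of_eq (hT.map_invMap h).symm)
          (hT.map₂_invMap₂ α).symm (hT.map₂_invMap₂ β).symm)))
      map_id := map_id
      map_comp := map_comp
      map₂_whisker_left := fun {a b c} f g g' η => by
        -- The equation is tested after applying `T`, where all cells are explicit conjugates.
        refine eq_of_sandwich (map_comp f g) (map_comp f g').symm
          (hT.map₂_heq (map_comp f g) (map_comp f g') ?_)
        refine (hT.map₂_invMap₂ _).trans ?_
        refine HEq.trans ?_ (map₂_whiskerLeft_heq T _ _).symm
        refine HEq.trans ?_ (whiskerLeft_heq (hT.map_invMap f) (hT.map_invMap g)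
          (hT.map_invMap g') (hT.map₂_invMap₂ η)).symm
        refine HEq.trans ?_ (comp_whiskerLeft_heq _ _ _).symm
        -- Both sides are now whiskered by `counit a` on the outside; what distinguishes them is the
        -- pair `counitInv b ≫ counit b` between `f` and `η`, removed by `whiskerLeft_inverse_heq`.
        refine whiskerLeft_heq rfl (by simp [← Strict.assoc (hT.counitInv b), counitInv_counit])
          (by simp [← Strict.assoc (hT.counitInv b), counitInv_counit]) ?_
        refine (whisker_assoc_heq _ _ _).trans ?_
        refine HEq.trans ?_ (comp_whiskerLeft_heq _ _ _).symm
        exact whiskerLeft_heq rfl (by simp [← Strict.assoc (hT.counitInv b), counitInv_counit])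
          (by simp [← Strict.assoc (hT.counitInv b), counitInv_counit])
          (whiskerLeft_inverse_heq _ (hT.counitInv_counit b)).symm
      map₂_whisker_right := fun {a b c f f'} η g => by
        refine eq_of_sandwich (map_comp f g) (map_comp f' g).symm
          (hT.map₂_heq (map_comp f g) (map_comp f' g) ?_)
        refine (hT.map₂_invMap₂ _).trans ?_
        refine HEq.trans ?_ (map₂_whiskerRight_heq T _ _).symm
        refine HEq.trans ?_ (whiskerRight_heq (hT.map_invMap f) (hT.map_invMap f')
          (hT.map_invMap g) (hT.map₂_invMap₂ η)).symm
        refine HEq.trans ?_ (whisker_assoc_heq _ _ _).symm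
        refine whiskerLeft_heq rfl (by simp [← Strict.assoc (hT.counitInv b), counitInv_counit])
          (by simp [← Strict.assoc (hT.counitInv b), counitInv_counit]) ?_
        -- The successive right whiskerings are gathered into one, so that the pair `counitInv b ≫
        -- counit b` cancels inside a single 1-cell.
        refine (whiskerRight_comp_heq _ _ _).symm.trans ?_
        refine HEq.trans ?_ (whiskerRight_comp_heq _ _ _)
        exact whiskerRight_heq rfl rfl
          (by simp [← Strict.assoc (hT.counitInv b), counitInv_counit]) HEq.rfl }

theorem counit_naturality {a b : D} (f : a ⟶ b) :
    T.map (hT.invMap f) ≫ hT.counit b = hT.counit a ≫ f := by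
  rw [map_invMap, Strict.assoc, Strict.assoc, counitInv_counit, Strict.comp_id]

theorem counit_naturality₂ {a b : D} {f g : a ⟶ b} (α : f ⟶ g) :
    T.map₂ (hT.invMap₂ α) ▷ hT.counit b ≍ hT.counit a ◁ α := by
  refine (whiskerRight_heq (hT.map_invMap f) (hT.map_invMap g) rfl (hT.map₂_invMap₂ α)).trans ?_
  refine (whisker_assoc_heq _ _ _).trans ?_
  exact whiskerLeft_heq rfl (by simp [counitInv_counit])
    (by simp [counitInv_counit]) (whiskerRight_inverse_heq α (hT.counitInv_counit b))

/-- The 1-cell with image the chosen isomorphism. -/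
noncomputable def unit (c : C) : hT.invObj (T.obj c) ⟶ c := hT.preimage (hT.counit (T.obj c))

/-- The 1-cell with image the inverse of the chosen isomorphism. -/
noncomputable def unitInv (c : C) : c ⟶ hT.invObj (T.obj c) :=
  hT.preimage (hT.counitInv (T.obj c))

theorem map_unit (c : C) : T.map (hT.unit c) = hT.counit (T.obj c) := hT.map_preimage _

theorem map_unitInv (c : C) : T.map (hT.unitInv c) = hT.counitInv (T.obj c) := hT.map_preimage _

theorem unit_unitInv (c : C) : hT.unit c ≫ hT.unitInv c = 𝟙 _ := hT.map_injective (by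
  rw [T.map_comp, map_unit, map_unitInv, counit_counitInv, T.map_id])

theorem unitInv_unit (c : C) : hT.unitInv c ≫ hT.unit c = 𝟙 _ := hT.map_injective (by
  rw [T.map_comp, map_unit, map_unitInv, counitInv_counit, T.map_id])

/-- `T` sends `unit` to the counit at an object of its image, so naturality of the unit is
naturality of the counit, reflected by injectivity. The same holds for 2-cells below. -/
theorem unit_naturality {a b : C} (f : a ⟶ b) :
    hT.invMap (T.map f) ≫ hT.unit b = hT.unit a ≫ f := hT.map_injective (by
  rw [T.map_comp, T.map_comp, map_unit, map_unit, counit_naturality])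

theorem unit_naturality₂ {a b : C} {f g : a ⟶ b} (α : f ⟶ g) :
    hT.invMap₂ (T.map₂ α) ▷ hT.unit b ≍ hT.unit a ◁ α := by
  refine hT.map₂_heq (hT.unit_naturality f) (hT.unit_naturality g) ?_
  refine (map₂_whiskerRight_heq T _ _).trans (HEq.trans ?_ (map₂_whiskerLeft_heq T _ _).symm)
  rw [map_unit, map_unit]
  exact hT.counit_naturality₂ (T.map₂ α)

/-- The 2-functor composed with its inverse on the codomain. -/
noncomputable def counitIso : TwoNatIso (hT.inverse.comp T) (StrictPseudofunctor.id D) where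
  hom := hT.counit
  inv := hT.counitInv
  hom_inv_id := hT.counit_counitInv
  inv_hom_id := hT.counitInv_counit
  naturality f := hT.counit_naturality f
  naturality₂ α := comp_eqToHom_eq_of_heq _ _ (hT.counit_naturality₂ α)

/-- The 2-functor composed with its inverse on the domain. -/
noncomputable def unitIso : TwoNatIso (T.comp hT.inverse) (StrictPseudofunctor.id C) where
  hom := hT.unit
  inv := hT.unitInv
  hom_inv_id := hT.unit_unitInv
  inv_hom_id := hT.unitInv_unit
  naturality f := hT.unit_naturality f
  naturality₂ α := comp_eqToHom_eq_of_heq _ _ (hT.unit_naturality₂ α)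

-- The criterion behind all the 2-equivalences of the theorem. Only the codomain has to be known to
-- be strict; strictness of the domain, needed to build the inverse, is reflected by `T`.
omit [Strict C] in
theorem isTwoEquivalence : IsTwoEquivalence T :=
  have := hT.strict
  ⟨hT.inverse, ⟨hT.unitIso⟩, ⟨hT.counitIso⟩⟩

end IsLocalIso

end Equivalences
end FibMon

/-! ### Lifting the criterion to objects with structure. -/

namespace FibMon

theorem IsLocalIso.comp {C : Type u} [Bicategory.{w, v} C] {D : Type u'} [Bicategory.{w', v'} D]
    {E : Type u₁} [Bicategory.{w₁, v₁} E] [Strict E] {T : StrictPseudofunctor C D}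
    {S : StrictPseudofunctor D E} (hT : IsLocalIso T) (hS : IsLocalIso S) :
    IsLocalIso (T.comp S) where
  map_injective h := hT.map_injective (hS.map_injective h)
  map_surjective k := by
    obtain ⟨l, rfl⟩ := hS.map_surjective k
    obtain ⟨f, rfl⟩ := hT.map_surjective l
    exact ⟨f, rfl⟩
  map₂_injective h := hT.map₂_injective (hS.map₂_injective h)
  map₂_surjective k := by
    obtain ⟨l, rfl⟩ := hS.map₂_surjective k
    obtain ⟨f, rfl⟩ := hT.map₂_surjective l
    exact ⟨f, rfl⟩
  exists_iso d := by
    obtain ⟨c, h, k, e, e'⟩ := hS.exists_iso d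
    obtain ⟨b, l, m, i, i'⟩ := hT.exists_iso c
    refine ⟨b, S.map l ≫ h, k ≫ S.map m, ?_, ?_⟩
    · change (S.map l ≫ h) ≫ k ≫ S.map m = _
      rw [Strict.assoc, ← Strict.assoc h, e, Strict.id_comp, ← S.map_comp, i, S.map_id]
      rfl
    · change (k ≫ S.map m) ≫ S.map l ≫ h = _
      rw [Strict.assoc, ← Strict.assoc (S.map m), ← S.map_comp, i', S.map_id, Strict.id_comp, e']

namespace Layer

variable {C : Type u} [Bicategory.{w, v} C] (L : Layer.{w, v, u, s, t} C)

/-- Structures on equal 1-cells for which the canonical 2-cell satisfies the condition agree. -/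
def Rigid : Prop :=
  ∀ {a b : C} {x : L.Str a} {y : L.Str b} {f g : a ⟶ b} (e : f = g) {h : L.Hom x y f}
    {k : L.Hom x y g}, L.Two h k (eqToHom e) → h ≍ k

/-- Structures on objects can be transported along isomorphisms. -/
def IsoFib : Prop :=
  ∀ {a b : C} (f : a ⟶ b) (g : b ⟶ a) (e : f ≫ g = 𝟙 a) (e' : g ≫ f = 𝟙 b) (y : L.Str b),
    ∃ (x : L.Str a) (h : L.Hom x y f) (k : L.Hom y x g),
      L.Two (L.compHom h k) (L.idHom x) (eqToHom e) ∧
        L.Two (L.compHom k h) (L.idHom y) (eqToHom e')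

/-- Structures on 1-cells can be transported along invertible 2-cells. -/
def HomLift : Prop :=
  ∀ {a b : C} {x : L.Str a} {y : L.Str b} {f g : a ⟶ b} (h : L.Hom x y f) (e : f ≅ g),
    ∃ k : L.Hom x y g, L.Two h k e.hom

variable {L}

/-- Replaces a heterogeneous equality of structures by a condition on a 2-cell, which the layer
axioms can supply. -/
theorem Rigid.hom_ext (hL : L.Rigid) {x y : L.Total} {f g : x ⟶ y} (e : f.base = g.base)
    (h : L.Two f.str g.str (eqToHom e)) : f = g :=
  Total.hom_ext e (hL e h)

theorem two_eqToHom {a b : C} {x : L.Str a} {y : L.Str b} {f g : a ⟶ b} (e : f = g)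
    {h : L.Hom x y f} {k : L.Hom x y g} (e' : h ≍ k) : L.Two h k (eqToHom e) := by
  subst e e'
  exact L.two_id h

theorem two_eqToHom_symm {a b : C} {x : L.Str a} {y : L.Str b} {f g : a ⟶ b} (hL : L.Rigid)
    (e : f = g) {h : L.Hom x y f} {k : L.Hom x y g} (e' : L.Two h k (eqToHom e)) :
    L.Two k h (eqToHom e.symm) :=
  two_eqToHom e.symm (hL e e').symm

/-- The layer axioms say that unitors and associators satisfy the condition on 2-cells. Over a
strict base these cells are `eqToHom`s, and rigidity turns the condition into equality of 1-cells
with structure. -/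
theorem Rigid.strict [Strict C] (hL : L.Rigid) : Strict L.Total := by
  have h₁ : ∀ {a b : L.Total} (f : a ⟶ b), 𝟙 a ≫ f = f := fun f =>
    hL.hom_ext (Strict.id_comp f.base) (by
      have := L.two_leftUnitor f.str
      rwa [Strict.leftUnitor_eqToIso] at this)
  have h₂ : ∀ {a b : L.Total} (f : a ⟶ b), f ≫ 𝟙 b = f := fun f =>
    hL.hom_ext (Strict.comp_id f.base) (by
      have := L.two_rightUnitor f.str
      rwa [Strict.rightUnitor_eqToIso] at this)
  have h₃ : ∀ {a b c d : L.Total} (f : a ⟶ b) (g : b ⟶ c) (h : c ⟶ d),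
      (f ≫ g) ≫ h = f ≫ g ≫ h := fun f g h =>
    hL.hom_ext (Strict.assoc f.base g.base h.base) (by
      have := L.two_associator f.str g.str h.str
      rwa [Strict.associator_eqToIso] at this)
  refine ⟨h₁, h₂, h₃, fun f => Iso.ext (Total.hom₂_ext ?_), fun f => Iso.ext (Total.hom₂_ext ?_),
    fun f g h => Iso.ext (Total.hom₂_ext ?_)⟩
  · rw [eqToIso.hom, Total.eqToHom_base]
    exact congrArg Iso.hom (Strict.leftUnitor_eqToIso f.base)
  · rw [eqToIso.hom, Total.eqToHom_base]
    exact congrArg Iso.hom (Strict.rightUnitor_eqToIso f.base)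
  · rw [eqToIso.hom, Total.eqToHom_base]
    exact congrArg Iso.hom (Strict.associator_eqToIso f.base g.base h.base)

/-- `α` is recovered from `α ▷ k` by whiskering with `k'` and inserting coherence cells and the
identification `k ≫ k' = 𝟙`, all of which satisfy the condition. Conditions may thus be checked
after whiskering with an isomorphism of objects with structure. -/
theorem two_of_whiskerRight (hL : L.Rigid) {a b c : C} {x : L.Str a} {y : L.Str b} {z : L.Str c}
    {f g : a ⟶ b} {hf : L.Hom x y f} {hg : L.Hom x y g} {α : f ⟶ g} {k : b ⟶ c} {k' : c ⟶ b}
    {hk : L.Hom y z k} {hk' : L.Hom z y k'} (e : k ≫ k' = 𝟙 b)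
    (he : L.Two (L.compHom hk hk') (L.idHom y) (eqToHom e))
    (h : L.Two (L.compHom hf hk) (L.compHom hg hk) (α ▷ k)) : L.Two hf hg α := by
  have H : α = (ρ_ f).inv ≫ f ◁ eqToHom e.symm ≫ (α_ f k k').inv ≫ α ▷ k ▷ k' ≫
      (α_ g k k').hom ≫ g ◁ eqToHom e ≫ (ρ_ g).hom := by
    rw [← whiskerRight_comp_assoc, whisker_exchange_assoc, ← whiskerLeft_comp_assoc]
    simp
  rw [H]
  exact L.two_comp (L.two_rightUnitor_inv hf) <|
    L.two_comp (L.two_whiskerLeft hf (two_eqToHom_symm hL e he)) <|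
    L.two_comp (L.two_associator_inv hf hk hk') <| L.two_comp (L.two_whiskerRight hk' h) <|
    L.two_comp (L.two_associator hg hk hk') <| L.two_comp (L.two_whiskerLeft hg he)
      (L.two_rightUnitor hg)

variable {D : Type u'} [Bicategory.{w', v'} D]

/-- On 1-cells and 2-cells the base part is handled by `T` and the structure by the hypotheses over
fixed base cells. Only essential surjectivity mixes the two, and there transport of structure is
needed. -/
theorem Lift.isLocalIso {T : StrictPseudofunctor C D} {M : Layer.{w, v, u, s, t} C}
    {N : Layer.{w', v', u', s', t'} D} (l : Lift T M N) (hT : IsLocalIso T) (hN : N.Rigid)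
    (hN' : N.IsoFib) (str : ∀ {c : C} (y : N.Str (T.obj c)), ∃ x : M.Str c, l.str x = y)
    (inj : ∀ {c d : C} {x : M.Str c} {y : M.Str d} {f : c ⟶ d} {h k : M.Hom x y f},
      l.hom h = l.hom k → h = k)
    (surj : ∀ {c d : C} {x : M.Str c} {y : M.Str d} {f : c ⟶ d}
      (k : N.Hom (l.str x) (l.str y) (T.map f)), ∃ h : M.Hom x y f, l.hom h = k)
    (two : ∀ {c d : C} {x : M.Str c} {y : M.Str d} {f g : c ⟶ d} {h : M.Hom x y f}
      {k : M.Hom x y g} {α : f ⟶ g}, N.Two (l.hom h) (l.hom k) (T.map₂ α) → M.Two h k α) :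
    IsLocalIso l.functor where
  map_injective {a b f g} h := by
    obtain ⟨f, hf⟩ : Total.Hom a b := f
    obtain ⟨g, hg⟩ : Total.Hom a b := g
    obtain rfl : f = g := hT.map_injective (congrArg Total.Hom.base h)
    obtain rfl : hf = hg := by
      refine inj ?_
      have h' : Total.Hom.mk (x := l.functor.obj a) (y := l.functor.obj b) (T.map f) (l.hom hf) =
        Total.Hom.mk (x := l.functor.obj a) (y := l.functor.obj b) (T.map f) (l.hom hg) := h
      injection h'
    rfl
  map_surjective {a b} k := by
    obtain ⟨k, hk⟩ : Total.Hom _ _ := k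
    obtain ⟨f, rfl⟩ := hT.map_surjective (a := a.base) (b := b.base) k
    obtain ⟨h, rfl⟩ := surj hk
    exact ⟨Total.Hom.mk f h, rfl⟩
  map₂_injective h := Total.hom₂_ext (hT.map₂_injective (congrArg Total.Hom₂.base h))
  map₂_surjective {a b f g} γ := by
    obtain ⟨α, hα⟩ := hT.map₂_surjective (f := f.base) (g := g.base) (Total.Hom₂.base γ)
    refine ⟨Total.Hom₂.mk α (two ?_), Total.hom₂_ext hα⟩
    rw [hα]
    exact Total.Hom₂.prop γ
  exists_iso d := by
    obtain ⟨c, h, k, e, e'⟩ := hT.exists_iso d.base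
    -- The structure of `d` is first moved along the base isomorphism to an object in the image of
    -- `T`; only there does `str` apply.
    obtain ⟨y, hh, hk, i, i'⟩ := hN' h k e e' d.str
    obtain ⟨x, rfl⟩ := str y
    exact ⟨⟨c, x⟩, Total.Hom.mk h hh, Total.Hom.mk k hk, hN.hom_ext e i, hN.hom_ext e' i'⟩

end Layer

/-! ### Strictness and invertibility for oplax transformations. -/

section Psd

variable {J : Type u₁} [Bicategory.{w₁, v₁} J] {D : Type u'} [Bicategory.{w', v'} D]

/-- With `eqToHom` components the modification axiom contains no further cells than the structure
cells of `f` and `g`, so it says that these agree. -/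
theorem psd_hom_ext_of_modification {Φ Ψ : Psd J D} {f g : Φ ⟶ Ψ} (Γ : f ⟶ g)
    (h : ∀ a, f.hom.app a = g.hom.app a) (hΓ : ∀ a, Γ.hom.as.app a = eqToHom (h a)) : f = g := by
  refine psd_hom_ext h fun {a b} k => ?_
  have H := Γ.hom.as.naturality k
  rw [hΓ, hΓ, whiskerLeft_eqToHom, eqToHom_whiskerRight] at H
  exact (comp_eqToHom_heq _ _).symm.trans ((heq_of_eq H.symm).trans (eqToHom_comp_heq _ _))

theorem psd_hom₂_ext {Φ Ψ : Psd J D} {f g : Φ ⟶ Ψ} {Γ Γ' : f ⟶ g}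
    (h : ∀ a, Γ.hom.as.app a = Γ'.hom.as.app a) : Γ = Γ' :=
  InducedBicategory.hom₂_ext (Oplax.OplaxTrans.homCategory.ext h)

/-- Unitors and associators of `Psd J D` are modifications with the corresponding cells of `D` as
components. These are `eqToHom`s, so the previous lemma yields the equations between
transformations. -/
instance psd_strict [Strict D] : Strict (Psd J D) := by
  have h₁ : ∀ {a b : Psd J D} (f : a ⟶ b), 𝟙 a ≫ f = f := fun f =>
    psd_hom_ext_of_modification (λ_ f).hom (fun a => Strict.id_comp (f.hom.app a))
      fun a => congrArg Iso.hom (Strict.leftUnitor_eqToIso (f.hom.app a))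
  have h₂ : ∀ {a b : Psd J D} (f : a ⟶ b), f ≫ 𝟙 b = f := fun f =>
    psd_hom_ext_of_modification (ρ_ f).hom (fun a => Strict.comp_id (f.hom.app a))
      fun a => congrArg Iso.hom (Strict.rightUnitor_eqToIso (f.hom.app a))
  have h₃ : ∀ {a b c d : Psd J D} (f : a ⟶ b) (g : b ⟶ c) (h : c ⟶ d),
      (f ≫ g) ≫ h = f ≫ g ≫ h := fun f g h =>
    psd_hom_ext_of_modification (α_ f g h).hom
      (fun a => Strict.assoc (f.hom.app a) (g.hom.app a) (h.hom.app a))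
      fun a => congrArg Iso.hom
        (Strict.associator_eqToIso (f.hom.app a) (g.hom.app a) (h.hom.app a))
  refine ⟨h₁, h₂, h₃, fun f => Iso.ext (psd_hom₂_ext fun a => ?_),
    fun f => Iso.ext (psd_hom₂_ext fun a => ?_), fun f g h => Iso.ext (psd_hom₂_ext fun a => ?_)⟩
  · rw [eqToIso.hom, Layer.psd_eqToHom_app]
    exact congrArg Iso.hom (Strict.leftUnitor_eqToIso (f.hom.app a))
  · rw [eqToIso.hom, Layer.psd_eqToHom_app]
    exact congrArg Iso.hom (Strict.rightUnitor_eqToIso (f.hom.app a))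
  · rw [eqToIso.hom, Layer.psd_eqToHom_app]
    exact congrArg Iso.hom (Strict.associator_eqToIso (f.hom.app a) (g.hom.app a) (h.hom.app a))

section Oplax

variable {Φ Ψ : J ⥤ᵒᵖᴸ D}

theorem oplax_congr_app {f g : Φ ⟶ Ψ} (h : f = g) (a : J) : f.app a = g.app a := by
  rw [h]

theorem oplax_eqToHom_app {f g : Φ ⟶ Ψ} (h : f = g) (a : J) :
    (eqToHom h : f ⟶ g).as.app a = eqToHom (oplax_congr_app h a) := by
  subst h; rfl

theorem oplax_comp_app {τ : Φ ⟶ Ψ} {σ : Ψ ⟶ Φ} (e : τ ≫ σ = 𝟙 Φ) (a : J) :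
    τ.app a ≫ σ.app a = 𝟙 (Φ.obj a) :=
  oplax_congr_app e a

/-- The structure cells of a composite of oplax transformations that is an identity. -/
theorem naturality_of_comp_eq_id {τ : Φ ⟶ Ψ} {σ : Ψ ⟶ Φ} (e : τ ≫ σ = 𝟙 Φ) {a b : J}
    (f : a ⟶ b) :
    (α_ _ _ _).inv ≫ τ.naturality f ▷ σ.app b ≫ (α_ _ _ _).hom ≫
      τ.app a ◁ σ.naturality f ≫ (α_ _ _ _).inv =
    Φ.map f ◁ eqToHom (oplax_comp_app e b) ≫ ((ρ_ (Φ.map f)).hom ≫ (λ_ (Φ.map f)).inv) ≫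
      eqToHom (oplax_comp_app e a).symm ▷ Φ.map f := by
  -- The equality `e` is itself a modification with `eqToHom` components; its axiom at `f` is the
  -- claim, up to moving one `eqToHom` to the other side.
  have H := (eqToHom e).as.naturality f
  rw [oplax_eqToHom_app, oplax_eqToHom_app] at H
  change Φ.map f ◁ eqToHom (oplax_comp_app e b) ≫ ((ρ_ (Φ.map f)).hom ≫ (λ_ (Φ.map f)).inv) =
    ((α_ _ _ _).inv ≫ τ.naturality f ▷ σ.app b ≫ (α_ _ _ _).hom ≫
      τ.app a ◁ σ.naturality f ≫ (α_ _ _ _).inv) ≫ eqToHom (oplax_comp_app e a) ▷ Φ.map f at H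
  rw [← Category.assoc (Φ.map f ◁ _), H, Category.assoc, ← comp_whiskerRight, eqToHom_trans,
    eqToHom_refl, id_whiskerRight, Category.comp_id]

theorem isSplitMono_of_heq {a b : D} {f g f' g' : a ⟶ b} {α : f ⟶ g} {β : f' ⟶ g'} (e : f = f')
    (e' : g = g') (h : α ≍ β) (hβ : IsSplitMono β) : IsSplitMono α := by
  subst e e' h
  exact hβ

theorem isSplitEpi_of_heq {a b : D} {f g f' g' : a ⟶ b} {α : f ⟶ g} {β : f' ⟶ g'} (e : f = f')
    (e' : g = g') (h : α ≍ β) (hβ : IsSplitEpi β) : IsSplitEpi α := by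
  subst e e' h
  exact hβ

/-- The first invertible composite splits `α ▷ s` as a monomorphism, the second splits `r ◁ α` as an
epimorphism. Whiskering with `s'` and `r'` keeps the splittings and gives back `α`, which is then
both split mono and split epi. -/
theorem isIso_of_whisker_isIso [Strict D] {a b a' b' : D} {f g : a ⟶ b} (α : f ⟶ g)
    {s : b ⟶ b'} {s' : b' ⟶ b} (hs : s ≫ s' = 𝟙 b) {r : a' ⟶ a} {r' : a ⟶ a'} (hr : r' ≫ r = 𝟙 a)
    {k : a ⟶ b'} (β : g ≫ s ⟶ k) (h : IsIso (α ▷ s ≫ β)) {l : a' ⟶ b} (γ : l ⟶ r ≫ f)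
    (h' : IsIso (γ ≫ r ◁ α)) : IsIso α := by
  have h₁ : IsSplitMono (α ▷ s) := ⟨⟨⟨β ≫ inv (α ▷ s ≫ β), by
    rw [← Category.assoc, IsIso.hom_inv_id]⟩⟩⟩
  have h₂ : IsSplitEpi (r ◁ α) := ⟨⟨⟨inv (γ ≫ r ◁ α) ≫ γ, by
    rw [Category.assoc, IsIso.inv_hom_id]⟩⟩⟩
  have h₃ : IsSplitMono (α ▷ s ▷ s') := ⟨⟨⟨retraction (α ▷ s) ▷ s', by
    rw [← comp_whiskerRight, IsSplitMono.id, id_whiskerRight]⟩⟩⟩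
  have h₄ : IsSplitEpi (r' ◁ r ◁ α) := ⟨⟨⟨r' ◁ section_ (r ◁ α), by
    rw [← whiskerLeft_comp, IsSplitEpi.id, whiskerLeft_id]⟩⟩⟩
  have h₅ : IsSplitMono α := isSplitMono_of_heq (by rw [Strict.assoc, hs, Strict.comp_id])
    (by rw [Strict.assoc, hs, Strict.comp_id]) (whiskerRight_inverse_heq α hs).symm h₃
  have h₆ : IsSplitEpi α := isSplitEpi_of_heq (by rw [← Strict.assoc, hr, Strict.id_comp])
    (by rw [← Strict.assoc, hr, Strict.id_comp]) (whiskerLeft_inverse_heq α hr).symm h₄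
  exact isIso_of_mono_of_isSplitEpi α

/-- The structure cells of `τ ≫ σ` and `σ ≫ τ` are coherence cells, hence invertible. Up to
associators the first begins with `τ.naturality f` whiskered by `σ.app b` and the second ends with
it whiskered by `σ.app a`, so `isIso_of_whisker_isIso` applies. -/
theorem isIso_naturality_of_inverse [Strict D] {τ : Φ ⟶ Ψ} {σ : Ψ ⟶ Φ} (e : τ ≫ σ = 𝟙 Φ)
    (e' : σ ≫ τ = 𝟙 Ψ) {a b : J} (f : a ⟶ b) : IsIso (τ.naturality f) := by
  have H := naturality_of_comp_eq_id e f
  have H' := naturality_of_comp_eq_id e' f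
  refine isIso_of_whisker_isIso (τ.naturality f) (s := σ.app b) (s' := τ.app b)
    (oplax_comp_app e' b) (r := σ.app a) (r' := τ.app a) (oplax_comp_app e a)
    ((α_ _ _ _).hom ≫ τ.app a ◁ σ.naturality f ≫ (α_ _ _ _).inv) ?_
    ((α_ _ _ _).inv ≫ σ.naturality f ▷ τ.app b ≫ (α_ _ _ _).hom) ?_
  · have h : IsIso ((α_ (Φ.map f) (τ.app b) (σ.app b)).inv ≫ τ.naturality f ▷ σ.app b ≫
        (α_ _ _ _).hom ≫ τ.app a ◁ σ.naturality f ≫ (α_ _ _ _).inv) := by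
      rw [H]; infer_instance
    exact IsIso.of_isIso_comp_left (α_ (Φ.map f) (τ.app b) (σ.app b)).inv _
  · have h : IsIso (((α_ (Ψ.map f) (σ.app b) (τ.app b)).inv ≫ σ.naturality f ▷ τ.app b ≫
        (α_ _ _ _).hom ≫ σ.app a ◁ τ.naturality f) ≫ (α_ _ _ _).inv) := by
      simp only [Category.assoc]
      rw [H']; infer_instance
    have := IsIso.of_isIso_comp_right ((α_ (Ψ.map f) (σ.app b) (τ.app b)).inv ≫
      σ.naturality f ▷ τ.app b ≫ (α_ _ _ _).hom ≫ σ.app a ◁ τ.naturality f)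
      (α_ (σ.app a) (τ.app a) (Ψ.map f)).inv
    simpa only [Category.assoc] using this

end Oplax

theorem isPseudoNatural_of_inverse [Strict D] {Φ Ψ : Psd J D} {τ : Φ ⟶ Ψ} {σ : Ψ ⟶ Φ}
    (e : τ ≫ σ = 𝟙 Φ) (e' : σ ≫ τ = 𝟙 Ψ) : IsPseudoNatural τ := fun f =>
  isIso_naturality_of_inverse (congrArg InducedBicategory.Hom.hom e)
    (congrArg InducedBicategory.Hom.hom e') f

end Psd

/-! ### Transport of structures on pseudo-functors. -/

namespace Layer

theorem propLayer_rigid {C : Type u} [Bicategory.{w, v} C] {P : C → Prop}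
    {Q : ∀ {a b : C}, P a → P b → (a ⟶ b) → Prop} (id) (comp) :
    (propLayer P Q id comp).Rigid :=
  fun _ _ _ _ => plift_heq _ _

variable {J : Type u₁} [Bicategory.{w₁, v₁} J] {D : Type u'} [Bicategory.{w', v'} D]

/-- Objects carry no extra structure here, so transport only requires an isomorphism and its inverse
to be pseudo-natural. -/
theorem pseudoLayer_isoFib [Strict D] : (pseudoLayer J D).IsoFib := fun f g e e' y =>
  ⟨y, ⟨isPseudoNatural_of_inverse e e'⟩, ⟨isPseudoNatural_of_inverse e' e⟩, trivial, trivial⟩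

/-- Between pseudo-natural transformations there is no condition on 2-cells and no data on objects.
What remains is `hom`: a 1-cell with pseudo-natural image must belong to the restricted domain. -/
theorem Lift.pseudo_isLocalIso {C : Type u} [Bicategory.{w, v} C] [Strict D]
    {T : StrictPseudofunctor C (Psd J D)} (hT : IsLocalIso T) {M : Layer.{w, v, u, s, t} C}
    (l : Lift T M (pseudoLayer J D)) (str : ∀ c, Nonempty (M.Str c))
    (hom : ∀ {c d : C} (x : M.Str c) (y : M.Str d) (f : c ⟶ d), IsPseudoNatural (T.map f) →
      Nonempty (M.Hom x y f))
    (sub : ∀ {c d : C} (x : M.Str c) (y : M.Str d) (f : c ⟶ d), Subsingleton (M.Hom x y f))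
    (two : ∀ {c d : C} {x : M.Str c} {y : M.Str d} {f g : c ⟶ d} (h : M.Hom x y f)
      (k : M.Hom x y g) (α : f ⟶ g), M.Two h k α) :
    IsLocalIso l.functor :=
  l.isLocalIso hT (propLayer_rigid _ _) pseudoLayer_isoFib
    (fun {c} y => ⟨(str c).some, Subsingleton.elim (α := PLift _) _ _⟩)
    (fun {_ _ x y f} _ _ _ => (sub x y f).elim _ _)
    (fun {_ _ x y f} k => ⟨(hom x y f k.down).some, Subsingleton.elim (α := PLift _) _ _⟩)
    (fun {_ _ _ _ _ _ h k α} _ => two h k α)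

section PsdLayer

variable {C : Type u} [Bicategory.{w, v} C] {L : Layer.{w, v, u, s, t} C}

theorem Rigid.psd (hL : L.Rigid) : (L.psd J).Rigid := fun e _ _ H => PsdHom.heq e fun a => by
  have := H a
  rw [psd_eqToHom_app] at this
  exact hL _ this

/-- Both sides consist of the same data differently bundled, so every preimage is a repackaging and
the isomorphisms on objects are identities. Rigidity enters only through strictness, for `𝟙 d ≫ 𝟙 d
= 𝟙 d`. -/
theorem psdTotal_isLocalIso [Strict C] (hL : L.Rigid) : IsLocalIso (L.psdTotal J) where
  map_injective {a b f g} h := by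
    obtain ⟨f, hf⟩ : Total.Hom a b := f
    obtain ⟨g, hg⟩ : Total.Hom a b := g
    obtain rfl : f = g := congrArg (fun k => (L.psdForget J).map k) h
    obtain rfl : hf = hg := eq_of_heq (PsdHom.heq rfl fun c => by
      have := congrArg (fun τ => τ.hom.app c) h
      have h' : Total.Hom.mk (x := ⟨a.base.obj c, a.str.str c⟩) (y := ⟨b.base.obj c, b.str.str c⟩)
        (f.hom.app c) (hf.app c) = Total.Hom.mk (x := ⟨a.base.obj c, a.str.str c⟩)
          (y := ⟨b.base.obj c, b.str.str c⟩) (f.hom.app c) (hg.app c) := this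
      injection h' with _ h''
      exact heq_of_eq h'')
    rfl
  map_surjective {a b} k :=
    ⟨Total.Hom.mk (InducedBicategory.mkHom (baseTrans k.hom))
      { app := fun c => (k.hom.app c).str
        two_naturality := fun f => (k.hom.naturality f).prop }, rfl⟩
  map₂_injective {a b f g α β} h := Total.hom₂_ext (psd_hom₂_ext fun c =>
    congrArg (fun Γ => Total.Hom₂.base (Γ.hom.as.app c)) h)
  map₂_surjective {a b f g} γ :=
    ⟨Total.Hom₂.mk ⟨⟨⟨fun c => (γ.hom.as.app c).base, fun k =>
      congrArg Total.Hom₂.base (γ.hom.as.naturality k)⟩⟩⟩ fun c => (γ.hom.as.app c).prop, rfl⟩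
  exists_iso d := by
    have := hL.strict
    exact ⟨⟨basePsd d,
      { str := fun a => (d.obj a).str
        hom := fun f => (d.map f).str
        two_map₂ := fun α => (d.map₂ α).prop
        two_mapId := fun a => (d.mapId a).hom.prop
        two_mapId_inv := fun a => (d.mapId a).inv.prop
        two_mapComp := fun f g => (d.mapComp f g).hom.prop
        two_mapComp_inv := fun f g => (d.mapComp f g).inv.prop }⟩, 𝟙 d, 𝟙 d,
      Strict.id_comp (𝟙 d), Strict.id_comp (𝟙 d)⟩

section Transport

variable (hL : L.Rigid) (hL₁ : L.IsoFib) (hL₂ : L.HomLift) (hL₃ : L.InvClosed)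
include hL hL₁ hL₂ hL₃

/-- The structures on the objects come from `hL₁`, those on the 1-cells `Φ.map f` from conjugation
of `Y.hom f`. Every condition on a 2-cell is then verified after whiskering with an isomorphism,
where the axioms of the transformation express the cell through cells of `Ψ`. The hypotheses spell
out an invertible oplax transformation: `n` consists of the structure cells of `τ`, `m` of those of
its inverse `σ`. -/
theorem exists_psdStr {Φ Ψ : J ⥤ᵖ C} (τ : ∀ a, Φ.obj a ⟶ Ψ.obj a) (σ : ∀ a, Ψ.obj a ⟶ Φ.obj a)
    (e : ∀ a, τ a ≫ σ a = 𝟙 (Φ.obj a)) (e' : ∀ a, σ a ≫ τ a = 𝟙 (Ψ.obj a))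
    (n : ∀ {a b : J} (f : a ⟶ b), Φ.map f ≫ τ b ≅ τ a ≫ Ψ.map f)
    (n_map₂ : ∀ {a b : J} {f g : a ⟶ b} (α : f ⟶ g),
      Φ.map₂ α ▷ τ b ≫ (n g).hom = (n f).hom ≫ τ a ◁ Ψ.map₂ α)
    (n_id : ∀ a, (n (𝟙 a)).hom ≫ τ a ◁ (Ψ.mapId a).hom =
      (Φ.mapId a).hom ▷ τ a ≫ (λ_ (τ a)).hom ≫ (ρ_ (τ a)).inv)
    (n_comp : ∀ {a b c : J} (f : a ⟶ b) (g : b ⟶ c), (n (f ≫ g)).hom ≫ τ a ◁ (Ψ.mapComp f g).hom =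
      (Φ.mapComp f g).hom ▷ τ c ≫ (α_ _ _ _).hom ≫ Φ.map f ◁ (n g).hom ≫
          (α_ _ _ _).inv ≫ (n f).hom ▷ Ψ.map g ≫ (α_ _ _ _).hom)
    (m : ∀ {a b : J} (f : a ⟶ b), Ψ.map f ≫ σ b ⟶ σ a ≫ Φ.map f)
    (m_n : ∀ {a b : J} (f : a ⟶ b), (α_ _ _ _).inv ≫ m f ▷ τ b ≫ (α_ _ _ _).hom ≫
      σ a ◁ (n f).hom ≫ (α_ _ _ _).inv = Ψ.map f ◁ eqToHom (e' b) ≫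
        ((ρ_ (Ψ.map f)).hom ≫ (λ_ (Ψ.map f)).inv) ≫ eqToHom (e' a).symm ▷ Ψ.map f)
    (Y : L.PsdStr Ψ) :
    ∃ (X : L.PsdStr Φ) (h : ∀ a, L.Hom (X.str a) (Y.str a) (τ a))
      (k : ∀ a, L.Hom (Y.str a) (X.str a) (σ a)),
      (∀ {a b : J} (f : a ⟶ b),
        L.Two (L.compHom (X.hom f) (h b)) (L.compHom (h a) (Y.hom f)) (n f).hom) ∧
      (∀ {a b : J} (f : a ⟶ b),
        L.Two (L.compHom (Y.hom f) (k b)) (L.compHom (k a) (X.hom f)) (m f)) ∧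
      ∀ a, L.Two (L.compHom (h a) (k a)) (L.idHom (X.str a)) (eqToHom (e a)) ∧
        L.Two (L.compHom (k a) (h a)) (L.idHom (Y.str a)) (eqToHom (e' a)) := by
  choose x hτ hσ h₁ h₂ using fun a => hL₁ (τ a) (σ a) (e a) (e' a) (Y.str a)
  -- The naturality cell exhibits `Φ.map f` as a conjugate of `Ψ.map f`. The conjugate carries an
  -- evident structure, which `hL₂` moves to `Φ.map f`.
  let φ {a b : J} (f : a ⟶ b) : Φ.map f ≅ τ a ≫ Ψ.map f ≫ σ b :=
    (ρ_ _).symm ≪≫ whiskerLeftIso (Φ.map f) (eqToIso (e b).symm) ≪≫ (α_ _ _ _).symm ≪≫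
      whiskerRightIso (n f) (σ b) ≪≫ α_ _ _ _
  choose l hl using fun {a b : J} (f : a ⟶ b) =>
    hL₂ (L.compHom (hτ a) (L.compHom (Y.hom f) (hσ b))) (φ f).symm
  have hl' {a b : J} (f : a ⟶ b) : L.Two (l f) _ (φ f).hom := hL₃ (φ f).symm (hl f)
  have nτ {a b : J} (f : a ⟶ b) : L.Two (L.compHom (l f) (hτ b)) (L.compHom (hτ a) (Y.hom f))
      (n f).hom := by
    refine two_of_whiskerRight hL (e' b) (h₂ b) (hk := hσ b) ?_
    -- Whiskered with `σ b`, the cell `n f` becomes `φ f` up to coherence, and along `φ f` the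
    -- structure was transported.
    have H : (n f).hom ▷ σ b = (α_ _ _ _).hom ≫
        Φ.map f ◁ eqToHom (e b) ≫ (ρ_ _).hom ≫ (φ f).hom ≫ (α_ _ _ _).inv := by
      simp only [φ, Iso.trans_hom, Iso.symm_hom, whiskerLeftIso_hom, whiskerRightIso_hom,
        eqToIso.hom, Category.assoc, Iso.hom_inv_id_assoc, Iso.hom_inv_id, Category.comp_id]
      rw [← whiskerLeft_comp_assoc, eqToHom_trans, eqToHom_refl, whiskerLeft_id,
        Category.id_comp, Iso.hom_inv_id_assoc]
    rw [H]
    exact L.two_comp (L.two_associator _ _ _) <| L.two_comp (L.two_whiskerLeft _ (h₁ b)) <|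
      L.two_comp (L.two_rightUnitor _) <| L.two_comp (hl' f) (L.two_associator_inv _ _ _)
  have nτ' {a b : J} (f : a ⟶ b) : L.Two (L.compHom (hτ a) (Y.hom f)) (L.compHom (l f) (hτ b))
      (n f).inv := hL₃ _ (nτ f)
  have two_map₂ {a b : J} {f g : a ⟶ b} (α : f ⟶ g) : L.Two (l f) (l g) (Φ.map₂ α) := by
    refine two_of_whiskerRight hL (e b) (h₁ b) (hk := hτ b) ?_
    -- The transformation axiom, solved for the cell of `Φ`; the same is done for `mapId` and
    -- `mapComp` below.
    have H : Φ.map₂ α ▷ τ b = (n f).hom ≫ τ a ◁ Ψ.map₂ α ≫ (n g).inv := by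
      rw [← Category.assoc, Iso.eq_comp_inv, n_map₂]
    rw [H]
    exact L.two_comp (nτ f) <| L.two_comp (L.two_whiskerLeft _ (Y.two_map₂ α)) (nτ' g)
  have two_mapId (a : J) : L.Two (l (𝟙 a)) (L.idHom (x a)) (Φ.mapId a).hom := by
    refine two_of_whiskerRight hL (e a) (h₁ a) (hk := hτ a) ?_
    have H : (Φ.mapId a).hom ▷ τ a = (n (𝟙 a)).hom ≫ τ a ◁ (Ψ.mapId a).hom ≫
        (ρ_ _).hom ≫ (λ_ _).inv := by
      rw [reassoc_of% n_id]
      simp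
    rw [H]
    exact L.two_comp (nτ _) <| L.two_comp (L.two_whiskerLeft _ (Y.two_mapId a)) <|
      L.two_comp (L.two_rightUnitor _) (L.two_leftUnitor_inv _)
  have two_mapComp {a b c : J} (f : a ⟶ b) (g : b ⟶ c) :
      L.Two (l (f ≫ g)) (L.compHom (l f) (l g)) (Φ.mapComp f g).hom := by
    refine two_of_whiskerRight hL (e c) (h₁ c) (hk := hτ c) ?_
    have H : (Φ.mapComp f g).hom ▷ τ c = (n (f ≫ g)).hom ≫
        τ a ◁ (Ψ.mapComp f g).hom ≫ (α_ _ _ _).inv ≫ (n f).inv ▷ Ψ.map g ≫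
          (α_ _ _ _).hom ≫ Φ.map f ◁ (n g).inv ≫ (α_ _ _ _).inv := by
      rw [reassoc_of% n_comp]
      simp
    rw [H]
    exact L.two_comp (nτ _) <| L.two_comp (L.two_whiskerLeft _ (Y.two_mapComp f g)) <|
      L.two_comp (L.two_associator_inv _ _ _) <| L.two_comp (L.two_whiskerRight _ (nτ' f)) <|
      L.two_comp (L.two_associator _ _ _) <| L.two_comp (L.two_whiskerLeft _ (nτ' g))
        (L.two_associator_inv _ _ _)
  refine ⟨⟨x, l, two_map₂, two_mapId, fun a => hL₃ _ (two_mapId a), two_mapComp,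
    fun f g => hL₃ _ (two_mapComp f g)⟩, hτ, hσ, nτ, fun {a b} f => ?_, fun a => ⟨h₁ a, h₂ a⟩⟩
  refine two_of_whiskerRight hL (e b) (h₁ b) (hk := hτ b) ?_
  -- The relation `m_n` says that the structure cells of `σ ≫ τ` are trivial; as `n f` is invertible
  -- it can be solved for `m f ▷ τ b`.
  have H : m f ▷ τ b = (α_ _ _ _).hom ≫
      Ψ.map f ◁ eqToHom (e' b) ≫ ((ρ_ (Ψ.map f)).hom ≫ (λ_ (Ψ.map f)).inv) ≫
        eqToHom (e' a).symm ▷ Ψ.map f ≫ (α_ _ _ _).hom ≫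
          σ a ◁ (n f).inv ≫ (α_ _ _ _).inv := by
    rw [← Category.assoc (_ ≫ _) (eqToHom (e' a).symm ▷ Ψ.map f),
      ← Category.assoc (Ψ.map f ◁ _), ← m_n]
    simp
  rw [H]
  exact L.two_comp (L.two_associator _ _ _) <| L.two_comp (L.two_whiskerLeft _ (h₂ b)) <|
    L.two_comp (L.two_comp (L.two_rightUnitor _) (L.two_leftUnitor_inv _)) <|
    L.two_comp (L.two_whiskerRight _ (two_eqToHom_symm hL _ (h₂ a))) <|
    L.two_comp (L.two_associator _ _ _) <| L.two_comp (L.two_whiskerLeft _ (nτ' f))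
      (L.two_associator_inv _ _ _)

/-- Unpacks the isomorphism into components and structure cells; those of `τ` are invertible by
`isPseudoNatural_of_inverse`, as `exists_psdStr` requires. -/
theorem psd_isoFib [Strict C] : (L.psd J).IsoFib := fun {Φ Ψ} τ σ e e' Y => by
  have e₁ := congrArg InducedBicategory.Hom.hom e
  have e₂ := congrArg InducedBicategory.Hom.hom e'
  obtain ⟨X, h, k, H₁, H₂, H₃⟩ := exists_psdStr (J := J) hL hL₁ hL₂ hL₃ (Φ := Φ) (Ψ := Ψ)
    τ.hom.app σ.hom.app (oplax_comp_app e₁) (oplax_comp_app e₂)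
    (fun f => @asIso _ _ _ _ (τ.hom.naturality f) (isPseudoNatural_of_inverse e e' f)) τ.hom.naturality_naturality τ.hom.naturality_id
    τ.hom.naturality_comp σ.hom.naturality (naturality_of_comp_eq_id e₂) Y
  refine ⟨X, ⟨h, H₁⟩, ⟨k, H₂⟩, fun a => ?_, fun a => ?_⟩
  · rw [psd_eqToHom_app]
    exact (H₃ a).1
  · rw [psd_eqToHom_app]
    exact (H₃ a).2

end Transport

end PsdLayer

end Layer
end FibMon

namespace FibMon

/-! ### Functors over the base from oplax transformations. -/

section OfTrans

variable {B : Type u₁} [Category.{v₁} B] {P Q : BasedCategory.{v, u} B}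

/-- The object of the index 2-category given by an object of the base. -/
abbrev idx (S : B) : Idx B := ⟨Opposite.op S⟩

/-- The 1-cell of the index 2-category given by an arrow of the base. -/
abbrev ixHom {S T : B} (f : S ⟶ T) : idx T ⟶ idx S := f.op.toLoc

variable {κ : Cleavage P.p} {κ' : Cleavage Q.p}

namespace OfTrans

variable (τ : Oplax.OplaxTrans κ.psd.toOplax κ'.psd.toOplax)

/-- The action of a component on objects. -/
def obj {S : B} (a : P.p.Fiber S) : Q.p.Fiber S := (τ.app (idx S)).toFunctor.obj a

/-- The action of a component on vertical arrows. -/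
def map {S : B} {a b : P.p.Fiber S} (u : a ⟶ b) : obj τ a ⟶ obj τ b :=
  (τ.app (idx S)).toFunctor.map u

/-- The structure morphism. -/
def nat {S T : B} (f : S ⟶ T) (a : P.p.Fiber T) : obj τ (κ.obj f a) ⟶ κ'.obj f (obj τ a) :=
  (τ.naturality (ixHom f)).toNatTrans.app a

theorem map_id {S : B} (a : P.p.Fiber S) : map τ (𝟙 a) = 𝟙 (obj τ a) :=
  (τ.app (idx S)).toFunctor.map_id a

theorem map_comp {S : B} {a b c : P.p.Fiber S} (u : a ⟶ b) (v : b ⟶ c) :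
    map τ (u ≫ v) = map τ u ≫ map τ v :=
  (τ.app (idx S)).toFunctor.map_comp u v

theorem nat_natural {S T : B} (f : S ⟶ T) {a b : P.p.Fiber T} (u : a ⟶ b) :
    map τ (κ.map f u) ≫ nat τ f b = nat τ f a ≫ κ'.map f (map τ u) :=
  (τ.naturality (ixHom f)).toNatTrans.naturality u

/-- Here and in `nat_comp` the axiom of an oplax transformation is evaluated at an object, where the
coherence cells of `Cat` are identities and drop out. -/
theorem nat_id {S : B} (a : P.p.Fiber S) :
    nat τ (𝟙 S) a ≫ κ'.unitHom (obj τ a) = map τ (κ.unitHom a) := by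
  have h : nat τ (𝟙 S) a ≫ κ'.unitHom (obj τ a) =
      map τ (κ.unitHom a) ≫ 𝟙 (obj τ a) ≫ 𝟙 (obj τ a) :=
    congrArg (fun α => α.toNatTrans.app a) (τ.naturality_id (idx S))
  rw [h, Category.comp_id, Category.comp_id]

theorem nat_comp {S T U : B} (f : S ⟶ T) (g : T ⟶ U) (a : P.p.Fiber U) :
    nat τ (f ≫ g) a ≫ κ'.compHom f g (obj τ a) =
      map τ (κ.compHom f g a) ≫ nat τ f (κ.obj g a) ≫ κ'.map f (nat τ g a) := by
  have h : nat τ (f ≫ g) a ≫ κ'.compHom f g (obj τ a) =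
      map τ (κ.compHom f g a) ≫ 𝟙 (obj τ (κ.obj f (κ.obj g a))) ≫ nat τ f (κ.obj g a) ≫
        𝟙 (κ'.obj f (obj τ (κ.obj g a))) ≫ κ'.map f (nat τ g a) ≫
          𝟙 (κ'.obj f (κ'.obj g (obj τ a))) :=
    congrArg (fun α => α.toNatTrans.app a) (τ.naturality_comp (ixHom g) (ixHom f))
  rw [h, Category.id_comp, Category.id_comp, Category.comp_id]

/-- The action on arrows lying over an arbitrary arrow of the base. -/
noncomputable def arr {S T : B} {f : S ⟶ T} {a : P.p.Fiber S} {b : P.p.Fiber T}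
    (φ : ArrOver P.p f a b) : ArrOver Q.p f (obj τ a) (obj τ b) :=
  ArrOver.vcomp (map τ ((κ.cart f b).lift φ) ≫ nat τ f b) (κ'.arr f (obj τ b))

theorem arr_val {S T : B} {f : S ⟶ T} {a : P.p.Fiber S} {b : P.p.Fiber T}
    (φ : ArrOver P.p f a b) : (arr τ φ).1 =
      (map τ ((κ.cart f b).lift φ)).1 ≫ (nat τ f b).1 ≫ (κ'.arr f (obj τ b)).1 :=
  Category.assoc _ _ _

theorem arr_cast {S T : B} {f g : S ⟶ T} (h : f = g) {a : P.p.Fiber S} {b : P.p.Fiber T}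
    (φ : ArrOver P.p f a b) : (arr τ (ArrOver.cast h φ)).1 = (arr τ φ).1 := by
  subst h; rfl

/-- The chosen Cartesian arrow over an identity is itself vertical, so `u` is its lift followed by
`unitHom`; by `nat_id` the structure cell contributes the value of `τ` at `unitHom`. -/
theorem arr_vert {S : B} {a b : P.p.Fiber S} (u : a ⟶ b) : arr τ (f := 𝟙 S) u = map τ u := by
  refine Subtype.ext ((arr_val τ _).trans ?_)
  have h : (κ.cart (𝟙 S) b).lift u ≫ κ.unitHom b = u := Subtype.ext ((κ.cart (𝟙 S) b).lift_fac u)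
  conv_rhs => rw [← h, map_comp, ← nat_id]
  rfl

theorem arr_cleavage {S T : B} (f : S ⟶ T) (a : P.p.Fiber T) :
    (arr τ (κ.arr f a)).1 = (nat τ f a).1 ≫ (κ'.arr f (obj τ a)).1 := by
  have h : (κ.cart f a).lift (κ.arr f a) = 𝟙 (κ.obj f a) := (κ.cart f a).ext (by simp)
  rw [arr_val, h, map_id]
  exact Category.id_comp _

/-- The lift of a composite agrees, through `compHom`, with the lift of `φ` followed by the inverse
image of the lift of `ψ`. Then `nat_comp` splits the structure cell and `nat_natural` moves it past
the second lift. -/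
theorem arr_comp {R S T : B} {f : R ⟶ S} {g : S ⟶ T} {a : P.p.Fiber R} {b : P.p.Fiber S}
    {c : P.p.Fiber T} (φ : ArrOver P.p f a b) (ψ : ArrOver P.p g b c) :
    arr τ (ArrOver.comp φ ψ) = ArrOver.comp (arr τ φ) (arr τ ψ) := by
  refine Subtype.ext ?_
  have h : (κ.cart (f ≫ g) c).lift (ArrOver.comp φ ψ) ≫ κ.compHom f g c =
      (κ.cart f b).lift φ ≫ κ.map f ((κ.cart g c).lift ψ) := κ.ext₂ (by simp)
  have h' : map τ ((κ.cart (f ≫ g) c).lift (ArrOver.comp φ ψ)) ≫ nat τ (f ≫ g) c ≫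
      κ'.compHom f g (obj τ c) = map τ ((κ.cart f b).lift φ) ≫ nat τ f b ≫
        κ'.map f (map τ ((κ.cart g c).lift ψ)) ≫ κ'.map f (nat τ g c) := by
    rw [nat_comp, ← Category.assoc, ← map_comp, h, map_comp, Category.assoc, ← Category.assoc,
      ← Category.assoc, ← Category.assoc, Category.assoc (map τ _), nat_natural]
    simp only [Category.assoc]
  -- Composition with the chosen Cartesian arrows turns the equation of vertical arrows into one
  -- between arrows of the total category.
  have h'' := congrArg (fun k => k.1 ≫ (κ'.arr f _).1 ≫ (κ'.arr g (obj τ c)).1) h'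
  simp only [Fib.comp_val, Category.assoc, Cleavage.compHom_fac, Cleavage.map_fac_assoc] at h''
  simp only [ArrOver.comp_val, arr_val, Category.assoc]
  exact h''

end OfTrans

open OfTrans

/-- The functor over `B` with given restrictions to fibres. -/
noncomputable def ofTrans (τ : Oplax.OplaxTrans κ.psd.toOplax κ'.psd.toOplax) : P ⟶ Q where
  obj a := (obj τ ⟨a, rfl⟩).1
  map {a b} φ := (arr τ (f := P.p.map φ) (a := ⟨a, rfl⟩) (b := ⟨b, rfl⟩) ⟨φ, .map φ⟩).1
  map_id a := by
    -- The image of an identity under the projection is an identity only propositionally, whence the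
    -- passage through `arr_cast`; likewise for composites below.
    refine Eq.trans ?_ (congrArg Subtype.val
      ((arr_vert τ (𝟙 (Functor.Fiber.mk (p := P.p) (a := a) rfl))).trans (map_id τ _)))
    exact (arr_cast τ (P.p.map_id a) (a := ⟨a, rfl⟩) (b := ⟨a, rfl⟩) ⟨𝟙 a, .map _⟩).symm
  map_comp {a b c} φ ψ := by
    refine Eq.trans ?_ (congrArg Subtype.val (arr_comp τ (a := ⟨a, rfl⟩) (b := ⟨b, rfl⟩)
      (c := ⟨c, rfl⟩) ⟨φ, .map φ⟩ ⟨ψ, .map ψ⟩))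
    exact (arr_cast τ (P.p.map_comp φ ψ) (a := ⟨a, rfl⟩) (b := ⟨c, rfl⟩) ⟨φ ≫ ψ, .map _⟩).symm
  w := CategoryTheory.Functor.ext (fun a => (OfTrans.obj τ ⟨a, rfl⟩).2) fun a b φ =>
    have := (arr τ (f := P.p.map φ) (a := ⟨a, rfl⟩) (b := ⟨b, rfl⟩) ⟨φ, .map φ⟩).2
    IsHomLift.fac' Q.p (P.p.map φ) _

theorem fibObj_ofTrans (τ : Oplax.OplaxTrans κ.psd.toOplax κ'.psd.toOplax) {S : B}
    (a : P.p.Fiber S) : fibObj (ofTrans τ) a = obj τ a := by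
  obtain ⟨a, rfl⟩ := a
  rfl

theorem fibArr_ofTrans (τ : Oplax.OplaxTrans κ.psd.toOplax κ'.psd.toOplax) {S T : B} {f : S ⟶ T}
    {a : P.p.Fiber S} {b : P.p.Fiber T} (φ : ArrOver P.p f a b) :
    fibArr (ofTrans τ) φ ≍ arr τ φ := by
  obtain ⟨a, rfl⟩ := a
  obtain ⟨b, rfl⟩ := b
  obtain ⟨φ, hφ⟩ := φ
  obtain rfl := IsHomLift.eq_of_isHomLift P.p f φ
  rfl

/-- All data of `τ` can be read off from its action on arrows: vertical arrows give the components
by `arr_vert`, chosen Cartesian arrows give the structure cells by `arr_cleavage`. -/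
theorem fibTrans_eq_of {F : P ⟶ Q} {τ : Oplax.OplaxTrans κ.psd.toOplax κ'.psd.toOplax}
    (h : ∀ {S : B} (a : P.p.Fiber S), fibObj F a = obj τ a)
    (h' : ∀ {S T : B} {f : S ⟶ T} {a : P.p.Fiber S} {b : P.p.Fiber T} (φ : ArrOver P.p f a b),
      fibArr F φ ≍ arr τ φ) : fibTrans κ κ' F = τ := by
  have H (X : Idx B) : (fibTrans κ κ' F).app X = τ.app X := by
    refine Cat.Hom.ext (Functor.hext (fun a => h a) fun a b u => ?_)
    exact (h' (f := 𝟙 X.as.unop) u).trans (heq_of_eq (arr_vert τ u))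
  obtain ⟨t, n, n₁, n₂, n₃⟩ := τ
  obtain rfl : (fibTrans κ κ' F).app = t := funext H
  have H' {X Y : Idx B} (k : X ⟶ Y) : (fibTrans κ κ' F).naturality k = n k := by
    refine Cleavage.hom₂_ext fun a => (κ'.cart (Cleavage.bs k) (fibObj F a)).ext ?_
    refine (xi_fac κ κ' F _ a).trans ?_
    exact (congrArg Subtype.val (eq_of_heq (h' (κ.arr (Cleavage.bs k) a)))).trans
      (arr_cleavage _ (Cleavage.bs k) a)
  obtain rfl : @(fibTrans κ κ' F).naturality = @n := by
    funext X Y k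
    exact H' k
  rfl

theorem fibTrans_ofTrans (τ : Oplax.OplaxTrans κ.psd.toOplax κ'.psd.toOplax) :
    fibTrans κ κ' (ofTrans τ) = τ :=
  fibTrans_eq_of (fibObj_ofTrans τ) (fibArr_ofTrans τ)

theorem basedFunctor_ext {F G : P ⟶ Q} (h : F.toFunctor = G.toFunctor) : F = G := by
  obtain ⟨F, _⟩ : BasedFunctor P Q := F
  obtain ⟨G, _⟩ : BasedFunctor P Q := G
  obtain rfl : F = G := h
  rfl

/-- An arrow is its lift followed by the chosen Cartesian arrow, and `xi` followed by the Cartesian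
arrow of the codomain is the image under `F` of the one of the domain. Hence the reconstruction
gives `F` of the composite. -/
theorem ofTrans_fibTrans (F : P ⟶ Q) : ofTrans (fibTrans κ κ' F) = F := by
  refine basedFunctor_ext (Functor.hext (fun _ => rfl) fun a b φ => heq_of_eq ?_)
  refine (arr_val (fibTrans κ κ' F) (a := ⟨a, rfl⟩) (b := ⟨b, rfl⟩) ⟨φ, .map φ⟩).trans ?_
  refine (congrArg _ (xi_fac κ κ' F (P.p.map φ) ⟨b, rfl⟩)).trans ?_
  refine (F.map_comp _ _).symm.trans (congrArg F.map ?_)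
  exact (κ.cart (P.p.map φ) ⟨b, rfl⟩).lift_fac (c := ⟨a, rfl⟩) ⟨φ, .map φ⟩

section Modification

variable {F G : P ⟶ Q}

/-- `h` is naturality on vertical arrows, and `h'`, followed by a Cartesian arrow, is naturality on
chosen Cartesian arrows. Every arrow is a composite of one of each kind. -/
theorem fibMod_natural
    {γ : ∀ {S : B} (a : P.p.Fiber S), fibObj F a ⟶ fibObj G a}
    (h : ∀ {S : B} {a b : P.p.Fiber S} (u : a ⟶ b), fibMap F u ≫ γ b = γ a ≫ fibMap G u)
    (h' : ∀ {S T : B} (f : S ⟶ T) (a : P.p.Fiber T),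
      γ (κ.obj f a) ≫ xi κ κ' G f a = xi κ κ' F f a ≫ κ'.map f (γ a)) {S T : B} {f : S ⟶ T}
    {a : P.p.Fiber S} {b : P.p.Fiber T} (φ : ArrOver P.p f a b) :
    F.map φ.1 ≫ (γ b).1 = (γ a).1 ≫ G.map φ.1 := by
  have h₁ := congrArg (fun k => k.1 ≫ (κ'.arr f (fibObj G b)).1) (h' f b)
  have h₂ := congrArg Subtype.val (h ((κ.cart f b).lift φ))
  simp only [Fib.comp_val, Category.assoc, xi_fac, Cleavage.map_fac, xi_fac_assoc,
    fibMap_val] at h₁ h₂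
  rw [← (κ.cart f b).lift_fac φ, F.map_comp, G.map_comp, Category.assoc, ← h₁, ← Category.assoc,
    h₂, Category.assoc]

theorem exists_fibMod (Γ : Oplax.OplaxTrans.Modification (fibTrans κ κ' F) (fibTrans κ κ' G)) :
    ∃ α : F ⟶ G, fibMod κ κ' α = Γ := by
  let γ {S : B} (a : P.p.Fiber S) : fibObj F a ⟶ fibObj G a :=
    (Γ.app (idx S)).toNatTrans.app a
  have h {S : B} {a b : P.p.Fiber S} (u : a ⟶ b) : fibMap F u ≫ γ b = γ a ≫ fibMap G u :=
    (Γ.app (idx S)).toNatTrans.naturality u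
  have h' {S T : B} (f : S ⟶ T) (a : P.p.Fiber T) :
      γ (κ.obj f a) ≫ xi κ κ' G f a = xi κ κ' F f a ≫ κ'.map f (γ a) :=
    congrArg (fun α => α.toNatTrans.app a) (Γ.naturality (ixHom f))
  refine ⟨{
    app := fun a => (γ (⟨a, rfl⟩ : P.p.Fiber (P.p.obj a))).1
    naturality := fun a b φ => fibMod_natural h h' (a := ⟨a, rfl⟩) (b := ⟨b, rfl⟩) ⟨φ, .map φ⟩
    isHomLift' := fun a => (γ (⟨a, rfl⟩ : P.p.Fiber (P.p.obj a))).2 }, ?_⟩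
  refine Oplax.OplaxTrans.Modification.ext (funext fun X => Cleavage.hom₂_ext fun a => ?_)
  obtain ⟨⟨X⟩⟩ := X
  obtain ⟨a, rfl⟩ : P.p.Fiber X := a
  rfl

end Modification

end OfTrans
end FibMon

namespace FibMon

/-! ### Vertical components in the category of elements. -/

section TotalCategory

open Pseudofunctor.CoGrothendieck

variable {B : Type u₁} [Category.{v₁} B] {Φ : Idx B ⥤ᵖ Cat.{v, u}}

/-- The category of elements of a pseudo-functor, over its base. -/
abbrev elements (Φ : Idx B ⥤ᵖ Cat.{v, u}) : Pseudofunctor.CoGrothendieck Φ ⥤ B :=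
  Pseudofunctor.CoGrothendieck.forget Φ

namespace Indexed

variable (Φ : Idx B ⥤ᵖ Cat.{v, u})

/-- The inverse image functor. -/
def pf {R S : B} (f : R ⟶ S) : Φ.obj (idx S) ⥤ Φ.obj (idx R) := (Φ.map (ixHom f)).toFunctor

/-- The comparison of an object with its inverse image along an identity. -/
def ηi (S : B) (x : Φ.obj (idx S)) : x ⟶ (pf Φ (𝟙 S)).obj x :=
  (Φ.mapId (idx S)).inv.toNatTrans.app x

/-- The comparison of the inverse image along an identity with the object. -/
def ηh (S : B) (x : Φ.obj (idx S)) : (pf Φ (𝟙 S)).obj x ⟶ x :=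
  (Φ.mapId (idx S)).hom.toNatTrans.app x

/-- The comparison of the iterated inverse image with the inverse image along a composite. -/
def μi {R S T : B} (f : R ⟶ S) (g : S ⟶ T) (x : Φ.obj (idx T)) :
    (pf Φ f).obj ((pf Φ g).obj x) ⟶ (pf Φ (f ≫ g)).obj x :=
  (Φ.mapComp (ixHom g) (ixHom f)).inv.toNatTrans.app x

/-- The comparison of the inverse image along a composite with the iterated one. -/
def μh {R S T : B} (f : R ⟶ S) (g : S ⟶ T) (x : Φ.obj (idx T)) :
    (pf Φ (f ≫ g)).obj x ⟶ (pf Φ f).obj ((pf Φ g).obj x) :=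
  (Φ.mapComp (ixHom g) (ixHom f)).hom.toNatTrans.app x

/-- The comparison of inverse images along equal arrows. -/
def ec {R S : B} {f g : R ⟶ S} (h : f = g) (x : Φ.obj (idx S)) :
    (pf Φ f).obj x ⟶ (pf Φ g).obj x :=
  (Φ.map₂ (eqToHom (congrArg ixHom h))).toNatTrans.app x

@[simp] theorem ηh_ηi (S : B) (x : Φ.obj (idx S)) : ηh Φ S x ≫ ηi Φ S x = 𝟙 _ :=
  congrArg (fun α => α.toNatTrans.app x) (Φ.mapId (idx S)).hom_inv_id

@[simp] theorem ηi_ηh (S : B) (x : Φ.obj (idx S)) : ηi Φ S x ≫ ηh Φ S x = 𝟙 _ :=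
  congrArg (fun α => α.toNatTrans.app x) (Φ.mapId (idx S)).inv_hom_id

@[simp] theorem μh_μi {R S T : B} (f : R ⟶ S) (g : S ⟶ T) (x : Φ.obj (idx T)) :
    μh Φ f g x ≫ μi Φ f g x = 𝟙 _ :=
  congrArg (fun α => α.toNatTrans.app x) (Φ.mapComp (ixHom g) (ixHom f)).hom_inv_id

@[simp] theorem μi_μh {R S T : B} (f : R ⟶ S) (g : S ⟶ T) (x : Φ.obj (idx T)) :
    μi Φ f g x ≫ μh Φ f g x = 𝟙 _ :=
  congrArg (fun α => α.toNatTrans.app x) (Φ.mapComp (ixHom g) (ixHom f)).inv_hom_id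

theorem ηh_natural {S : B} {x y : Φ.obj (idx S)} (k : x ⟶ y) :
    (pf Φ (𝟙 S)).map k ≫ ηh Φ S y = ηh Φ S x ≫ k :=
  (Φ.mapId (idx S)).hom.toNatTrans.naturality k

@[simp] theorem ec_refl {R S : B} {f : R ⟶ S} (h : f = f) (x : Φ.obj (idx S)) :
    ec Φ h x = 𝟙 _ :=
  congrArg (fun α => α.toNatTrans.app x) (Φ.map₂_id (ixHom f))

/-- The index 2-category is locally discrete, so a 2-cell is no more than an equality of arrows. -/
theorem map₂_app {X Y : Idx B} {k l : X ⟶ Y} (α : k ⟶ l) (x : Φ.obj X) :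
    (Φ.map₂ α).toNatTrans.app x = ec Φ (Cleavage.bs_eq α) x := by
  obtain rfl : k = l := LocallyDiscrete.eq_of_hom α
  rw [Subsingleton.elim α (𝟙 k), Φ.map₂_id, ec_refl]
  rfl

@[simp] theorem ec_trans {R S : B} {f g k : R ⟶ S} (h : f = g) (h' : g = k)
    (x : Φ.obj (idx S)) : ec Φ h x ≫ ec Φ h' x = ec Φ (h.trans h') x := by
  subst h h'
  simp

/-- Coherence of the comparison of inverse images along an identity. -/
theorem id_left {R S : B} (f : R ⟶ S) (y : Φ.obj (idx S)) :
    μi Φ (𝟙 R) f y ≫ ec Φ (Category.id_comp f) y = ηh Φ R ((pf Φ f).obj y) := by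
  have e : (ρ_ (ixHom f)).inv = eqToHom (congrArg ixHom (Category.id_comp f).symm) :=
    Subsingleton.elim _ _
  have h := congrArg (fun α => α.toNatTrans.app y) (Φ.mapComp_id_right_inv (ixHom f))
  rw [e] at h
  have h' : μi Φ (𝟙 R) f y = ηh Φ R ((pf Φ f).obj y) ≫ ec Φ (Category.id_comp f).symm y :=
    h.trans (congrArg _ (Category.id_comp _))
  rw [h', Category.assoc, ec_trans, ec_refl, Category.comp_id]

/-- Coherence of the comparison of inverse images along an identity. -/
theorem id_right {R S : B} (f : R ⟶ S) (y : Φ.obj (idx S)) :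
    μi Φ f (𝟙 S) y ≫ ec Φ (Category.comp_id f) y = (pf Φ f).map (ηh Φ S y) := by
  have e : (λ_ (ixHom f)).inv = eqToHom (congrArg ixHom (Category.comp_id f).symm) :=
    Subsingleton.elim _ _
  have h := congrArg (fun α => α.toNatTrans.app y) (Φ.mapComp_id_left_inv (ixHom f))
  rw [e] at h
  have h' : μi Φ f (𝟙 S) y = (pf Φ f).map (ηh Φ S y) ≫ ec Φ (Category.comp_id f).symm y :=
    h.trans (congrArg _ (Category.id_comp _))
  rw [h', Category.assoc, ec_trans, ec_refl, Category.comp_id]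

end Indexed

open Indexed

namespace Elements

/-- The second component of an object of a fibre. -/
def fib {S : B} (a : (elements Φ).Fiber S) : Φ.obj (idx S) :=
  Eq.rec (motive := fun S _ => Φ.obj (idx S)) a.1.fiber a.2

theorem base_eq {a b : Pseudofunctor.CoGrothendieck Φ} {f : a.base ⟶ b.base} {φ : a ⟶ b}
    (h : (elements Φ).IsHomLift f φ) : φ.base = f :=
  (@IsHomLift.eq_of_isHomLift _ _ _ _ (elements Φ) a b f φ h).symm

/-- The vertical component of an arrow. -/
def vp {R S : B} {f : R ⟶ S} {a : (elements Φ).Fiber R} {b : (elements Φ).Fiber S}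
    (φ : ArrOver (elements Φ) f a b) : fib a ⟶ (pf Φ f).obj (fib b) := by
  obtain ⟨a, rfl⟩ := a
  obtain ⟨b, rfl⟩ := b
  exact φ.1.fiber ≫ eqToHom (by rw [base_eq φ.2]; rfl)

/-- The arrow with a given vertical component. -/
def pv {R S : B} {f : R ⟶ S} {a : (elements Φ).Fiber R} {b : (elements Φ).Fiber S}
    (k : fib a ⟶ (pf Φ f).obj (fib b)) : ArrOver (elements Φ) f a b := by
  obtain ⟨a, rfl⟩ := a
  obtain ⟨b, rfl⟩ := b
  exact ⟨⟨f, k⟩, .map (p := elements Φ) (a := a) (b := b) ⟨f, k⟩⟩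

theorem vp_mk {a b : Pseudofunctor.CoGrothendieck Φ} (φ : a ⟶ b) :
    vp (f := φ.base) (a := ⟨a, rfl⟩) (b := ⟨b, rfl⟩) ⟨φ, .map φ⟩ = φ.fiber :=
  Category.comp_id _

/-- Allows all equalities recorded in fibre objects and lifting conditions to be taken as `rfl`. -/
theorem arrOver_cases
    {motive : ∀ {R S : B} {f : R ⟶ S} {a : (elements Φ).Fiber R} {b : (elements Φ).Fiber S}
      (φ : ArrOver (elements Φ) f a b), Prop}
    (h : ∀ {a b : Pseudofunctor.CoGrothendieck Φ} (φ : a ⟶ b),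
      motive (f := φ.base) (a := ⟨a, rfl⟩) (b := ⟨b, rfl⟩) ⟨φ, .map φ⟩)
    {R S : B} {f : R ⟶ S} {a : (elements Φ).Fiber R} {b : (elements Φ).Fiber S}
    (φ : ArrOver (elements Φ) f a b) : motive φ := by
  obtain ⟨a, rfl⟩ := a
  obtain ⟨b, rfl⟩ := b
  obtain ⟨φ, hφ⟩ := φ
  obtain rfl := IsHomLift.eq_of_isHomLift (elements Φ) f φ
  exact h φ

theorem pv_vp {R S : B} {f : R ⟶ S} {a : (elements Φ).Fiber R} {b : (elements Φ).Fiber S}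
    (φ : ArrOver (elements Φ) f a b) : pv (vp φ) = φ := by
  induction φ using arrOver_cases with
  | h φ => rw [vp_mk]; rfl

theorem vp_pv {R S : B} {f : R ⟶ S} {a : (elements Φ).Fiber R} {b : (elements Φ).Fiber S}
    (k : fib a ⟶ (pf Φ f).obj (fib b)) : vp (pv k) = k := by
  obtain ⟨a, rfl⟩ := a
  obtain ⟨b, rfl⟩ := b
  exact vp_mk (a := a) (b := b) ⟨f, k⟩

theorem vp_injective {R S : B} {f : R ⟶ S} {a : (elements Φ).Fiber R} {b : (elements Φ).Fiber S}
    {φ ψ : ArrOver (elements Φ) f a b} (h : vp φ = vp ψ) : φ = ψ := by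
  rw [← pv_vp φ, h, pv_vp]

theorem vp_comp {R S T : B} {f : R ⟶ S} {g : S ⟶ T} {a : (elements Φ).Fiber R}
    {b : (elements Φ).Fiber S} {c : (elements Φ).Fiber T} (φ : ArrOver (elements Φ) f a b)
    (ψ : ArrOver (elements Φ) g b c) :
    vp (ArrOver.comp φ ψ) = vp φ ≫ (pf Φ f).map (vp ψ) ≫ μi Φ f g (fib c) := by
  obtain ⟨a, rfl⟩ := a
  obtain ⟨b, rfl⟩ := b
  obtain ⟨c, rfl⟩ := c
  obtain ⟨φ, hφ⟩ := φ
  obtain ⟨ψ, hψ⟩ := ψ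
  obtain rfl := IsHomLift.eq_of_isHomLift (elements Φ) f φ
  obtain rfl := IsHomLift.eq_of_isHomLift (elements Φ) g ψ
  refine (vp_mk (φ ≫ ψ)).trans ?_
  have h₁ := vp_mk φ
  have h₂ := vp_mk ψ
  exact (congrArg₂ (fun k l => k ≫ (pf Φ φ.base).map l ≫ μi Φ φ.base ψ.base c.fiber) h₁ h₂).symm

theorem vp_id {S : B} (a : (elements Φ).Fiber S) : vp (ArrOver.id a) = ηi Φ S (fib a) := by
  obtain ⟨a, rfl⟩ := a
  exact vp_mk (𝟙 a)

theorem vp_cast {R S : B} {f g : R ⟶ S} (h : f = g) {a : (elements Φ).Fiber R}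
    {b : (elements Φ).Fiber S} (φ : ArrOver (elements Φ) f a b) :
    vp (ArrOver.cast h φ) = vp φ ≫ ec Φ h (fib b) := by
  subst h
  rw [ec_refl, Category.comp_id]
  rfl

/-- The vertical component of a vertical arrow. -/
def fibM {S : B} {a b : (elements Φ).Fiber S} (u : a ⟶ b) : fib a ⟶ fib b :=
  vp (f := 𝟙 S) u ≫ ηh Φ S (fib b)

/-- The vertical component of a vertical arrow still ends in an inverse image along an identity,
since identities of the category of elements are given by `ηi`; this is the correction. -/
theorem vp_vert {S : B} {a b : (elements Φ).Fiber S} (u : a ⟶ b) :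
    vp (f := 𝟙 S) u = fibM u ≫ ηi Φ S (fib b) := by
  rw [fibM, Category.assoc, ηh_ηi, Category.comp_id]

theorem fibM_id {S : B} (a : (elements Φ).Fiber S) : fibM (𝟙 a) = 𝟙 (fib a) :=
  (congrArg (· ≫ _) (vp_id a)).trans (ηi_ηh Φ S _)

/-- The `ηi` contributed by the vertical factor is cancelled by the unit coherence `id_left` of the
pseudo-functor; `vp_compv` uses `id_right` in the same way. -/
theorem vp_vcomp {R S : B} {f : R ⟶ S} {a a' : (elements Φ).Fiber R} {b : (elements Φ).Fiber S}
    (u : a ⟶ a') (φ : ArrOver (elements Φ) f a' b) :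
    vp (ArrOver.vcomp u φ) = fibM u ≫ vp φ := by
  rw [ArrOver.vcomp, vp_cast, vp_comp, vp_vert]
  simp only [Category.assoc]
  rw [id_left, ηh_natural, ← Category.assoc (ηi Φ R _), ηi_ηh, Category.id_comp]

theorem vp_compv {R S : B} {f : R ⟶ S} {a : (elements Φ).Fiber R} {b b' : (elements Φ).Fiber S}
    (φ : ArrOver (elements Φ) f a b) (u : b ⟶ b') :
    vp (ArrOver.compv φ u) = vp φ ≫ (pf Φ f).map (fibM u) := by
  rw [ArrOver.compv, vp_cast, vp_comp, vp_vert]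
  simp only [Category.assoc]
  rw [id_right, ← Functor.map_comp, Category.assoc, ηi_ηh, Category.comp_id]

theorem fibM_comp {S : B} {a b c : (elements Φ).Fiber S} (u : a ⟶ b) (v : b ⟶ c) :
    fibM (u ≫ v) = fibM u ≫ fibM v := by
  have h : vp (f := 𝟙 S) (u ≫ v) = fibM u ≫ vp (f := 𝟙 S) v := vp_vcomp u (f := 𝟙 S) v
  rw [fibM, h, Category.assoc]
  rfl

end Elements
end TotalCategory
end FibMon

namespace FibMon

/-! ### Every pseudo-functor comes from a fibration. -/

section EssentialSurjectivity

variable {B : Type u₁} [Category.{v₁} B] {Φ : Idx B ⥤ᵖ Cat.{max v₁ v₂, max u₁ u₂}}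

open Indexed

namespace Elements

theorem fibM_injective {S : B} {a b : (elements Φ).Fiber S} {u v : a ⟶ b} (h : fibM u = fibM v) :
    u = v :=
  vp_injective (f := 𝟙 S) (by rw [vp_vert, vp_vert, h])

variable (Φ) in
/-- The functor from a fibre to a value of the pseudo-functor. -/
def fibFunctor (S : B) : (elements Φ).Fiber S ⥤ Φ.obj (idx S) where
  obj a := fib a
  map u := fibM u
  map_id a := fibM_id a
  map_comp u v := fibM_comp u v

/-- The object of a fibre given by an object of a value of the pseudo-functor. -/
def incl {S : B} (x : Φ.obj (idx S)) : (elements Φ).Fiber S := ⟨⟨S, x⟩, rfl⟩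

/-- The vertical arrow given by an arrow of a value of the pseudo-functor. -/
def inclM {S : B} {x y : Φ.obj (idx S)} (k : x ⟶ y) : incl x ⟶ incl y :=
  pv (f := 𝟙 S) (a := incl x) (b := incl y) (k ≫ ηi Φ S y)

theorem vp_inclM {S : B} {x y : Φ.obj (idx S)} (k : x ⟶ y) :
    vp (f := 𝟙 S) (inclM k) = k ≫ ηi Φ S y :=
  vp_pv (a := incl x) (b := incl y) _

theorem fibM_inclM {S : B} {x y : Φ.obj (idx S)} (k : x ⟶ y) : fibM (inclM k) = k := by
  refine (congrArg (· ≫ ηh Φ S y) (vp_inclM k)).trans ((Category.assoc _ _ _).trans ?_)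
  exact (congrArg (k ≫ ·) (ηi_ηh Φ S y)).trans (Category.comp_id k)

variable (Φ) in
/-- The functor from a value of the pseudo-functor to a fibre. -/
def inclFunctor (S : B) : Φ.obj (idx S) ⥤ (elements Φ).Fiber S where
  obj x := incl x
  map k := inclM k
  map_id x := fibM_injective ((fibM_inclM _).trans (fibM_id (incl x)).symm)
  map_comp k l := fibM_injective (by
    rw [fibM_comp, fibM_inclM, fibM_inclM, fibM_inclM]; rfl)

/-- The canonical Cartesian arrow. -/
def car {S T : B} (f : S ⟶ T) (x : Φ.obj (idx T)) :
    ArrOver (elements Φ) f (incl ((pf Φ f).obj x)) (incl x) :=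
  pv (𝟙 ((pf Φ f).obj x))

theorem vp_car {S T : B} (f : S ⟶ T) (x : Φ.obj (idx T)) :
    vp (car f x) = 𝟙 ((pf Φ f).obj x) :=
  vp_pv _

theorem vp_inclM_car {S T : B} (f : S ⟶ T) {x : Φ.obj (idx S)} {y : Φ.obj (idx T)}
    (k : x ⟶ (pf Φ f).obj y) : vp (ArrOver.vcomp (inclM k) (car f y)) = k := by
  rw [vp_vcomp, fibM_inclM, vp_car]
  exact Category.comp_id _

variable (κ : Cleavage (elements Φ))

/-- The equation defining `κ.map`, read on vertical components. The other axioms of `proj` arise in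
the same way from the equations defining `eqv` and `compHom`. -/
theorem fibM_vp_natural {S T : B} (f : S ⟶ T) {a b : (elements Φ).Fiber T} (u : a ⟶ b) :
    fibM (κ.map f u) ≫ vp (κ.arr f b) = vp (κ.arr f a) ≫ (pf Φ f).map (fibM u) := by
  rw [← vp_vcomp, ← vp_compv]
  exact congrArg vp (Subtype.ext (κ.map_fac f u))

theorem fibM_eqv {S T : B} {f g : S ⟶ T} (h : f = g) (a : (elements Φ).Fiber T) :
    fibM (κ.eqv h a) ≫ vp (κ.arr g a) = vp (κ.arr f a) ≫ ec Φ h (fib a) := by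
  rw [← vp_vcomp, ← vp_cast h]
  exact congrArg vp (Subtype.ext (κ.eqv_fac h a))

theorem vp_comp_μh {S T U : B} (f : S ⟶ T) (g : T ⟶ U) (a : (elements Φ).Fiber U) :
    vp (κ.arr (f ≫ g) a) ≫ μh Φ f g (fib a) = fibM (κ.compHom f g a) ≫
      vp (κ.arr f (κ.obj g a)) ≫ (pf Φ f).map (vp (κ.arr g a)) := by
  have h : κ.arr (f ≫ g) a = ArrOver.vcomp (κ.compHom f g a)
      (ArrOver.comp (κ.arr f (κ.obj g a)) (κ.arr g a)) := Subtype.ext (κ.compHom_fac f g a).symm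
  rw [h, vp_vcomp, vp_comp]
  simp only [Category.assoc, μi_μh, Category.comp_id]

/-- The oplax natural transformation from the fibres of the category of elements to the
pseudo-functor. -/
noncomputable def proj : Oplax.OplaxTrans κ.psd.toOplax Φ.toOplax where
  app X := (fibFunctor Φ X.as.unop).toCatHom
  naturality {X Y} k := NatTrans.toCatHom₂
    { app := fun a => vp (κ.arr (Cleavage.bs k) a)
      naturality := fun a b u => fibM_vp_natural κ (Cleavage.bs k) u }
  naturality_naturality α := Cleavage.hom₂_ext fun a =>
    (fibM_eqv κ (Cleavage.bs_eq α) a).trans (congrArg _ (map₂_app Φ α (fib a)).symm)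
  naturality_id X := Cleavage.hom₂_ext fun a =>
    ((congrArg _ (Category.comp_id _)).trans (Category.comp_id (fibM (κ.unitHom a)))).symm
  naturality_comp k l := Cleavage.hom₂_ext fun a => by
    refine (vp_comp_μh κ (Cleavage.bs l) (Cleavage.bs k) a).trans (congrArg _ ?_)
    refine Eq.trans ?_ (Category.id_comp _).symm
    refine congrArg _ (Eq.trans ?_ (Category.id_comp _).symm)
    exact (Category.comp_id _).symm

/-- The comparison of inverse images. -/
noncomputable def inat {S T : B} (f : S ⟶ T) (x : Φ.obj (idx T)) :
    incl ((pf Φ f).obj x) ⟶ κ.obj f (incl x) :=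
  (κ.cart f (incl x)).lift (car f x)

@[simp] theorem inat_fac {S T : B} (f : S ⟶ T) (x : Φ.obj (idx T)) :
    (inat κ f x).1 ≫ (κ.arr f (incl x)).1 = (car f x).1 :=
  (κ.cart f (incl x)).lift_fac _

theorem inat_natural {S T : B} (f : S ⟶ T) {x y : Φ.obj (idx T)} (k : x ⟶ y) :
    inclM ((pf Φ f).map k) ≫ inat κ f y = inat κ f x ≫ κ.map f (inclM k) :=
  (κ.cart f (incl y)).ext (by
    simp only [Fib.comp_val, Category.assoc, inat_fac, Cleavage.map_fac]
    rw [← Category.assoc, inat_fac]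
    refine congrArg Subtype.val (vp_injective (φ := ArrOver.vcomp (inclM ((pf Φ f).map k)) (car f y))
      (ψ := ArrOver.compv (car f x) (inclM k)) ?_)
    rw [vp_vcomp, vp_compv, vp_car, vp_car, fibM_inclM, fibM_inclM]
    exact (Category.comp_id _).trans (Category.id_comp _).symm)

theorem inat_eqv {S T : B} {f g : S ⟶ T} (h : f = g) (x : Φ.obj (idx T)) :
    inclM (ec Φ h x) ≫ inat κ g x = inat κ f x ≫ κ.eqv h (incl x) := by
  subst h
  rw [ec_refl, Cleavage.eqv_refl]
  exact (congrArg (· ≫ _) ((inclFunctor Φ S).map_id _)).trans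
    ((Category.id_comp _).trans (Category.comp_id _).symm)

theorem inat_id {S : B} (x : Φ.obj (idx S)) :
    inat κ (𝟙 S) x ≫ κ.unitHom (incl x) = inclM (ηh Φ S x) := by
  refine Subtype.ext ((inat_fac κ (𝟙 S) x).trans ?_)
  refine congrArg Subtype.val (vp_injective (φ := car (𝟙 S) x) (ψ := inclM (ηh Φ S x)) ?_)
  rw [vp_car, vp_inclM, ηh_ηi]

theorem inat_comp {S T U : B} (f : S ⟶ T) (g : T ⟶ U) (x : Φ.obj (idx U)) :
    inat κ (f ≫ g) x ≫ κ.compHom f g (incl x) =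
      inclM (μh Φ f g x) ≫ inat κ f ((pf Φ g).obj x) ≫ κ.map f (inat κ g x) :=
  κ.ext₂ (by
    simp only [Fib.comp_val, Category.assoc, Cleavage.compHom_fac, Cleavage.map_fac_assoc, inat_fac]
    rw [← Category.assoc (inat κ f _).1, inat_fac]
    refine congrArg Subtype.val (vp_injective (φ := car (f ≫ g) x)
      (ψ := ArrOver.vcomp (inclM (μh Φ f g x)) (ArrOver.comp (car f _) (car g x))) ?_)
    rw [vp_vcomp, vp_comp, vp_car, vp_car, vp_car, fibM_inclM]
    refine ((μh_μi Φ f g x).symm.trans (congrArg (μh Φ f g x ≫ ·) ?_))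
    refine Eq.trans ?_ (Category.id_comp _).symm
    exact (Category.id_comp _).symm.trans (congrArg (· ≫ _) (CategoryTheory.Functor.map_id _ _).symm))

/-- The oplax natural transformation from a pseudo-functor to the fibres of its category of
elements. -/
noncomputable def sect : Oplax.OplaxTrans Φ.toOplax κ.psd.toOplax where
  app X := (inclFunctor Φ X.as.unop).toCatHom
  naturality {X Y} k := NatTrans.toCatHom₂
    { app := fun x => inat κ (Cleavage.bs k) x
      naturality := fun a b u => inat_natural κ (Cleavage.bs k) u }
  naturality_naturality α := Cleavage.hom₂_ext fun x =>
    (congrArg (fun k => inclM k ≫ _) (map₂_app Φ α x)).trans (inat_eqv κ (Cleavage.bs_eq α) x)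
  naturality_id X := Cleavage.hom₂_ext fun x => (inat_id κ x).trans
    ((congrArg _ (Category.comp_id _)).trans (Category.comp_id (inclM (ηh Φ _ x)))).symm
  naturality_comp k l := Cleavage.hom₂_ext fun a => by
    refine (inat_comp κ (Cleavage.bs l) (Cleavage.bs k) a).trans (congrArg _ ?_)
    refine Eq.trans ?_ (Category.id_comp _).symm
    refine congrArg _ (Eq.trans ?_ (Category.id_comp _).symm)
    exact (Category.comp_id _).symm

theorem toCatHom₂_heq {C D : Cat.{v, u}} {F F' G G' : C ⟶ D} (h : F = F') (h' : G = G')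
    {α : F ⟶ G} {β : F' ⟶ G'} (H : ∀ a, α.toNatTrans.app a ≍ β.toNatTrans.app a) : α ≍ β := by
  subst h h'
  exact heq_of_eq (Cleavage.hom₂_ext fun a => eq_of_heq (H a))

/-- Both sides are the vertical component of the canonical Cartesian arrow `car f x`. -/
theorem inat_vp {S T : B} (f : S ⟶ T) (x : Φ.obj (idx T)) :
    fibM (inat κ f x) ≫ vp (κ.arr f (incl x)) = 𝟙 ((pf Φ f).obj x) := by
  refine (vp_vcomp _ _).symm.trans (Eq.trans ?_ (vp_car f x))
  exact congrArg vp (Subtype.ext (inat_fac κ f x))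

/-- The left side is what the composite of the two comparisons does to the arrow `φ`. It has the
same vertical component as `φ`, because lifting and composing with the chosen Cartesian arrow gives
`φ` back. -/
theorem incl_fac {S T : B} {f : S ⟶ T} {x : Φ.obj (idx S)} {y : Φ.obj (idx T)}
    (φ : ArrOver (elements Φ) f (incl x) (incl y)) :
    (inclM (fibM ((κ.cart f (incl y)).lift φ))).1 ≫ (inclM (vp (κ.arr f (incl y)))).1 ≫
      (inat κ f y).1 ≫ (κ.arr f (incl y)).1 = φ.1 := by
  let u := (κ.cart f (incl y)).lift φ
  have hu : ArrOver.vcomp u (κ.arr f (incl y)) = φ :=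
    Subtype.ext ((κ.cart f (incl y)).lift_fac φ)
  have hv : fibM u ≫ vp (κ.arr f (incl y)) = vp φ := (vp_vcomp _ _).symm.trans (congrArg vp hu)
  have H : ArrOver.vcomp (inclM (fibM u)) (ArrOver.vcomp (inclM (vp (κ.arr f (incl y))))
      (car f y)) = φ := by
    refine vp_injective (((vp_vcomp _ _).trans ?_).trans hv)
    have h : vp (ArrOver.vcomp (inclM (vp (κ.arr f (incl y)))) (car f y)) =
        vp (κ.arr f (incl y)) := vp_inclM_car f (vp (κ.arr f (incl y)))
    exact congrArg₂ (· ≫ ·) (fibM_inclM (fibM u)) h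
  exact (congrArg (fun k => (inclM (fibM u)).1 ≫ (inclM (vp (κ.arr f (incl y)))).1 ≫ k)
    (inat_fac κ f y)).trans (congrArg Subtype.val H)

end Elements

open Elements

section

variable (Φ : Idx B ⥤ᵖ Cat.{max v₁ v₂, max u₁ u₂}) (κ : Cleavage (elements Φ))

/-- A pseudo-functor as an object of the 2-category of pseudo-functors. -/
def asPsd (Φ : Idx B ⥤ᵖ Cat.{v, u}) : Psd (Idx B) Cat.{v, u} := Φ

/-- The comparison as a 1-cell. -/
noncomputable def projHom : asPsd κ.psd ⟶ asPsd Φ := InducedBicategory.mkHom (proj κ)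

/-- The inverse comparison as a 1-cell. -/
noncomputable def sectHom : asPsd Φ ⟶ asPsd κ.psd := InducedBicategory.mkHom (sect κ)

/-- `fib (incl x)` is `x` by definition, so the components are identities, and `inat_vp` makes the
structure cells trivial. -/
theorem sectHom_projHom : sectHom Φ κ ≫ projHom Φ κ = 𝟙 (asPsd Φ) := by
  have H (X : Idx B) : (sectHom Φ κ ≫ projHom Φ κ).hom.app X = 𝟙 (Φ.obj X) :=
    Cat.Hom.ext (Functor.hext (fun _ => rfl) fun a b u => heq_of_eq (fibM_inclM u))
  refine psd_hom_ext H fun {X Y} k => toCatHom₂_heq ?_ ?_ fun a => heq_of_eq ?_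
  · exact congrArg (Φ.map k ≫ ·) (H Y)
  · exact congrArg (· ≫ Φ.map k) (H X)
  · refine Eq.trans ?_ (Category.id_comp _).symm
    refine (Category.id_comp _).trans (Eq.trans ?_ (inat_vp κ (Cleavage.bs k) a))
    exact congrArg _ ((Category.id_comp _).trans (Category.comp_id _))

/-- Objects of fibres are equal to their images under the composite only after their fibre condition
is eliminated. The functor over the base induced by the composite avoids this, as it is the identity
on objects by definition, and on arrows by `incl_fac`. -/
theorem ofTrans_projHom_sectHom :
    ofTrans (P := .ofFunctor (elements Φ)) (Q := .ofFunctor (elements Φ)) (κ := κ) (κ' := κ)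
      (projHom Φ κ ≫ sectHom Φ κ).hom = 𝟙 (BasedCategory.ofFunctor (elements Φ)) := by
  refine basedFunctor_ext (Functor.hext (fun _ => rfl) fun a b φ => heq_of_eq ?_)
  have H {S T : B} (f : S ⟶ T) (y : (elements Φ).Fiber T) :
      OfTrans.nat (P := .ofFunctor (elements Φ)) (Q := .ofFunctor (elements Φ)) (κ := κ)
        (κ' := κ) (projHom Φ κ ≫ sectHom Φ κ).hom f y =
      inclM (vp (κ.arr f y)) ≫ inat κ f (fib y) :=
    (Category.id_comp _).trans (congrArg (inclM (vp (κ.arr f y)) ≫ ·)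
      ((Category.id_comp _).trans (Category.comp_id _)))
  refine (OfTrans.arr_val (P := .ofFunctor (elements Φ)) (Q := .ofFunctor (elements Φ)) (κ := κ)
    (κ' := κ) (projHom Φ κ ≫ sectHom Φ κ).hom (a := ⟨a, rfl⟩) (b := ⟨b, rfl⟩) ⟨φ, .map φ⟩).trans ?_
  refine (congrArg (fun k => (inclM (fibM ((κ.cart ((elements Φ).map φ)
    ⟨b, rfl⟩).lift (c := ⟨a, rfl⟩) ⟨φ, .map φ⟩))).1 ≫ k.1 ≫ (κ.arr ((elements Φ).map φ) ⟨b, rfl⟩).1)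
      (H ((elements Φ).map φ) ⟨b, rfl⟩)).trans ?_
  exact (congrArg _ (Category.assoc _ _ _)).trans (incl_fac κ (f := (elements Φ).map φ)
    (x := a.fiber) (y := b.fiber) ⟨φ, .map φ⟩)

/-- `fibTrans_ofTrans` recovers the composite from the functor it induces, which is the identity. -/
theorem projHom_sectHom : projHom Φ κ ≫ sectHom Φ κ = 𝟙 (asPsd κ.psd) := by
  have h := fibTrans_ofTrans (P := .ofFunctor (elements Φ)) (Q := .ofFunctor (elements Φ))
    (κ := κ) (κ' := κ) (projHom Φ κ ≫ sectHom Φ κ).hom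
  rw [ofTrans_projHom_sectHom] at h
  refine (congrArg InducedBicategory.mkHom h.symm).trans ?_
  exact psd_hom_ext (fun _ => rfl) fun k => heq_of_eq (Cleavage.hom₂_ext fun a =>
    xi_idFun (P := .ofFunctor (elements Φ)) κ (Cleavage.bs k) a)

end

section

variable (κ : ∀ P : Fibr.{v, u} B, Cleavage P.base.p)

theorem fibIndexed_map_injective {P Q : Fibr.{v, u} B} {F G : P ⟶ Q}
    (h : (fibIndexed κ).map F = (fibIndexed κ).map G) : F = G := by
  have h' : fibTrans (κ P) (κ Q) F.base = fibTrans (κ P) (κ Q) G.base :=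
    congrArg InducedBicategory.Hom.hom h
  refine Layer.Total.hom_ext ?_ HEq.rfl
  rw [← ofTrans_fibTrans (κ := κ P) (κ' := κ Q) F.base, h', ofTrans_fibTrans]

theorem fibIndexed_map₂_injective {P Q : Fibr.{v, u} B} {F G : P ⟶ Q} {α β : F ⟶ G}
    (h : (fibIndexed κ).map₂ α = (fibIndexed κ).map₂ β) : α = β := by
  refine Layer.Total.hom₂_ext (BasedNatTrans.ext _ _ (NatTrans.ext (funext fun a => ?_)))
  exact congrArg (fun Γ => ((Γ.hom.as.app (idx (P.base.p.obj a))).toNatTrans.app ⟨a, rfl⟩).1) h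

end

/-- The category of elements contains the objects and arrows of the base, which is why the universes
of the fibrations are taken to be at least those of `B`. -/
theorem fibIndexed_isLocalIso (κ : ∀ P : Fibr.{max v₁ v₂, max u₁ u₂} B, Cleavage P.base.p) :
    IsLocalIso (fibIndexed κ) where
  map_injective h := fibIndexed_map_injective κ h
  map_surjective {P Q} τ := ⟨Layer.Total.Hom.mk (ofTrans (κ := κ P) (κ' := κ Q) τ.hom) ⟨⟩,
    congrArg InducedBicategory.mkHom (fibTrans_ofTrans τ.hom)⟩
  map₂_injective h := fibIndexed_map₂_injective κ h
  map₂_surjective {P Q F G} Γ := by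
    obtain ⟨α, h⟩ := exists_fibMod Γ.hom.as
    exact ⟨Layer.Total.Hom₂.mk α trivial, psd_hom₂_ext fun a => congrArg (fun Γ => Γ.app a) h⟩
  exists_iso Ψ := by
    let Φ : Idx B ⥤ᵖ Cat.{max v₁ v₂, max u₁ u₂} := Ψ
    let P : Fibr.{max v₁ v₂, max u₁ u₂} B :=
      ⟨BasedCategory.ofFunctor (elements Φ), ⟨inferInstanceAs (elements Φ).IsFibered⟩⟩
    exact ⟨P, projHom Φ (κ P), sectHom Φ (κ P), projHom_sectHom Φ (κ P), sectHom_projHom Φ (κ P)⟩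

end EssentialSurjectivity
end FibMon

namespace FibMon

/-! ### Transport of monoidal, strong and symmetric structures. -/

section LayerProperties

open MonoidalCategory

theorem laxMonoidal_ext {C D : Type*} [Category* C] [Category* D] [MonoidalCategory C]
    [MonoidalCategory D] {F : C ⥤ D} {h k : F.LaxMonoidal} (hε : h.ε = k.ε)
    (hμ : ∀ a b, h.μ a b = k.μ a b) : h = k :=
  Functor.LaxMonoidal.ext hε (funext fun a => funext fun b => hμ a b)

/-- For an identity transformation the two axioms of a monoidal transformation say that the
structure morphisms coincide. -/
theorem monLayer_rigid : (monLayer.{v, u}).Rigid := by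
  intro C D x y F G e h k H
  subst e
  letI : MonoidalCategory C := x
  letI : MonoidalCategory D := y
  have h₁ := H.unit
  have h₂ := H.tensor
  refine heq_of_eq (laxMonoidal_ext ((Category.comp_id _).symm.trans h₁) fun a b => ?_)
  refine (Category.comp_id _).symm.trans ((h₂ a b).trans ?_)
  exact (congrArg (· ≫ _) (id_tensorHom_id _ _)).trans (Category.id_comp _)

/-- Transport of a lax monoidal structure along a natural isomorphism. -/
@[reducible] def laxOfIso {C D : Type*} [Category* C] [Category* D] [MonoidalCategory C]
    [MonoidalCategory D] {F G : C ⥤ D} [F.LaxMonoidal] (e : F ≅ G) : G.LaxMonoidal :=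
  Functor.LaxMonoidal.ofTensorHom (F := G)
    (Functor.LaxMonoidal.ε F ≫ e.hom.app _)
    (fun a b => (e.inv.app a ⊗ₘ e.inv.app b) ≫ Functor.LaxMonoidal.μ F a b ≫ e.hom.app _)
    (by
      intro X Y X' Y' f g
      rw [tensorHom_comp_tensorHom_assoc, e.inv.naturality, e.inv.naturality,
        ← tensorHom_comp_tensorHom_assoc, Functor.LaxMonoidal.μ_natural_assoc]
      simp)
    (by
      intro X Y Z
      have h := Functor.LaxMonoidal.associativity F X Y Z
      rw [← tensorHom_id, ← id_tensorHom] at h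
      -- Consecutive occurrences of `e.hom` and `e.inv` cancel inside the tensor product; this
      -- reduces associativity for `G` to that for `F`.
      have h₁ : (((e.inv.app X ⊗ₘ e.inv.app Y) ≫ Functor.LaxMonoidal.μ F X Y ≫ e.hom.app _) ⊗ₘ
          𝟙 (G.obj Z)) ≫ (e.inv.app (X ⊗ Y) ⊗ₘ e.inv.app Z) =
          ((e.inv.app X ⊗ₘ e.inv.app Y) ⊗ₘ e.inv.app Z) ≫
            (Functor.LaxMonoidal.μ F X Y ⊗ₘ 𝟙 (F.obj Z)) := by
        simp only [tensorHom_comp_tensorHom, Category.assoc, e.hom_inv_id_app, Category.comp_id,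
          Category.id_comp]
      have h₂ : (𝟙 (G.obj X) ⊗ₘ ((e.inv.app Y ⊗ₘ e.inv.app Z) ≫ Functor.LaxMonoidal.μ F Y Z ≫
          e.hom.app _)) ≫ (e.inv.app X ⊗ₘ e.inv.app (Y ⊗ Z)) =
          (e.inv.app X ⊗ₘ (e.inv.app Y ⊗ₘ e.inv.app Z)) ≫
            (𝟙 (F.obj X) ⊗ₘ Functor.LaxMonoidal.μ F Y Z) := by
        simp only [tensorHom_comp_tensorHom, Category.assoc, e.hom_inv_id_app, Category.comp_id,
          Category.id_comp]
      simp only [Category.assoc]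
      rw [reassoc_of% h₁, reassoc_of% h₂, ← e.hom.naturality, reassoc_of% h,
        MonoidalCategory.associator_naturality_assoc])
    (by
      intro X
      have h₁ : ((Functor.LaxMonoidal.ε F ≫ e.hom.app _) ⊗ₘ 𝟙 (G.obj X)) ≫
          (e.inv.app (𝟙_ C) ⊗ₘ e.inv.app X) =
          (𝟙 _ ⊗ₘ e.inv.app X) ≫ (Functor.LaxMonoidal.ε F ⊗ₘ 𝟙 (F.obj X)) := by
        simp only [tensorHom_comp_tensorHom, Category.assoc, e.hom_inv_id_app, Category.comp_id,
          Category.id_comp]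
      have h := Functor.LaxMonoidal.left_unitality F X
      rw [← tensorHom_id] at h
      simp only [Category.assoc]
      rw [reassoc_of% h₁, ← e.hom.naturality, ← reassoc_of% h, id_tensorHom,
        MonoidalCategory.leftUnitor_naturality_assoc, e.inv_hom_id_app, Category.comp_id])
    (by
      intro X
      have h₁ : (𝟙 (G.obj X) ⊗ₘ (Functor.LaxMonoidal.ε F ≫ e.hom.app _)) ≫
          (e.inv.app X ⊗ₘ e.inv.app (𝟙_ C)) =
          (e.inv.app X ⊗ₘ 𝟙 _) ≫ (𝟙 (F.obj X) ⊗ₘ Functor.LaxMonoidal.ε F) := by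
        simp only [tensorHom_comp_tensorHom, Category.assoc, e.hom_inv_id_app, Category.comp_id,
          Category.id_comp]
      have h := Functor.LaxMonoidal.right_unitality F X
      rw [← id_tensorHom] at h
      simp only [Category.assoc]
      rw [reassoc_of% h₁, ← e.hom.naturality, ← reassoc_of% h, tensorHom_id,
        MonoidalCategory.rightUnitor_naturality_assoc, e.inv_hom_id_app, Category.comp_id])

theorem monLayer_homLift : (monLayer.{v, u}).HomLift := by
  intro C D x y F G h e
  letI : MonoidalCategory C := x
  letI : MonoidalCategory D := y
  letI : F.toFunctor.LaxMonoidal := h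
  let e' : F.toFunctor ≅ G.toFunctor := Cat.Hom.toNatIso e
  refine ⟨laxOfIso e', monLayer_two_mk rfl fun a b => ?_⟩
  change _ = (e'.hom.app a ⊗ₘ e'.hom.app b) ≫ (e'.inv.app a ⊗ₘ e'.inv.app b) ≫
    Functor.LaxMonoidal.μ F.toFunctor a b ≫ e'.hom.app _
  rw [tensorHom_comp_tensorHom_assoc, e'.hom_inv_id_app, e'.hom_inv_id_app, id_tensorHom_id,
    Category.id_comp]
  rfl

/-- The equivalence of categories given by functors inverse to each other. -/
def equivOfInverse {C D : Cat.{v, u}} (f : C ⟶ D) (g : D ⟶ C) (e : f ≫ g = 𝟙 C)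
    (e' : g ≫ f = 𝟙 D) : CategoryTheory.Equivalence C D where
  functor := f.toFunctor
  inverse := g.toFunctor
  unitIso := eqToIso (congrArg Cat.Hom.toFunctor e.symm)
  counitIso := eqToIso (congrArg Cat.Hom.toFunctor e')
  functor_unitIso_comp X := by
    rw [eqToIso.hom, eqToIso.hom, eqToHom_app, eqToHom_app, eqToHom_map, eqToHom_trans]
    rfl

theorem cat_eqToHom_toNatTrans {C D : Cat.{v, u}} {F G : C ⟶ D} (e : F = G) :
    (eqToHom e : F ⟶ G).toNatTrans = eqToHom (congrArg Cat.Hom.toFunctor e) := by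
  subst e; rfl

/-- Transport of a monoidal structure along an equivalence. -/
theorem exists_transport {C D : Type u} [Category.{v} C] [Category.{v} D] [MonoidalCategory D]
    (E : CategoryTheory.Equivalence D C) :
    ∃ (x : MonoidalCategory C) (h : E.inverse.LaxMonoidal) (k : E.functor.LaxMonoidal),
      NatTrans.IsMonoidal E.counit ∧ NatTrans.IsMonoidal E.unit :=
  ⟨(inferInstance : MonoidalCategory (Monoidal.Transported E)),
    (inferInstance : (Monoidal.equivalenceTransported E).inverse.LaxMonoidal),
    (inferInstance : (Monoidal.equivalenceTransported E).functor.LaxMonoidal),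
    (inferInstance : NatTrans.IsMonoidal (Monoidal.equivalenceTransported E).counit),
    (inferInstance : NatTrans.IsMonoidal (Monoidal.equivalenceTransported E).unit)⟩

theorem monLayer_two_eqToHom {C D : Cat.{v, u}} {x : MonoidalCategory C} {y : MonoidalCategory D}
    {F G : C ⟶ D} {hF : F.toFunctor.LaxMonoidal} {hG : G.toFunctor.LaxMonoidal} (e : F = G)
    (h : NatTrans.IsMonoidal (eqToHom (congrArg Cat.Hom.toFunctor e))) :
    monLayer.Two (x := x) (y := y) (f := F) (g := G) hF hG (eqToHom e) := by
  rw [← cat_eqToHom_toNatTrans] at h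
  exact h

/-- An isomorphism of categories is an equivalence, along which `y` is transported. Monoidality of
the counit gives the first condition; the unit runs in the direction opposite to the second, and
rigidity reverses it. -/
theorem monLayer_isoFib : (monLayer.{v, u}).IsoFib := by
  intro C D f g e e' y
  letI : MonoidalCategory D := y
  obtain ⟨x, h, k, h₁, h₂⟩ := exists_transport (equivOfInverse g f e' e)
  exact ⟨x, h, k, monLayer_two_eqToHom e h₁, Layer.two_eqToHom_symm monLayer_rigid e'.symm
    (monLayer_two_eqToHom e'.symm h₂)⟩

section Strong

namespace Layer

variable {C : Type u} [Bicategory.{w, v} C] {L : Layer.{w, v, u, s, t} C}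
  {L' : Layer.{w, v, u, s', t'} C}

theorem Rigid.prod (h : L.Rigid) (h' : L'.Rigid) : (L.prod L').Rigid := by
  intro a b x y f g e k l H
  have h₁ := h e H.1
  have h₂ := h' e H.2
  subst e
  exact heq_of_eq (Prod.ext (eq_of_heq h₁) (eq_of_heq h₂))

theorem HomLift.prod (h : L.HomLift) (h' : L'.HomLift) : (L.prod L').HomLift := by
  intro a b x y f g k e
  obtain ⟨l, hl⟩ := h k.1 e
  obtain ⟨l', hl'⟩ := h' k.2 e
  exact ⟨(l, l'), hl, hl'⟩

theorem IsoFib.prod (h : L.IsoFib) (h' : L'.IsoFib) : (L.prod L').IsoFib := by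
  intro a b f g e e' y
  obtain ⟨x, k, l, h₁, h₂⟩ := h f g e e' y.1
  obtain ⟨x', k', l', h₁', h₂'⟩ := h' f g e e' y.2
  exact ⟨(x, x'), (k, k'), (l, l'), ⟨h₁, h₁'⟩, h₂, h₂'⟩

end Layer

theorem strongLayer_rigid : (strongLayer.{v, u}).Rigid := Layer.propLayer_rigid _ _

theorem symLayer_rigid : (symLayer.{v, u}).Rigid := fun _ _ _ _ => Layer.plift_heq _ _

theorem strongLayer_invClosed : (strongLayer.{v, u}).InvClosed := fun _ _ => trivial

theorem symLayer_invClosed : (symLayer.{v, u}).InvClosed := fun _ _ => trivial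

/-- The natural isomorphism underlying an invertible monoidal natural transformation. -/
def monCatIso {V W : MonCat.{v, u}} {F G : V ⟶ W} (e : F ≅ G) :
    F.base.toFunctor ≅ G.base.toFunctor :=
  Cat.Hom.toNatIso (Layer.Total.isoBase e)

theorem monCat_unit {V W : MonCat.{v, u}} {F G : V ⟶ W} (α : F ⟶ G) :
    Functor.LaxMonoidal.ε F.base.toFunctor ≫ (Layer.Total.Hom₂.base α).toNatTrans.app (𝟙_ V.base) =
      Functor.LaxMonoidal.ε G.base.toFunctor :=
  NatTrans.IsMonoidal.unit (self := Layer.Total.Hom₂.prop α)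

theorem monCat_tensor {V W : MonCat.{v, u}} {F G : V ⟶ W} (α : F ⟶ G) (X Y : V.base) :
    Functor.LaxMonoidal.μ F.base.toFunctor X Y ≫
        (Layer.Total.Hom₂.base α).toNatTrans.app (X ⊗ Y) =
      ((Layer.Total.Hom₂.base α).toNatTrans.app X ⊗ₘ
        (Layer.Total.Hom₂.base α).toNatTrans.app Y) ≫ Functor.LaxMonoidal.μ G.base.toFunctor X Y :=
  NatTrans.IsMonoidal.tensor (self := Layer.Total.Hom₂.prop α) X Y

/-- Solves the tensor axiom for the structure morphism of `G`, so that properties of the structure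
morphisms of `F` carry over by conjugation. -/
theorem monCat_tensor_iso {V W : MonCat.{v, u}} {F G : V ⟶ W} (e : F ≅ G) (X Y : V.base) :
    Functor.LaxMonoidal.μ G.base.toFunctor X Y = ((monCatIso e).inv.app X ⊗ₘ
      (monCatIso e).inv.app Y) ≫ Functor.LaxMonoidal.μ F.base.toFunctor X Y ≫
        (monCatIso e).hom.app (X ⊗ Y) := by
  have h : Functor.LaxMonoidal.μ F.base.toFunctor X Y ≫ (monCatIso e).hom.app (X ⊗ Y) =
    ((monCatIso e).hom.app X ⊗ₘ (monCatIso e).hom.app Y) ≫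
      Functor.LaxMonoidal.μ G.base.toFunctor X Y := monCat_tensor e.hom X Y
  rw [h, tensorHom_comp_tensorHom_assoc, Iso.inv_hom_id_app, Iso.inv_hom_id_app, id_tensorHom_id,
    Category.id_comp]

theorem IsStrongFunctor.of_iso {V W : MonCat.{v, u}} {F G : V ⟶ W} (h : IsStrongFunctor F)
    (e : F ≅ G) : IsStrongFunctor G := by
  refine ⟨?_, fun X Y => ?_⟩
  · have := h.1
    have H : Functor.LaxMonoidal.ε F.base.toFunctor ≫ (monCatIso e).hom.app (𝟙_ V.base) =
      Functor.LaxMonoidal.ε G.base.toFunctor := monCat_unit e.hom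
    rw [← H]
    infer_instance
  · have := h.2 X Y
    rw [monCat_tensor_iso e]
    infer_instance

theorem IsSymmetricFunctor.of_iso {V W : MonCat.{v, u}} {x : SymmetricCategory V.base}
    {y : SymmetricCategory W.base} {F G : V ⟶ W} (h : IsSymmetricFunctor x y F) (e : F ≅ G) :
    IsSymmetricFunctor x y G := by
  intro X Y
  have h₁ := h X Y
  rw [monCat_tensor_iso e, monCat_tensor_iso e, Category.assoc, Category.assoc,
    ← (monCatIso e).hom.naturality, reassoc_of% h₁, BraidedCategory.braiding_naturality_assoc]

theorem strongLayer_homLift : (strongLayer.{v, u}).HomLift :=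
  fun h e => ⟨⟨IsStrongFunctor.of_iso h.down e⟩, trivial⟩

theorem symLayer_homLift : (symLayer.{v, u}).HomLift :=
  fun h e => ⟨⟨IsSymmetricFunctor.of_iso h.down e⟩, trivial⟩

theorem exists_symmetricCategory_of_fullyFaithful {C D : Type*} [Category* C] [Category* D]
    [MonoidalCategory C] [MonoidalCategory D] (F : C ⥤ D) [F.LaxMonoidal]
    [IsIso (Functor.LaxMonoidal.ε F)] [∀ X Y, IsIso (Functor.LaxMonoidal.μ F X Y)] [F.Full]
    [F.Faithful] [SymmetricCategory D] : ∃ x : SymmetricCategory C,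
      ∀ X Y, Functor.LaxMonoidal.μ F X Y ≫ F.map (β_ X Y).hom =
        (β_ (F.obj X) (F.obj Y)).hom ≫ Functor.LaxMonoidal.μ F Y X := by
  letI : F.Monoidal := Functor.Monoidal.ofLaxMonoidal _
  refine ⟨SymmetricCategory.ofFullyFaithful F, fun X Y => ?_⟩
  -- The pulled back braiding is the preimage of the braiding of `D` conjugated by the structure
  -- isomorphisms of `F`.
  change _ ≫ F.map (F.preimage _) = _
  rw [F.map_preimage]
  exact Functor.Monoidal.μ_δ_assoc F X Y _

/-- `G.map a` is split epi by the first hypothesis, and split mono because `a` is by the second; `G`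
reflects its invertibility. -/
theorem isIso_of_isIso_comp_map {C D : Type*} [Category* C] [Category* D] (G : D ⥤ C)
    [G.ReflectsIsomorphisms] {X Y Z : D} {W : C} {c : W ⟶ G.obj X} {a : X ⟶ Y} {b : Y ⟶ Z}
    (h : IsIso (c ≫ G.map a)) (h' : IsIso (a ≫ b)) : IsIso a := by
  have h₁ : IsSplitEpi (G.map a) := ⟨⟨⟨inv (c ≫ G.map a) ≫ c, by
    rw [Category.assoc, IsIso.inv_hom_id]⟩⟩⟩
  have h₂ : IsSplitMono a := ⟨⟨⟨b ≫ inv (a ≫ b), by rw [← Category.assoc, IsIso.hom_inv_id]⟩⟩⟩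
  have : IsIso (G.map a) := isIso_of_mono_of_isSplitEpi _
  exact isIso_of_reflects_iso a G

section Inverse

variable {V W : MonCat.{v, u}} {F : V ⟶ W} {G : W ⟶ V} (e : F ≫ G = 𝟙 V) (e' : G ≫ F = 𝟙 W)

theorem isStrongFunctor_of_eq_id {K : V ⟶ V} (e : K = 𝟙 V) : IsStrongFunctor K :=
  e ▸ (strongLayer.idHom (a := V) ⟨trivial⟩).down

theorem isSymmetricFunctor_of_eq_id {K : V ⟶ V} (e : K = 𝟙 V) (x : SymmetricCategory V.base) :
    IsSymmetricFunctor x x K :=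
  e ▸ IsSymmetricFunctor.id x

include e e'

theorem isEquivalence_of_inverse : F.base.toFunctor.IsEquivalence :=
  (equivOfInverse F.base G.base (congrArg Layer.Total.Hom.base e)
    (congrArg Layer.Total.Hom.base e')).isEquivalence_functor

/-- Both composites equal identities and so are strong. The structure morphisms of `F ≫ G` end with
`G` applied to those of `F`, and those of `G ≫ F` begin with those of `F`, so
`isIso_of_isIso_comp_map` applies. -/
theorem isStrongFunctor_of_inverse : IsStrongFunctor F := by
  have := isEquivalence_of_inverse e' e
  have h := isStrongFunctor_of_eq_id e
  have h' := isStrongFunctor_of_eq_id e'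
  refine ⟨isIso_of_isIso_comp_map G.base.toFunctor h.1 h'.1, fun X Y => ?_⟩
  -- In `G ≫ F` the structure morphisms of `F` occur only at objects in the image of `G`, which is
  -- everything.
  have H (X : V.base) : ∃ Z : W.base, G.base.toFunctor.obj Z = X :=
    ⟨F.base.toFunctor.obj X, CategoryTheory.Functor.congr_obj
      (congrArg (fun K : V ⟶ V => (Layer.Total.Hom.base K).toFunctor) e) X⟩
  obtain ⟨X, rfl⟩ := H X
  obtain ⟨Y, rfl⟩ := H Y
  exact isIso_of_isIso_comp_map G.base.toFunctor (h.2 _ _) (h'.2 X Y)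

theorem exists_symmetric_of_inverse (y : SymmetricCategory W.base) :
    ∃ x : SymmetricCategory V.base, IsSymmetricFunctor x y F ∧ IsSymmetricFunctor y x G := by
  have := isEquivalence_of_inverse e e'
  obtain ⟨h₁, h₂⟩ := isStrongFunctor_of_inverse e e'
  obtain ⟨x, hF⟩ := exists_symmetricCategory_of_fullyFaithful F.base.toFunctor
  -- Compatibility of `G` is tested under the faithful `F`. There it follows from compatibility of
  -- `F` and of the identity `G ≫ F`, once the invertible structure morphism of `F` is cancelled.
  refine ⟨x, hF, fun X Y => F.base.toFunctor.map_injective ?_⟩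
  have h₃ := hF (G.base.toFunctor.obj X) (G.base.toFunctor.obj Y)
  have h₄ : (Functor.LaxMonoidal.μ F.base.toFunctor _ _ ≫
      F.base.toFunctor.map (Functor.LaxMonoidal.μ G.base.toFunctor X Y)) ≫
      F.base.toFunctor.map (G.base.toFunctor.map (β_ X Y).hom) =
    (β_ (F.base.toFunctor.obj (G.base.toFunctor.obj X))
      (F.base.toFunctor.obj (G.base.toFunctor.obj Y))).hom ≫
        Functor.LaxMonoidal.μ F.base.toFunctor _ _ ≫
          F.base.toFunctor.map (Functor.LaxMonoidal.μ G.base.toFunctor Y X) :=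
    isSymmetricFunctor_of_eq_id e' y X Y
  rw [← cancel_epi (Functor.LaxMonoidal.μ F.base.toFunctor _ _), Functor.map_comp,
    Functor.map_comp, reassoc_of% h₃, ← h₄, Category.assoc]

end Inverse

theorem strongLayer_isoFib : (strongLayer.{v, u}).IsoFib := fun f g e e' y =>
  ⟨⟨trivial⟩, ⟨isStrongFunctor_of_inverse e e'⟩, ⟨isStrongFunctor_of_inverse e' e⟩, trivial,
    trivial⟩

theorem symLayer_isoFib : (symLayer.{v, u}).IsoFib := fun f g e e' y => by
  obtain ⟨x, h, h'⟩ := exists_symmetric_of_inverse e e' y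
  exact ⟨x, ⟨h⟩, ⟨h'⟩, trivial, trivial⟩

/-- With `psd_strict`, these instances provide the strictness of the codomains. -/
instance : Strict MonCat.{v, u} := monLayer_rigid.strict

instance : Strict strongLayer.{v, u}.Total := strongLayer_rigid.strict

instance : Strict symLayer.{v, u}.Total := symLayer_rigid.strict

instance : Strict (strongLayer.{v, u}.prod symLayer.{v, u}).Total :=
  Layer.Rigid.strict (Layer.Rigid.prod strongLayer_rigid symLayer_rigid)

end Strong

end LayerProperties
end FibMon

namespace FibMon

/-! ### Fibred monoidal structures from structures on fibres and inverse images. -/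

section MonoidalIndexed

open MonoidalCategory

variable {B : Type u₁} [Category.{v₁} B]

theorem ArrOver.IsCart.vcomp_lift {E : Type u} [Category.{v} E] {p : E ⥤ B} {R S : B} {f : R ⟶ S}
    {a c : p.Fiber R} {b : p.Fiber S} {φ : ArrOver p f a b} (hφ : φ.IsCart) (ψ : ArrOver p f c b) :
    ArrOver.vcomp (hφ.lift ψ) φ = ψ :=
  Subtype.ext (hφ.lift_fac ψ)

namespace FibLax

variable {P Q : BasedCategory.{v, u} B} [∀ S : B, MonoidalCategory (P.p.Fiber S)]
  [∀ S : B, MonoidalCategory (Q.p.Fiber S)] {x : FibTensor P.p} {y : FibTensor Q.p}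

theorem ext_lax {F : P ⟶ Q} {h k : FibLax x y F} (H : ∀ S, h.lax S = k.lax S) : h = k := by
  obtain ⟨h, _, _⟩ := h
  obtain ⟨k, _, _⟩ := k
  obtain rfl : h = k := funext H
  rfl

variable (κ : Cleavage P.p) (κ' : Cleavage Q.p)

/-- Composition with the chosen Cartesian arrow turns the fibrewise compatibility with inverse
images into naturality along the unit section. -/
theorem unit_natural_of_xi {F : P ⟶ Q} {S T : B} (f : S ⟶ T)
    (e : ∀ S : B, 𝟙_ (Q.p.Fiber S) ⟶ fibObj F (𝟙_ (P.p.Fiber S)))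
    (h : (e S ≫ fibMap F (x.pullε κ f)) ≫ xi κ κ' F f (𝟙_ _) = y.pullε κ' f ≫ κ'.map f (e T)) :
    (y.unit f).1 ≫ (e T).1 = (e S).1 ≫ F.map (x.unit f).1 := by
  have h := congrArg (fun u => u.1 ≫ (κ'.arr f (fibObj F (𝟙_ (P.p.Fiber T)))).1) h
  simp [← Functor.map_comp] at h
  exact h.symm

/-- Each arrow is split into its lift and a chosen Cartesian arrow: `hm` treats the vertical
factors, and `h`, composed with the Cartesian arrow over the tensor product, treats the others. -/
theorem tensor_natural_of_xi {F : P ⟶ Q} {S T : B} (f : S ⟶ T)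
    (m : ∀ {S : B} (a b : P.p.Fiber S), fibObj F a ⊗ fibObj F b ⟶ fibObj F (a ⊗ b))
    (hm : ∀ {a b a' b' : P.p.Fiber S} (u : a ⟶ b) (u' : a' ⟶ b'),
      (fibMap F u ⊗ₘ fibMap F u') ≫ m b b' = m a a' ≫ fibMap F (u ⊗ₘ u'))
    (h : ∀ a b : P.p.Fiber T,
      (m (κ.obj f a) (κ.obj f b) ≫ fibMap F (x.pullμ κ f a b)) ≫ xi κ κ' F f (a ⊗ b) =
      (xi κ κ' F f a ⊗ₘ xi κ κ' F f b) ≫ y.pullμ κ' f (fibObj F a) (fibObj F b) ≫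
        κ'.map f (m a b)) {a a' : P.p.Fiber S} {b b' : P.p.Fiber T} (φ : ArrOver P.p f a b)
    (φ' : ArrOver P.p f a' b') :
    (y.tensor (fibArr F φ) (fibArr F φ')).1 ≫ (m b b').1 =
      (m a a').1 ≫ F.map (x.tensor φ φ').1 := by
  have h := congrArg (fun u => u.1 ≫ (κ'.arr f (fibObj F (b ⊗ b'))).1) (h b b')
  simp [← Functor.map_comp] at h
  have hu := congrArg Subtype.val (hm ((κ.cart f b).lift φ) ((κ.cart f b').lift φ'))
  have h₁ := x.tensor_vcomp ((κ.cart f b).lift φ) ((κ.cart f b').lift φ') (κ.arr f b) (κ.arr f b')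
  rw [(κ.cart f b).vcomp_lift, (κ.cart f b').vcomp_lift] at h₁
  have h₂ := y.tensor_vcomp (xi κ κ' F f b) (xi κ κ' F f b') (κ'.arr f _) (κ'.arr f _)
  have h₃ := y.tensor_vcomp (fibMap F ((κ.cart f b).lift φ)) (fibMap F ((κ.cart f b').lift φ'))
    (fibArr F (κ.arr f b)) (fibArr F (κ.arr f b'))
  -- Splits off the vertical factors; `h₅` then expresses what is left through `xi` and the cleavage
  -- of the codomain.
  have h₄ : (y.tensor (fibArr F φ) (fibArr F φ')).1 =
    (fibMap F ((κ.cart f b).lift φ) ⊗ₘ fibMap F ((κ.cart f b').lift φ')).1 ≫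
      (y.tensor (fibArr F (κ.arr f b)) (fibArr F (κ.arr f b'))).1 :=
    (y.tensor_congr rfl (by simp [← Functor.map_comp]) (by simp [← Functor.map_comp])).trans h₃
  have h₅ : (y.tensor (fibArr F (κ.arr f b)) (fibArr F (κ.arr f b'))).1 = _ :=
    (y.tensor_congr rfl (by simp) (by simp)).trans h₂
  rw [h₁, Functor.map_comp, h₄, Category.assoc, h₅, Category.assoc, ← h]
  exact (Category.assoc _ _ _).symm.trans ((congrArg (· ≫ _) hu).trans (Category.assoc _ _ _))

end FibLax

theorem Layer.PsdStr.ext_hom {J : Type u₁} [Bicategory.{w₁, v₁} J] {C : Type u}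
    [Bicategory.{w, v} C] {L : Layer.{w, v, u, s, t} C} {Φ : J ⥤ᵖ C} {X Y : L.PsdStr Φ}
    (h : X.str = Y.str) (h' : ∀ {a b : J} (f : a ⟶ b), X.hom f ≍ Y.hom f) : X = Y := by
  obtain ⟨x, l, _, _, _, _, _⟩ := X
  obtain ⟨y, k, _, _, _, _, _⟩ := Y
  obtain rfl : x = y := h
  obtain rfl : @l = @k := by
    funext a b f
    exact eq_of_heq (h' f)
  rfl

section OfLax

variable {E : Type u} [Category.{v} E] {p : E ⥤ B} (κ : Cleavage p)

/-- From here on the vertical arrow `lift φ` serves as a coordinate for the arrow `φ` over `f`. This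
and the following lemmas translate the operations on arrows into these coordinates. -/
theorem Cleavage.lift_id {S : B} {a b : p.Fiber S} (u : a ⟶ b) :
    (κ.cart (𝟙 S) b).lift u ≫ κ.unitHom b = u :=
  Subtype.ext ((κ.cart (𝟙 S) b).lift_fac u)

theorem Cleavage.lift_comp {R S T : B} {f : R ⟶ S} {g : S ⟶ T} {a : p.Fiber R} {b : p.Fiber S}
    {c : p.Fiber T} (φ : ArrOver p f a b) (ψ : ArrOver p g b c) :
    (κ.cart (f ≫ g) c).lift (ArrOver.comp φ ψ) ≫ κ.compHom f g c =
      (κ.cart f b).lift φ ≫ κ.map f ((κ.cart g c).lift ψ) :=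
  κ.ext₂ (by simp)

theorem Cleavage.lift_arr {R S : B} (f : R ⟶ S) (a : p.Fiber S) :
    (κ.cart f a).lift (κ.arr f a) = 𝟙 _ :=
  (κ.cart f a).ext (by simp)

/-- Arrows over `f` are determined by the induced vertical arrows. -/
theorem Cleavage.eq_of_lift_eq {R S : B} {f : R ⟶ S} {a : p.Fiber R} {b : p.Fiber S}
    {φ ψ : ArrOver p f a b} (h : (κ.cart f b).lift φ = (κ.cart f b).lift ψ) : φ = ψ := by
  rw [← (κ.cart f b).vcomp_lift φ, h, (κ.cart f b).vcomp_lift]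

theorem Cleavage.lift_compv {R S : B} {f : R ⟶ S} {a : p.Fiber R} {b b' : p.Fiber S}
    (φ : ArrOver p f a b) (u : b ⟶ b') :
    (κ.cart f b').lift (ArrOver.compv φ u) = (κ.cart f b).lift φ ≫ κ.map f u :=
  (κ.cart f b').ext (by simp)

theorem Cleavage.lift_vcomp {R S : B} {f : R ⟶ S} {a a' : p.Fiber R} {b : p.Fiber S}
    (u : a ⟶ a') (φ : ArrOver p f a' b) :
    (κ.cart f b).lift (ArrOver.vcomp u φ) = u ≫ (κ.cart f b).lift φ :=
  (κ.cart f b).ext (by simp)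

theorem Cleavage.compHom_injective {R S T : B} {f : R ⟶ S} {g : S ⟶ T} {a : p.Fiber R}
    {c : p.Fiber T} {u v : a ⟶ κ.obj (f ≫ g) c}
    (h : u ≫ κ.compHom f g c = v ≫ κ.compHom f g c) : u = v :=
  (κ.cart (f ≫ g) c).ext (by
    rw [← κ.compHom_fac]
    have := congrArg (fun w => w.1 ≫ (κ.arr f _).1 ≫ (κ.arr g c).1) h
    simpa using this)

variable [∀ S : B, MonoidalCategory (p.Fiber S)]
  (m : ∀ {R S : B} (f : R ⟶ S) (a b : p.Fiber S), κ.obj f a ⊗ κ.obj f b ⟶ κ.obj f (a ⊗ b))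
  (e : ∀ {R S : B} (f : R ⟶ S), 𝟙_ (p.Fiber R) ⟶ κ.obj f (𝟙_ (p.Fiber S)))

/-- The tensor product of arrows obtained from morphisms `f^* a ⊗ f^* b ⟶ f^*(a ⊗ b)`. -/
noncomputable def pulledTensor {R S : B} {f : R ⟶ S} {a a' : p.Fiber R} {b b' : p.Fiber S}
    (φ : ArrOver p f a b) (φ' : ArrOver p f a' b') : ArrOver p f (a ⊗ a') (b ⊗ b') :=
  ArrOver.vcomp (((κ.cart f b).lift φ ⊗ₘ (κ.cart f b').lift φ') ≫ m f b b') (κ.arr f (b ⊗ b'))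

/-- The unit section obtained from morphisms `I ⟶ f^* I`. -/
noncomputable def pulledUnit {R S : B} (f : R ⟶ S) :
    ArrOver p f (𝟙_ (p.Fiber R)) (𝟙_ (p.Fiber S)) :=
  ArrOver.vcomp (e f) (κ.arr f _)

theorem lift_pulledTensor {R S : B} {f : R ⟶ S} {a a' : p.Fiber R} {b b' : p.Fiber S}
    (φ : ArrOver p f a b) (φ' : ArrOver p f a' b') :
    (κ.cart f (b ⊗ b')).lift (pulledTensor κ m φ φ') =
      ((κ.cart f b).lift φ ⊗ₘ (κ.cart f b').lift φ') ≫ m f b b' :=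
  (κ.cart f _).ext ((κ.cart f _).lift_fac _)

theorem lift_pulledTensor_arr {R S : B} (f : R ⟶ S) (a b : p.Fiber S) :
    (κ.cart f (a ⊗ b)).lift (pulledTensor κ m (κ.arr f a) (κ.arr f b)) = m f a b := by
  rw [lift_pulledTensor, κ.lift_arr, κ.lift_arr, id_tensorHom_id, Category.id_comp]

theorem lift_pulledUnit {R S : B} (f : R ⟶ S) :
    (κ.cart f (𝟙_ (p.Fiber S))).lift (pulledUnit κ e f) = e f :=
  (κ.cart f _).ext ((κ.cart f _).lift_fac _)

/-- The fibred monoidal structure obtained from monoidal structures on inverse image functors. -/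
noncomputable def pulledFibTensor
    (hm : ∀ {R S : B} (f : R ⟶ S) {a b a' b' : p.Fiber S} (u : a ⟶ b) (u' : a' ⟶ b'),
      (κ.map f u ⊗ₘ κ.map f u') ≫ m f b b' = m f a a' ≫ κ.map f (u ⊗ₘ u'))
    (assoc : ∀ {R S : B} (f : R ⟶ S) (a b c : p.Fiber S),
      (m f a b ⊗ₘ 𝟙 (κ.obj f c)) ≫ m f (a ⊗ b) c ≫ κ.map f (α_ a b c).hom =
        (α_ (κ.obj f a) (κ.obj f b) (κ.obj f c)).hom ≫ (𝟙 (κ.obj f a) ⊗ₘ m f b c) ≫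
          m f a (b ⊗ c))
    (left : ∀ {R S : B} (f : R ⟶ S) (a : p.Fiber S), (λ_ (κ.obj f a)).hom =
      (e f ⊗ₘ 𝟙 (κ.obj f a)) ≫ m f (𝟙_ _) a ≫ κ.map f (λ_ a).hom)
    (right : ∀ {R S : B} (f : R ⟶ S) (a : p.Fiber S), (ρ_ (κ.obj f a)).hom =
      (𝟙 (κ.obj f a) ⊗ₘ e f) ≫ m f a (𝟙_ _) ≫ κ.map f (ρ_ a).hom)
    (e_id : ∀ S : B, e (𝟙 S) ≫ κ.unitHom (𝟙_ _) = 𝟙 (𝟙_ (p.Fiber S)))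
    (m_id : ∀ {S : B} (a b : p.Fiber S),
      m (𝟙 S) a b ≫ κ.unitHom (a ⊗ b) = κ.unitHom a ⊗ₘ κ.unitHom b)
    (e_comp : ∀ {R S T : B} (f : R ⟶ S) (g : S ⟶ T),
      e (f ≫ g) ≫ κ.compHom f g (𝟙_ _) = e f ≫ κ.map f (e g))
    (m_comp : ∀ {R S T : B} (f : R ⟶ S) (g : S ⟶ T) (a b : p.Fiber T),
      m (f ≫ g) a b ≫ κ.compHom f g (a ⊗ b) = (κ.compHom f g a ⊗ₘ κ.compHom f g b) ≫
        m f (κ.obj g a) (κ.obj g b) ≫ κ.map f (m g a b)) : FibTensor p where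
  tensor φ φ' := pulledTensor κ m φ φ'
  unit f := pulledUnit κ e f
  tensor_vert u u' := by
    -- Over an identity an arrow is its lift followed by `unitHom`, which `m_id` distributes over
    -- the tensor product.
    have h := κ.lift_id (pulledTensor κ m (f := 𝟙 _) u u')
    rw [lift_pulledTensor, Category.assoc, m_id, tensorHom_comp_tensorHom, κ.lift_id,
      κ.lift_id] at h
    exact h.symm
  -- The lifts along `f ≫ g` are compared in the iterated inverse image, where `m_comp` splits the
  -- structure morphism and `hm` moves it past the lifts of `ψ` and `ψ'`.
  tensor_comp φ φ' ψ ψ' := κ.eq_of_lift_eq <| κ.compHom_injective <| by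
    rw [lift_pulledTensor, Category.assoc, m_comp, κ.lift_comp, lift_pulledTensor,
      lift_pulledTensor, tensorHom_comp_tensorHom_assoc, κ.lift_comp, κ.lift_comp,
      ← tensorHom_comp_tensorHom_assoc, κ.map_comp, reassoc_of% hm, Category.assoc]
  unit_id S := Subtype.ext (congrArg Subtype.val (e_id S))
  unit_comp f g := κ.eq_of_lift_eq <| κ.compHom_injective <| by
    rw [lift_pulledUnit, e_comp, κ.lift_comp, lift_pulledUnit, lift_pulledUnit]
  -- In terms of lifts, the vertical factors pass through the associator of the fibre by its
  -- naturality, and what remains is `assoc`.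
  associator_natural {R S f a a' a'' b b' b''} φ φ' φ'' := congrArg Subtype.val <| κ.eq_of_lift_eq
      (φ := ArrOver.compv _ (α_ b b' b'').hom) (ψ := ArrOver.vcomp (α_ a a' a'').hom _) <| by
    rw [κ.lift_compv, κ.lift_vcomp, lift_pulledTensor, lift_pulledTensor, lift_pulledTensor,
      lift_pulledTensor, ← Category.comp_id ((κ.cart f b'').lift φ''),
      ← tensorHom_comp_tensorHom, Category.assoc, Category.assoc, assoc,
      associator_naturality_assoc, tensorHom_comp_tensorHom_assoc]
    simp only [Category.comp_id]
  leftUnitor_natural {R S f a b} φ := congrArg Subtype.val <| κ.eq_of_lift_eq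
      (φ := ArrOver.compv _ (λ_ b).hom) (ψ := ArrOver.vcomp (λ_ a).hom φ) <| by
    rw [κ.lift_compv, κ.lift_vcomp, lift_pulledTensor, lift_pulledUnit,
      ← MonoidalCategory.leftUnitor_naturality, left, ← id_tensorHom,
      tensorHom_comp_tensorHom_assoc, Category.id_comp, Category.comp_id, Category.assoc]
  rightUnitor_natural {R S f a b} φ := congrArg Subtype.val <| κ.eq_of_lift_eq
      (φ := ArrOver.compv _ (ρ_ b).hom) (ψ := ArrOver.vcomp (ρ_ a).hom φ) <| by
    rw [κ.lift_compv, κ.lift_vcomp, lift_pulledTensor, lift_pulledUnit,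
      ← MonoidalCategory.rightUnitor_naturality, right, ← tensorHom_id,
      tensorHom_comp_tensorHom_assoc, Category.id_comp, Category.comp_id, Category.assoc]

end OfLax

/-- Monoidal structures on the fibres and inverse image functors come from a fibred monoidal
structure. -/
theorem exists_fibMonStr {E : Type u} [Category.{v} E] {p : E ⥤ B} (κ : Cleavage p) (Y : monLayer.{v, u}.PsdStr κ.psd) :
    ∃ x : FibMonStr p, x.psdStr κ = Y := by
  letI mon : ∀ S : B, MonoidalCategory (p.Fiber S) := fun S => Y.str (idx S)
  letI l {R S : B} (f : R ⟶ S) : (κ.pull f).LaxMonoidal := Y.hom (ixHom f)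
  let t : FibTensor p := pulledFibTensor κ (fun f a b => (l f).μ a b) (fun f => (l f).ε)
    (fun f _ _ _ _ u u' => Functor.LaxMonoidal.μ_natural (κ.pull f) u u')
    (fun f a b c => by
      have h := Functor.LaxMonoidal.associativity (κ.pull f) a b c
      rw [← tensorHom_id, ← id_tensorHom] at h
      exact h)
    (fun f a => by
      have h := Functor.LaxMonoidal.left_unitality (κ.pull f) a
      rw [← tensorHom_id] at h
      exact h)
    (fun f a => by
      have h := Functor.LaxMonoidal.right_unitality (κ.pull f) a
      rw [← id_tensorHom] at h
      exact h)
    (fun S => (Y.two_mapId (idx S)).unit)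
    (fun {S} a b => ((Y.two_mapId (idx S)).tensor a b).trans (Category.comp_id _))
    (fun f g => (Y.two_mapComp (ixHom g) (ixHom f)).unit)
    (fun f g a b => (Y.two_mapComp (ixHom g) (ixHom f)).tensor a b)
  refine ⟨⟨mon, t⟩, Layer.PsdStr.ext_hom rfl fun f => heq_of_eq ?_⟩
  -- The structure morphisms induced by the new fibred structure are the lifts of its unit section
  -- and of tensor products of chosen Cartesian arrows, which are the given ones.
  have e := lift_pulledUnit κ (fun f => (l f).ε) (Cleavage.bs f)
  have m := lift_pulledTensor_arr κ (fun f a b => (l f).μ a b) (Cleavage.bs f)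
  exact laxMonoidal_ext (F := κ.pull (Cleavage.bs f)) e m

variable {P Q : BasedCategory.{v, u} B} {x : FibMonStr P.p} {y : FibMonStr Q.p} {F : P ⟶ Q}
  (κ : Cleavage P.p) (κ' : Cleavage Q.p)

theorem FibMonHom.psdHom_injective {h k : FibMonHom x y F}
    (H : FibMonHom.psdHom κ κ' h = FibMonHom.psdHom κ κ' k) : h = k :=
  letI := x.mon
  letI := y.mon
  FibLax.ext_lax fun S => congrFun (congrArg Layer.PsdHom.app H) (idx S)

/-- The condition on the structure cells of `k` is compatibility with inverse images, which together
with naturality in the fibres gives naturality along all arrows. -/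
theorem FibMonHom.psdHom_surjective
    (k : Layer.PsdHom (x.psdStr κ) (y.psdStr κ') (fibTrans κ κ' F)) :
    ∃ h : FibMonHom x y F, FibMonHom.psdHom κ κ' h = k := by
  letI := x.mon
  letI := y.mon
  letI l (S : B) : (fibFun F S).LaxMonoidal := k.app (idx S)
  refine ⟨⟨l, fun {S T f a a' b b'} φ φ' => ?_, fun {S T} f => ?_⟩, rfl⟩
  · exact FibLax.tensor_natural_of_xi κ κ' f (fun {S} a b => (l S).μ a b)
      (fun {_ _ _ _} u u' => Functor.LaxMonoidal.μ_natural (fibFun F S) u u')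
      (k.two_naturality (ixHom f)).tensor φ φ'
  · exact FibLax.unit_natural_of_xi κ κ' f (fun S => (l S).ε) (k.two_naturality (ixHom f)).unit

theorem monLift_isLocalIso (κ : ∀ P : Fibr.{max v₁ v₂, max u₁ u₂} B, Cleavage P.base.p) :
    IsLocalIso (monLift κ).functor :=
  Layer.Lift.isLocalIso _ (fibIndexed_isLocalIso κ) monLayer_rigid.psd
    (Layer.psd_isoFib monLayer_rigid monLayer_isoFib monLayer_homLift monLayer_invClosed)
    (fun y => exists_fibMonStr _ y)
    (fun {P Q _ _ _ _ _} h => FibMonHom.psdHom_injective (κ P) (κ Q) h)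
    (fun {P Q _ _ _} k => FibMonHom.psdHom_surjective (κ P) (κ Q) k) (fun h S => h (idx S))

theorem monIndexed_isLocalIso (κ : ∀ P : Fibr.{max v₁ v₂, max u₁ u₂} B, Cleavage P.base.p) :
    IsLocalIso (monIndexed κ) :=
  (monLift_isLocalIso κ).comp (Layer.psdTotal_isLocalIso monLayer_rigid)

end MonoidalIndexed
end FibMon

namespace FibMon

/-! ### Compatibility with the forgetful 2-functors. -/

section Forgetful

/-- The coherence isomorphisms of a strict pseudo-functor are determined by its action on cells. The
lifted 2-functors act on underlying cells as the original ones by definition, so the squares below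
follow by `rfl`. -/
theorem strictPseudofunctor_ext {C : Type u} [Bicategory.{w, v} C] {D : Type u'}
    [Bicategory.{w', v'} D] {F G : StrictPseudofunctor C D}
    (h : F.toPrelaxFunctorStruct = G.toPrelaxFunctorStruct) : F = G := by
  obtain ⟨⟨⟨⟨F, _, _⟩, i, c, _, _, _, _, _⟩, hi, hi'⟩, hc, hc'⟩ := F
  obtain ⟨⟨⟨⟨G, _, _⟩, j, d, _, _, _, _, _⟩, hj, hj'⟩, hd, hd'⟩ := G
  obtain rfl : F = G := h
  obtain rfl : i = j := funext fun x => (hi' x).trans (hj' x).symm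
  obtain rfl : @c = @d := by
    funext x y z f g
    exact (hc' f g).trans (hd' f g).symm
  rfl

theorem Layer.Lift.functor_comp_forget {C : Type u} [Bicategory.{w, v} C] {D : Type u'}
    [Bicategory.{w', v'} D] {T : StrictPseudofunctor C D} {M : Layer.{w, v, u, s, t} C}
    {N : Layer.{w', v', u', s', t'} D} (l : Lift T M N) :
    l.functor.comp N.forget = M.forget.comp T :=
  strictPseudofunctor_ext rfl

theorem Layer.Lift.functor_comp_psdTotal {C : Type u} [Bicategory.{w, v} C] {D : Type u'}
    [Bicategory.{w', v'} D] {J : Type u₁} [Bicategory.{w₁, v₁} J]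
    {T : StrictPseudofunctor C (Psd J D)} {M : Layer.{w, v, u, s, t} C}
    {N : Layer.{w', v', u', s', t'} D} (l : Lift T M (N.psd J)) :
    (l.functor.comp (N.psdTotal J)).comp (N.psdForget J) = M.forget.comp T :=
  strictPseudofunctor_ext rfl

end Forgetful

/-! ### Strong and symmetric structures over the base. -/

section Restrictions

open MonoidalCategory

variable {B : Type u₁} [Category.{v₁} B]

/-- A vertical isomorphism is Cartesian over the identity, and Cartesian arrows compose. -/
theorem ArrOver.IsCart.vcomp {E : Type u} [Category.{v} E] {p : E ⥤ B} {R S : B} {f : R ⟶ S}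
    {a c : p.Fiber R} {b : p.Fiber S} {φ : ArrOver p f a b} (hφ : φ.IsCart) (u : c ⟶ a) [IsIso u] :
    (ArrOver.vcomp u φ).IsCart := by
  have hu : ArrOver.IsCart (f := 𝟙 R) u := by
    have := u.2
    have : IsIso u.1 := inferInstanceAs (IsIso (Functor.Fiber.fiberInclusion.map u))
    exact Functor.IsStronglyCartesian.of_isIso p (𝟙 R) u.1
  exact (ArrOver.IsCart.comp hu hφ).cast (Category.id_comp f)

/-- Isolates the part of a tensor product of arrows that depends on the fibred structure, namely
`pullμ`; strongness and naturality of the braiding are read off from it. -/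
theorem tensor_eq_vcomp {E : Type u} [Category.{v} E] {p : E ⥤ B}
    [∀ S : B, MonoidalCategory (p.Fiber S)] (x : FibTensor p) (κ : Cleavage p) {R S : B} {f : R ⟶ S}
    {a a' : p.Fiber R} {b b' : p.Fiber S} (φ : ArrOver p f a b) (φ' : ArrOver p f a' b') :
    x.tensor φ φ' = ArrOver.vcomp (((κ.cart f b).lift φ ⊗ₘ (κ.cart f b').lift φ') ≫
      x.pullμ κ f b b') (κ.arr f (b ⊗ b')) := by
  have h := x.tensor_vcomp ((κ.cart f b).lift φ) ((κ.cart f b').lift φ') (κ.arr f b) (κ.arr f b')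
  rw [(κ.cart f b).vcomp_lift, (κ.cart f b').vcomp_lift] at h
  exact Subtype.ext (h.trans (by simp))

/-- Cartesian arrows have invertible lifts, so their tensor product is a chosen Cartesian arrow
preceded by a vertical isomorphism; the unit section is treated alike. -/
theorem isStrong_of_isIso {E : Type u} [Category.{v} E] {p : E ⥤ B} (x : FibMonStr p)
    (κ : Cleavage p)
    (h : letI := x.mon; ∀ {R S : B} (f : R ⟶ S), IsIso (x.ten.pullε κ f) ∧
      ∀ a b, IsIso (x.ten.pullμ κ f a b)) : x.IsStrong := by
  letI := x.mon
  refine ⟨fun {R S f a a' b b'} φ φ' hφ hφ' => ?_, fun f => ?_⟩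
  · have := (h f).2 b b'
    have := (κ.cart f b).isIso_lift hφ
    have := (κ.cart f b').isIso_lift hφ'
    rw [tensor_eq_vcomp x.ten κ]
    exact (κ.cart f _).vcomp _
  · have := (h f).1
    rw [← (κ.cart f _).vcomp_lift (x.ten.unit f)]
    exact (κ.cart f _).vcomp (x.ten.pullε κ f)

/-- On lifts, `h` moves the braiding across `pullμ`, and naturality of the braiding in the fibre
over `R` moves it across the tensor product of the vertical factors. -/
theorem braiding_natural_of_pull {E : Type u} [Category.{v} E] {p : E ⥤ B}
    [∀ S : B, MonoidalCategory (p.Fiber S)] [∀ S : B, SymmetricCategory (p.Fiber S)]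
    (x : FibTensor p) (κ : Cleavage p) {R S : B} {f : R ⟶ S} {a a' : p.Fiber R} {b b' : p.Fiber S}
    (φ : ArrOver p f a b) (φ' : ArrOver p f a' b')
    (h : x.pullμ κ f b b' ≫ κ.map f (β_ b b').hom =
      (β_ (κ.obj f b) (κ.obj f b')).hom ≫ x.pullμ κ f b' b) :
    (x.tensor φ φ').1 ≫ (β_ b b').hom.1 = (β_ a a').hom.1 ≫ (x.tensor φ' φ).1 :=
  congrArg Subtype.val <| κ.eq_of_lift_eq (φ := ArrOver.compv _ (β_ b b').hom)
      (ψ := ArrOver.vcomp (β_ a a').hom _) <| by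
    rw [κ.lift_compv, κ.lift_vcomp, tensor_eq_vcomp x κ, tensor_eq_vcomp x κ, κ.lift_vcomp,
      κ.lift_vcomp, κ.lift_arr, κ.lift_arr, Category.comp_id, Category.comp_id, Category.assoc, h,
      BraidedCategory.braiding_naturality_assoc]

theorem strongLift_str {c : MonFib.{v, u} B} (κ : ∀ P : Fibr.{v, u} B, Cleavage P.base.p)
    (y : (strongLayer.psd (Idx B)).Str ((monIndexed κ).obj c)) :
    ∃ x : (fibStrongLayer B).Str c, (strongLift κ).str x = y :=
  ⟨⟨isStrong_of_isIso c.str (κ c.base) fun f => (Layer.PsdStr.hom y (ixHom f)).down⟩,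
    Layer.PsdStr.ext_hom rfl fun _ => Layer.plift_heq _ _⟩

theorem strongLift_hom {c d : MonFib.{v, u} B} (κ : ∀ P : Fibr.{v, u} B, Cleavage P.base.p)
    {x : (fibStrongLayer B).Str c} {y : (fibStrongLayer B).Str d} {f : c ⟶ d}
    (k : (strongLayer.psd (Idx B)).Hom ((strongLift κ).str x) ((strongLift κ).str y)
      ((monIndexed κ).map f)) : ∃ h : (fibStrongLayer B).Hom x y f, (strongLift κ).hom h = k :=
  ⟨⟨fun S => (Layer.PsdHom.app k (idx S)).down⟩,
    eq_of_heq (Layer.PsdHom.heq rfl fun _ => Layer.plift_heq _ _)⟩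

theorem symLift_str {c : MonFib.{v, u} B} (κ : ∀ P : Fibr.{v, u} B, Cleavage P.base.p)
    (y : (symLayer.psd (Idx B)).Str ((monIndexed κ).obj c)) :
    ∃ x : (fibSymLayer B).Str c, (symLift κ).str x = y := by
  letI := c.str.mon
  letI sym : ∀ S : B, SymmetricCategory (c.base.base.p.Fiber S) :=
    fun S => Layer.PsdStr.str y (idx S)
  refine ⟨⟨sym, fun {R S f a a' b b'} φ φ' => ?_⟩, Layer.PsdStr.ext_hom rfl fun _ => Layer.plift_heq _ _⟩
  have h : c.str.ten.pullμ (κ c.base) f b b' ≫ (κ c.base).map f (β_ b b').hom =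
    (β_ ((κ c.base).obj f b) ((κ c.base).obj f b')).hom ≫ c.str.ten.pullμ (κ c.base) f b' b :=
    (Layer.PsdStr.hom y (ixHom f)).down b b'
  exact braiding_natural_of_pull c.str.ten (κ c.base) φ φ' h

theorem symLift_hom {c d : MonFib.{v, u} B} (κ : ∀ P : Fibr.{v, u} B, Cleavage P.base.p)
    {x : (fibSymLayer B).Str c} {y : (fibSymLayer B).Str d} {f : c ⟶ d}
    (k : (symLayer.psd (Idx B)).Hom ((symLift κ).str x) ((symLift κ).str y)
      ((monIndexed κ).map f)) : ∃ h : (fibSymLayer B).Hom x y f, (symLift κ).hom h = k :=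
  ⟨⟨fun S => (Layer.PsdHom.app k (idx S)).down⟩,
    eq_of_heq (Layer.PsdHom.heq rfl fun _ => Layer.plift_heq _ _)⟩

variable (κ : ∀ P : Fibr.{max v₁ v₂, max u₁ u₂} B, Cleavage P.base.p)

theorem strongIndexed_isLocalIso : IsLocalIso (strongIndexed κ) :=
  (Layer.Lift.isLocalIso (strongLift κ) (monIndexed_isLocalIso κ) strongLayer_rigid.psd
    (Layer.psd_isoFib strongLayer_rigid strongLayer_isoFib strongLayer_homLift
      strongLayer_invClosed) (strongLift_str κ)
    (fun {_ _ _ _ _ _ _} _ => Subsingleton.elim (α := PLift _) _ _) (strongLift_hom κ)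
    fun _ => trivial).comp (Layer.psdTotal_isLocalIso strongLayer_rigid)

theorem symIndexed_isLocalIso : IsLocalIso (symIndexed κ) :=
  (Layer.Lift.isLocalIso (symLift κ) (monIndexed_isLocalIso κ) symLayer_rigid.psd
    (Layer.psd_isoFib symLayer_rigid symLayer_isoFib symLayer_homLift
      symLayer_invClosed) (symLift_str κ)
    (fun {_ _ _ _ _ _ _} _ => Subsingleton.elim (α := PLift _) _ _) (symLift_hom κ)
    fun _ => trivial).comp (Layer.psdTotal_isLocalIso symLayer_rigid)

end Restrictions
end FibMon

namespace FibMon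

namespace Layer

variable {J : Type u₁} [Bicategory.{w₁, v₁} J] {C : Type u} [Bicategory.{w, v} C]
  {N : Layer.{w, v, u, s, t} C} {N' : Layer.{w, v, u, s', t'} C} {Φ Ψ : J ⥤ᵖ C}

/-- The first of two structures on the components of a pseudo-functor. -/
def PsdStr.fst (X : (N.prod N').PsdStr Φ) : N.PsdStr Φ where
  str a := (X.str a).1
  hom f := (X.hom f).1
  two_map₂ α := (X.two_map₂ α).1
  two_mapId a := (X.two_mapId a).1
  two_mapId_inv a := (X.two_mapId_inv a).1
  two_mapComp f g := (X.two_mapComp f g).1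
  two_mapComp_inv f g := (X.two_mapComp_inv f g).1

/-- The second of two structures on the components of a pseudo-functor. -/
def PsdStr.snd (X : (N.prod N').PsdStr Φ) : N'.PsdStr Φ where
  str a := (X.str a).2
  hom f := (X.hom f).2
  two_map₂ α := (X.two_map₂ α).2
  two_mapId a := (X.two_mapId a).2
  two_mapId_inv a := (X.two_mapId_inv a).2
  two_mapComp f g := (X.two_mapComp f g).2
  two_mapComp_inv f g := (X.two_mapComp_inv f g).2

end Layer

/-! ### Combined structures and Cartesian functors. -/

section CartesianFunctors

variable {B : Type u₁} [Category.{v₁} B]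

/-- Strongness and symmetry are independent layers over the monoidal case, so every hypothesis of
`Layer.Lift.isLocalIso` holds because it holds for each factor. -/
theorem strongSymIndexed_isLocalIso
    (κ : ∀ P : Fibr.{max v₁ v₂, max u₁ u₂} B, Cleavage P.base.p) :
    IsLocalIso (strongSymIndexed κ) := by
  have hL : (strongLayer.prod symLayer).Rigid := Layer.Rigid.prod strongLayer_rigid symLayer_rigid
  refine (Layer.Lift.isLocalIso ((strongLift κ).prod (symLift κ)) (monIndexed_isLocalIso κ)
    hL.psd (Layer.psd_isoFib hL (Layer.IsoFib.prod strongLayer_isoFib symLayer_isoFib)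
      (Layer.HomLift.prod strongLayer_homLift symLayer_homLift) strongSym_invClosed)
    (fun {c} y => ?_) (fun {_ _ _ _ _ h k} _ => ?_) (fun {c d x y f} k => ?_)
    fun _ => ⟨trivial, trivial⟩).comp (Layer.psdTotal_isLocalIso hL)
  · obtain ⟨x, hx⟩ := strongLift_str κ (Layer.PsdStr.fst y)
    obtain ⟨x', hx'⟩ := symLift_str κ (Layer.PsdStr.snd y)
    refine ⟨(x, x'), ?_⟩
    change Layer.PsdStr.prod ((strongLift κ).str x) ((symLift κ).str x') = y
    rw [hx, hx']
    rfl
  · exact Prod.ext (Subsingleton.elim (α := PLift _) _ _) (Subsingleton.elim (α := PLift _) _ _)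
  · exact ⟨(⟨fun S => (Layer.PsdHom.app k (idx S)).1.down⟩,
      ⟨fun S => (Layer.PsdHom.app k (idx S)).2.down⟩),
      eq_of_heq (Layer.PsdHom.heq rfl fun _ => heq_of_eq
        (Prod.ext (Subsingleton.elim (α := PLift _) _ _) (Subsingleton.elim (α := PLift _) _ _)))⟩

/-- The image of `φ` is the image of its lift, then `xi`, then a chosen Cartesian arrow. The first
two are invertible, since the lift of a Cartesian arrow is. -/
theorem isCart_fibArr {P Q : BasedCategory.{v, u} B} (κ : Cleavage P.p) (κ' : Cleavage Q.p)
    (F : P ⟶ Q) {R S : B} {f : R ⟶ S} {a : P.p.Fiber R} {b : P.p.Fiber S}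
    (h : IsIso (xi κ κ' F f b)) {φ : ArrOver P.p f a b} (hφ : φ.IsCart) :
    (fibArr F φ).IsCart := by
  have := (κ.cart f b).isIso_lift hφ
  have : IsIso (fibMap F ((κ.cart f b).lift φ)) :=
    inferInstanceAs (IsIso ((fibFun F R).map ((κ.cart f b).lift φ)))
  have e : fibArr F φ = ArrOver.vcomp (fibMap F ((κ.cart f b).lift φ) ≫ xi κ κ' F f b)
      (κ'.arr f (fibObj F b)) :=
    Subtype.ext (by simp [← Functor.map_comp])
  rw [e]
  exact (κ'.cart f _).vcomp _

theorem isStronglyCartesian_map {P Q : Fibr.{v, u} B}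
    (κ : ∀ P : Fibr.{v, u} B, Cleavage P.base.p) {F : P ⟶ Q}
    (h : IsPseudoNatural ((fibIndexed κ).map F)) {R S : B} (f : R ⟶ S) {a b : P.base.obj}
    (φ : a ⟶ b) (hφ : P.base.p.IsStronglyCartesian f φ) :
    Q.base.p.IsStronglyCartesian f ((Layer.Total.Hom.base F).map φ) := by
  have ha : P.base.p.obj a = R := CategoryTheory.IsHomLift.domain_eq P.base.p f φ
  have hb : P.base.p.obj b = S := CategoryTheory.IsHomLift.codomain_eq P.base.p f φ
  -- Pseudo-naturality of the associated transformation is invertibility of all the comparisons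
  -- `xi`.
  have H : IsIso (xiNat (κ P) (κ Q) (Layer.Total.Hom.base F) f).toCatHom₂ := h (ixHom f)
  have : IsIso (xi (κ P) (κ Q) (Layer.Total.Hom.base F) f ⟨b, hb⟩) :=
    ((Cat.Hom.toNatIso (asIso
      (xiNat (κ P) (κ Q) (Layer.Total.Hom.base F) f).toCatHom₂)).app ⟨b, hb⟩).isIso_hom
  exact isCart_fibArr (κ P) (κ Q) (Layer.Total.Hom.base F) (f := f) (a := ⟨a, ha⟩) (b := ⟨b, hb⟩)
    this (φ := ⟨φ, hφ.toIsHomLift⟩) hφ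

/-- Cartesianness concerns the underlying functor only, so the structure is forgotten, once for
monoidal and twice for strong or symmetric functors, before `isStronglyCartesian_map` is applied. -/
theorem IsPseudoNatural.base {J : Type u₁} [Bicategory.{w₁, v₁} J] {D : Type u}
    [Bicategory.{w, v} D] {L : Layer.{w, v, u, s, t} D} {Φ Ψ : Psd J L.Total} {τ : Φ ⟶ Ψ}
    (h : IsPseudoNatural τ) : IsPseudoNatural ((L.psdForget J).map τ) := fun f =>
  have := h f
  (Layer.Total.isoBase (asIso (τ.hom.naturality f))).isIso_hom

variable (κ : ∀ P : Fibr.{max v₁ v₂, max u₁ u₂} B, Cleavage P.base.p)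

theorem cartLift_isLocalIso : IsLocalIso (cartLift κ).functor :=
  Layer.Lift.pseudo_isLocalIso (fibIndexed_isLocalIso κ) (cartLift κ) (fun _ => ⟨⟨trivial⟩⟩)
    (fun _ _ _ h => ⟨⟨fun f _ _ φ hφ => isStronglyCartesian_map κ h f φ hφ⟩⟩)
    (fun _ _ _ => inferInstanceAs (Subsingleton (PLift _))) fun _ _ _ => trivial

theorem monCartLift_isLocalIso : IsLocalIso (monCartLift κ).functor :=
  Layer.Lift.pseudo_isLocalIso (monIndexed_isLocalIso κ) (monCartLift κ) (fun _ => ⟨⟨trivial⟩⟩)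
    (fun _ _ _ h => ⟨⟨fun f _ _ φ hφ => isStronglyCartesian_map κ (IsPseudoNatural.base h) f φ hφ⟩⟩)
    (fun _ _ _ => inferInstanceAs (Subsingleton (PLift _))) fun _ _ _ => trivial

theorem strongCartLift_isLocalIso : IsLocalIso (strongCartLift κ).functor :=
  Layer.Lift.pseudo_isLocalIso (strongIndexed_isLocalIso κ) (strongCartLift κ) (fun _ => ⟨⟨trivial⟩⟩)
    (fun _ _ _ h => ⟨⟨fun f _ _ φ hφ => isStronglyCartesian_map κ (IsPseudoNatural.base (IsPseudoNatural.base h)) f φ hφ⟩⟩)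
    (fun _ _ _ => inferInstanceAs (Subsingleton (PLift _))) fun _ _ _ => trivial

theorem symCartLift_isLocalIso : IsLocalIso (symCartLift κ).functor :=
  Layer.Lift.pseudo_isLocalIso (symIndexed_isLocalIso κ) (symCartLift κ) (fun _ => ⟨⟨trivial⟩⟩)
    (fun _ _ _ h => ⟨⟨fun f _ _ φ hφ => isStronglyCartesian_map κ (IsPseudoNatural.base (IsPseudoNatural.base h)) f φ hφ⟩⟩)
    (fun _ _ _ => inferInstanceAs (Subsingleton (PLift _))) fun _ _ _ => trivial

theorem strongSymCartLift_isLocalIso : IsLocalIso (strongSymCartLift κ).functor :=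
  Layer.Lift.pseudo_isLocalIso (strongSymIndexed_isLocalIso κ) (strongSymCartLift κ) (fun _ => ⟨⟨trivial⟩⟩)
    (fun _ _ _ h => ⟨⟨fun f _ _ φ hφ => isStronglyCartesian_map κ (IsPseudoNatural.base (IsPseudoNatural.base h)) f φ hφ⟩⟩)
    (fun _ _ _ => inferInstanceAs (Subsingleton (PLift _))) fun _ _ _ => trivial

instance pseudoLayer_strict {J : Type u₁} [Bicategory.{w₁, v₁} J] {D : Type u}
    [Bicategory.{w, v} D] [Strict D] : Strict (PsdP J D) :=
  Layer.Rigid.strict (Layer.propLayer_rigid _ _)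

end CartesianFunctors
end FibMon

/-! ### The 2-equivalences and their compatibilities. -/

theorem mainTheorem7 {B : Type u₁} [Category.{v₁} B]
    (κ : ∀ P : FibMon.Fibr.{max v₁ v₂, max u₁ u₂} B, FibMon.Cleavage P.base.p) :
    -- the underlying correspondence between fibrations and indexed categories
    (FibMon.IsTwoEquivalence (FibMon.fibIndexed κ) ∧
      FibMon.IsTwoEquivalence (FibMon.cartLift κ).functor ∧
      (FibMon.cartLift κ).functor.comp (FibMon.pseudoLayer (FibMon.Idx B) Cat).forget =
        (FibMon.fibCartLayer B).forget.comp (FibMon.fibIndexed κ)) ∧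
    -- the monoidal correspondence lifts it
    (FibMon.IsTwoEquivalence (FibMon.monIndexed κ) ∧
      (FibMon.monIndexed κ).comp (FibMon.monLayer.psdForget (FibMon.Idx B)) =
        (FibMon.fibMonLayer B).forget.comp (FibMon.fibIndexed κ)) ∧
    -- it restricts to strong objects and morphisms
    (FibMon.IsTwoEquivalence (FibMon.strongIndexed κ) ∧
      (FibMon.strongIndexed κ).comp (FibMon.strongLayer.psdForget (FibMon.Idx B)) =
        (FibMon.fibStrongLayer B).forget.comp (FibMon.monIndexed κ)) ∧
    -- both restrict to Cartesian functors and pseudo-natural transformations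
    (FibMon.IsTwoEquivalence (FibMon.monCartLift κ).functor ∧
      (FibMon.monCartLift κ).functor.comp
          (FibMon.pseudoLayer (FibMon.Idx B) FibMon.MonCat).forget =
        (FibMon.monCartLayer B).forget.comp (FibMon.monIndexed κ)) ∧
    (FibMon.IsTwoEquivalence (FibMon.strongCartLift κ).functor ∧
      (FibMon.strongCartLift κ).functor.comp
          (FibMon.pseudoLayer (FibMon.Idx B) FibMon.MonCatS).forget =
        ((FibMon.monCartLayer B).onTotal (FibMon.fibStrongLayer B)).forget.comp
          (FibMon.strongIndexed κ)) ∧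
    -- the symmetric variants of the four correspondences
    (FibMon.IsTwoEquivalence (FibMon.symIndexed κ) ∧
      (FibMon.symIndexed κ).comp (FibMon.symLayer.psdForget (FibMon.Idx B)) =
        (FibMon.fibSymLayer B).forget.comp (FibMon.monIndexed κ)) ∧
    (FibMon.IsTwoEquivalence (FibMon.strongSymIndexed κ) ∧
      (FibMon.strongSymIndexed κ).comp
          ((FibMon.strongLayer.prod FibMon.symLayer).psdForget (FibMon.Idx B)) =
        ((FibMon.fibStrongLayer B).prod (FibMon.fibSymLayer B)).forget.comp
          (FibMon.monIndexed κ)) ∧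
    (FibMon.IsTwoEquivalence (FibMon.symCartLift κ).functor ∧
      (FibMon.symCartLift κ).functor.comp
          (FibMon.pseudoLayer (FibMon.Idx B) FibMon.SymMonCat).forget =
        ((FibMon.monCartLayer B).onTotal (FibMon.fibSymLayer B)).forget.comp
          (FibMon.symIndexed κ)) ∧
    (FibMon.IsTwoEquivalence (FibMon.strongSymCartLift κ).functor ∧
      (FibMon.strongSymCartLift κ).functor.comp
          (FibMon.pseudoLayer (FibMon.Idx B) FibMon.SymMonCatS).forget =
        ((FibMon.monCartLayer B).onTotal
          ((FibMon.fibStrongLayer B).prod (FibMon.fibSymLayer B))).forget.comp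
          (FibMon.strongSymIndexed κ)) := by
  refine ⟨⟨?_, ?_, ?_⟩, ⟨?_, ?_⟩, ⟨?_, ?_⟩, ⟨?_, ?_⟩, ⟨?_, ?_⟩, ⟨?_, ?_⟩, ⟨?_, ?_⟩, ⟨?_, ?_⟩,
    ⟨?_, ?_⟩⟩
  · exact (FibMon.fibIndexed_isLocalIso κ).isTwoEquivalence
  · exact (FibMon.cartLift_isLocalIso κ).isTwoEquivalence
  · exact (FibMon.cartLift κ).functor_comp_forget
  · exact (FibMon.monIndexed_isLocalIso κ).isTwoEquivalence
  · exact (FibMon.monLift κ).functor_comp_psdTotal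
  · exact (FibMon.strongIndexed_isLocalIso κ).isTwoEquivalence
  · exact (FibMon.strongLift κ).functor_comp_psdTotal
  · exact (FibMon.monCartLift_isLocalIso κ).isTwoEquivalence
  · exact (FibMon.monCartLift κ).functor_comp_forget
  · exact (FibMon.strongCartLift_isLocalIso κ).isTwoEquivalence
  · exact (FibMon.strongCartLift κ).functor_comp_forget
  · exact (FibMon.symIndexed_isLocalIso κ).isTwoEquivalence
  · exact (FibMon.symLift κ).functor_comp_psdTotal
  · exact (FibMon.strongSymIndexed_isLocalIso κ).isTwoEquivalence
  · exact ((FibMon.strongLift κ).prod (FibMon.symLift κ)).functor_comp_psdTotal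
  · exact (FibMon.symCartLift_isLocalIso κ).isTwoEquivalence
  · exact (FibMon.symCartLift κ).functor_comp_forget
  · exact (FibMon.strongSymCartLift_isLocalIso κ).isTwoEquivalence
  · exact (FibMon.strongSymCartLift κ).functor_comp_forget
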